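/- **Setting.** Let $d\ge 1$, $\alpha>1/2$, let $\boldsymbol\gamma=(\gamma_1,\gamma_2,\dots)$ be positive weights, $t\in(0,1)$, and for $\boldsymbol k\in\mathbb Z^d$ put $r_{\alpha,\boldsymbol\gamma}(\boldsymbol k)=\prod_{j=1}^d\max\{1,|k_j|^\alpha/\gamma_j\}$. For $\boldsymbol k\in\mathbb Z_+^d$ (where $\mathbb Z_+=\{0,1,2,\dots\}$) let $|\boldsymbol k|_0$ be the number of non-zero components and $\phi_{\boldsymbol k}(\boldsymbol x)=(\sqrt2)^{|\boldsymbol k|_0}\prod_{j}\cos(\pi k_jx_j)$. The half-period cosine space $\mathcal C=\mathcal C_{d,\alpha,\boldsymbol\gamma}$ consists of the $f:[0,1]^d\to\mathbb R$ with $f=\sum_{\boldsymbol k\in\mathbb Z_+^d}\widetilde f(\boldsymbol k)\phi_{\boldsymbol k}$ uniformly on $[0,1]^d$, where $\widetilde f(\boldsymbol k)=\int_{[0,1]^d}f\phi_{\boldsymbol k}$, and $\|f\|_{\mathcal C}^2:=\sum_{\boldsymbol k}|\widetilde f(\boldsymbol k)|^2r_{\alpha,\boldsymbol\gamma}^2(\boldsymbol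 k)<\infty$. **Frequencies.** Let $N$ be a prime and let $\{\cdot\}$ denote componentwise fractional parts. For $s\le d$ and $\boldsymbol g\in\mathbb Z^s$ let $P_{\alpha,\boldsymbol\gamma,N}(\boldsymbol g)=\sum r_{\alpha,\boldsymbol\gamma}(\boldsymbol k)^{-2}$, summed over the $\boldsymbol k\in\mathbb Z^s\setminus\{\boldsymbol 0\}$ with $\boldsymbol k\cdot\boldsymbol g\equiv0\pmod N$. The generating vector $\boldsymbol g\in\{1,\dots,N-1\}^d$ is constructed component by component: $g_1=1$, and $g_{s+1}\in\{1,\dots,N-1\}$ minimizes $P_{\alpha,\boldsymbol\gamma,N}(g_1,\dots,g_{s+1})$ (ties are broken arbitrarily); if $\alpha\ge1$, one may instead minimize $P_{\lfloor\alpha\rfloor,\boldsymbol\gamma',N}$ with $\gamma'_j=\gamma_j^{\lfloor\alpha\rfloor/\alpha}$. Put $$M=\sup_{1/\alpha<\lambda\le2}\Big(\frac N2\prod_{j=1}^d(1+2\gamma_j^\lambda\zeta(\alpha\lambda))^{-1}\Big)^{1/\lambda},$$ $A=\{\boldsymbol k\in\mathbb Z^d:r_{\alpha,\boldsymbol\gamma}(\boldsymbol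 k)<M\}$ and $A^+=\{\boldsymbol k\in\mathbb Z_+^d:r_{\alpha,\boldsymbol\gamma}(\boldsymbol k)<M\}$. The fiber of $\boldsymbol\ell\in A$ is $\Gamma(\boldsymbol\ell)=\{\boldsymbol k\in A:\boldsymbol k\cdot\boldsymbol g\equiv\boldsymbol\ell\cdot\boldsymbol g\pmod N\}$; $R$ is the maximal cardinality of a fiber ($R=0$ if $A=\emptyset$), and $\mathcal H^*$ is the set of non-zero differences of two elements of one fiber. **Shifts.** A finite family $Y=(\boldsymbol y_1,\dots,\boldsymbol y_S)$ of shifts is constructed as follows. If $R\le1$, take $S=1$, $\boldsymbol y_1=\boldsymbol 0$. Otherwise: 1. Let $H_j$ be the set of the $\boldsymbol h\in\mathcal H^*$ whose last non-zero component is $h_j$. For $j=1,\dots,d$ in turn, let $z_j$ be the first number in the list $0,1,-1,\dots,\lceil|H_j|/2\rceil,-\lceil|H_j|/2\rceil$ that differs from all integers of the form $-h_j^{-1}\sum_{l<j}h_lz_l$ with $\boldsymbol h\in H_j$. Let $X_{\boldsymbol h}=|\boldsymbol h\cdot\boldsymbol z|$ and $V=\max_{\boldsymbol h\in\mathcal H^*}X_{\boldsymbol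 h}$. 2. For a finite set $P$ of primes let $Y_P$ consist of the points $\{i\boldsymbol z/p\}$, $0\le i<p$, $p\in P$, counted with multiplicity. Let $p_1$ be the smallest prime $\ge 2(R-1)\ln V/(0.32\,t)$, let $k=\max\{1,\lceil2(R-1)\ln V/(t\ln p_1)\rceil\}$, and start with $Y=Y_{\{p_1,\dots,p_k\}}$, where $p_1<\dots<p_k$ are consecutive primes; $S=|Y|$ is always the current number of shifts. Put $p_{\min}=\lfloor(\gamma_1M)^{1/\alpha}\rfloor\lfloor(\gamma_2M)^{1/\alpha}\rfloor/N$, $P=\emptyset$, and call $P$ not frozen. 3. Let $p$ run through the primes $\ge R$ in increasing order as long as $p<S$. For each $p$: (a) if $\big|\sum_{i=0}^{p-1}e^{2\pi\mathrm i\,\boldsymbol h\cdot(i,i^2,\dots,i^d)/p}\big|\le tp/(R-1)$ for all $\boldsymbol h\in\mathcal H^*$, let $Y=(\{(i,i^2,\dots,i^d)/p\})_{0\le i<p}$ and stop; (b) otherwise, if $p\ge p_{\min}$ and $p\nmid X_{\boldsymbol h}$ for all $\boldsymbol h\in\mathcal H^*$, let $Y=Y_{\{p\}}$ and stop; (c)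 otherwise, if $P$ is not frozen, add $p$ to $P$; if then $\sum_{q\in P,\,q\mid X_{\boldsymbol h}}q\le\frac t{R-1}\sum_{q\in P}q$ for all $\boldsymbol h\in\mathcal H^*$, freeze $P$, and if moreover $\sum_{q\in P}q<S$, replace $Y$ by $Y_P$. The final $Y$ is used, and $N_{tot}=NS$. **Approximation.** Let $\boldsymbol\Delta\in[0,1]^d$, $f\in\mathcal C$, $u(\boldsymbol z)=f(\psi(\boldsymbol z))$ with $\psi(z)=1-|2z-1|$ acting componentwise. For a fiber $\Gamma(\boldsymbol\ell)=\{\boldsymbol\ell_1,\dots,\boldsymbol\ell_v\}$ let $B=(e^{2\pi\mathrm i\,\boldsymbol\ell_m\cdot\boldsymbol y_s})_{s,m}\in\mathbb C^{S\times v}$, $D(\boldsymbol\Delta)=\operatorname{diag}(e^{2\pi\mathrm i\,\boldsymbol\ell_m\cdot\boldsymbol\Delta})_m$, and $b_s=\frac1N\sum_{n=0}^{N-1}u(\{n\boldsymbol g/N+\boldsymbol y_s+\boldsymbol\Delta\})e^{-2\pi\mathrm i\,\boldsymbol\ell\cdot n\boldsymbol g/N}$. Let $(\widehat c_{\boldsymbol\ell_1},\dots,\widehat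 c_{\boldsymbol\ell_v})^\top=D(-\boldsymbol\Delta)(B^HB)^{-1}B^H\boldsymbol b$, where the inverse of a singular matrix is read as $0$. Finally $$\mathcal A^{\cos}_{\boldsymbol\Delta}(f)=\sum_{\boldsymbol k\in A^+}\Big(2^{-|\boldsymbol k|_0/2}\sum_{|\boldsymbol h|=\boldsymbol k}\widehat c_{\boldsymbol h}\Big)\phi_{\boldsymbol k},\qquad \mathcal A^{\cos}=\mathcal A^{\cos}_{\boldsymbol 0},$$ where the inner sum is over the $\boldsymbol h\in\mathbb Z^d$ with $|h_j|=k_j$ for all $j$. Its errors are $$e^{\rm wor}_\infty=\sup_{\|f\|_{\mathcal C}\le1}\ \sup_{\boldsymbol x\in[0,1]^d}|f(\boldsymbol x)-\mathcal A^{\cos}(f)(\boldsymbol x)|,\qquad e_2^{\rm ran}=\sup_{\|f\|_{\mathcal C}\le1}\Big(\mathbb E_{\boldsymbol\Delta}\|f-\mathcal A^{\cos}_{\boldsymbol\Delta}(f)\|_{L_2([0,1]^d)}^2\Big)^{1/2}$$ with $\boldsymbol\Delta$ uniformly distributed on $[0,1]^d$. **Theorem (optimal convergence in $\mathcal C_{d,\alpha,\boldsymbol\gamma}$).**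 For every $\tau\in(0,1]$ there are constants $C,C'>0$ depending only on $d,\alpha,\boldsymbol\gamma,t,\tau$ such that for all primes $N$ and all generating vectors $\boldsymbol g$ as above $$e_\infty^{\rm wor}\le C(\log N)^{(d-1)/2}N^{-\alpha+1/2+\tau},\qquad e_\infty^{\rm wor}\le C'(\log N_{tot})^{(2\alpha-2\tau-1/2)d-1/2}N_{tot}^{-\alpha+1/2+\tau},$$ $$e_2^{\rm ran}\le C(\log N)^{(d-1)/2}N^{-\alpha+\tau},\qquad e_2^{\rm ran}\le C'(\log N_{tot})^{(2\alpha-2\tau+1/2)d-1/2}N_{tot}^{-\alpha+\tau}.$$ Moreover, in the first line the first bound is at most the second one whenever $\tau\le\alpha-1/2$, and in the second line whenever $\tau\le\alpha$. -/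

import Mathlib

open scoped ENNReal Matrix

namespace MultiShift

/-! Frequencies are vectors `Fin d → ℤ`, points of the cube are vectors `Fin d → ℝ`, and the
sequence of weights `γ₁, γ₂, …` is `γ 0, γ 1, …`. -/

noncomputable section

/-- The weight function `r_{α,γ}(k) = ∏_j max {1, |k_j|^α / γ_j}`. -/
def weight {d : ℕ} (α : ℝ) (γ : ℕ → ℝ) (k : Fin d → ℤ) : ℝ :=
  ∏ j : Fin d, max 1 (|(k j : ℝ)| ^ α / γ j)

/-! ### The weighted half-period cosine space -/

/-- The unit cube `[0,1]^d`. -/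
def unitCube (d : ℕ) : Set (Fin d → ℝ) := Set.Icc 0 1

/-- `|k|₀`, the number of non-zero components. -/
def numNonzero {d : ℕ} (k : Fin d → ℕ) : ℕ := (Finset.univ.filter fun j => k j ≠ 0).card

/-- The half-period cosine basis function `φ_k(x) = (√2)^{|k|₀} ∏_j cos (π k_j x_j)`. -/
def cosineBasis {d : ℕ} (k : Fin d → ℕ) (x : Fin d → ℝ) : ℝ :=
  Real.sqrt 2 ^ numNonzero k * ∏ j : Fin d, Real.cos (Real.pi * k j * x j)

/-- The cosine coefficient `∫_{[0,1]^d} f(x) φ_k(x) dx`. -/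
def cosineCoeff {d : ℕ} (f : (Fin d → ℝ) → ℝ) (k : Fin d → ℕ) : ℝ :=
  ∫ x in unitCube d, f x * cosineBasis k x

/-- `f` (of which only the values on `[0,1]^d` matter) lies in the weighted half-period cosine
space: its cosine series converges to it uniformly on the cube, and its norm is finite. -/
structure MemCosineSpace {d : ℕ} (α : ℝ) (γ : ℕ → ℝ) (f : (Fin d → ℝ) → ℝ) : Prop where
  hasSum : HasSumUniformlyOn (fun k : Fin d → ℕ => fun x => cosineCoeff f k * cosineBasis k x) f
    (unitCube d)
  summable : Summable fun k : Fin d → ℕ =>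
    cosineCoeff f k ^ 2 * weight α γ (fun j => (k j : ℤ)) ^ 2

/-- The norm of the weighted half-period cosine space. -/
def cosineNorm {d : ℕ} (α : ℝ) (γ : ℕ → ℝ) (f : (Fin d → ℝ) → ℝ) : ℝ :=
  Real.sqrt (∑' k : Fin d → ℕ, cosineCoeff f k ^ 2 * weight α γ (fun j => (k j : ℤ)) ^ 2)

/-- The closed unit ball of the weighted half-period cosine space. -/
def cosineBall (d : ℕ) (α : ℝ) (γ : ℕ → ℝ) : Set ((Fin d → ℝ) → ℝ) :=
  {f | MemCosineSpace α γ f ∧ cosineNorm α γ f ≤ 1}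

/-- The worst-case `L_∞` error of `A` over the unit ball of the cosine space. -/
def worstCaseError (d : ℕ) (α : ℝ) (γ : ℕ → ℝ)
    (A : ((Fin d → ℝ) → ℝ) → (Fin d → ℝ) → ℂ) : ℝ≥0∞ :=
  ⨆ f ∈ cosineBall d α γ, ⨆ x ∈ unitCube d, ‖(f x : ℂ) - A f x‖ₑ

/-- The randomized `L_2` error, over the unit ball of the cosine space, of the family `A Δ`, where
`Δ` is uniformly distributed on `[0,1]^d`. -/
def randomizedError (d : ℕ) (α : ℝ) (γ : ℕ → ℝ)
    (A : (Fin d → ℝ) → ((Fin d → ℝ) → ℝ) → (Fin d → ℝ) → ℂ) : ℝ≥0∞ :=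
  ⨆ f ∈ cosineBall d α γ,
    (∫⁻ Δ in unitCube d, ∫⁻ x in unitCube d, ‖(f x : ℂ) - A Δ f x‖ₑ ^ 2) ^ (1 / 2 : ℝ)

/-! ### The generating vector: component-by-component construction -/

/-- The dual lattice `{k ∈ ℤ^s : k · g ≡ 0 (mod N)}`. -/
def dualLattice {s : ℕ} (N : ℕ) (g : Fin s → ℕ) : Set (Fin s → ℤ) :=
  {k | (N : ℤ) ∣ ∑ j, k j * g j}

/-- The squared worst-case integration error `P_{α,γ,N}(g) = ∑ r_{α,γ}(k)^{-2}`, the sum being over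
the non-zero elements `k` of the dual lattice. -/
def integrationError {s : ℕ} (α : ℝ) (γ : ℕ → ℝ) (N : ℕ) (g : Fin s → ℕ) : ℝ :=
  ∑' k : ↥(dualLattice N g \ {0}), 1 / weight α γ (k : Fin s → ℤ) ^ 2

/-- The first `j + 1` components of `g` (those with index at most `j`). -/
def initialPart {d : ℕ} (g : Fin d → ℕ) (j : Fin d) : Fin (j + 1) → ℕ :=
  fun i => g (Fin.castLE j.isLt i)

/-- `g` is an output of the component-by-component construction: its first component is `1`, and
each later component minimizes `P_{α,γ,N}` over `{1, …, N-1}`, given the preceding ones. -/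
structure IsCBC {d : ℕ} (α : ℝ) (γ : ℕ → ℝ) (N : ℕ) (g : Fin d → ℕ) : Prop where
  mem : ∀ j, g j ∈ Finset.Icc 1 (N - 1)
  first : ∀ j : Fin d, (j : ℕ) = 0 → g j = 1
  minimal : ∀ j : Fin d, (j : ℕ) ≠ 0 → ∀ x ∈ Finset.Icc 1 (N - 1),
    integrationError α γ N (initialPart g j) ≤
      integrationError α γ N (initialPart (Function.update g j x) j)

/-- The generating vectors which the algorithm may use: those obtained by minimizing `P_{α,γ,N}`
itself, and, for `α ≥ 1`, those obtained by minimizing, as a computable substitute,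
`P_{⌊α⌋,γ',N}` with the weights `γ'_j = γ_j ^ (⌊α⌋ / α)`. -/
def IsGeneratingVector {d : ℕ} (α : ℝ) (γ : ℕ → ℝ) (N : ℕ) (g : Fin d → ℕ) : Prop :=
  IsCBC α γ N g ∨ (1 ≤ α ∧ IsCBC (⌊α⌋₊ : ℝ) (fun j => γ j ^ ((⌊α⌋₊ : ℝ) / α)) N g)

/-! ### Truncation parameter, hyperbolic cross and fibers -/

/-- The truncation parameter
`M = sup_{1/α < λ ≤ 2} ((N/2) ∏_{j=1}^d (1 + 2 γ_j^λ ζ(αλ))^{-1})^{1/λ}`. -/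
def truncation (d : ℕ) (α : ℝ) (γ : ℕ → ℝ) (N : ℕ) : ℝ :=
  sSup ((fun l : ℝ => ((N : ℝ) / 2 *
    ∏ j : Fin d, (1 + 2 * γ j ^ l * (riemannZeta ((α * l : ℝ) : ℂ)).re)⁻¹) ^ (1 / l)) ''
      Set.Ioc (1 / α) 2)

/-- The hyperbolic cross `{k ∈ ℤ^d : r_{α,γ}(k) < M}` as a finite set
(see `mem_hyperbolicCross`). -/
def hyperbolicCross (d : ℕ) (α : ℝ) (γ : ℕ → ℝ) (M : ℝ) : Finset (Fin d → ℤ) :=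
  (Fintype.piFinset fun j : Fin d =>
    Finset.Icc (-⌈(γ j * M) ^ (1 / α)⌉) ⌈(γ j * M) ^ (1 / α)⌉).filter fun k => weight α γ k < M

theorem one_le_weight {d : ℕ} (α : ℝ) (γ : ℕ → ℝ) (k : Fin d → ℤ) : 1 ≤ weight α γ k :=
  Finset.one_le_prod fun _ _ => le_max_left _ _

theorem abs_le_of_weight_lt {d : ℕ} {α : ℝ} {γ : ℕ → ℝ} {M : ℝ} (hα : 0 < α)
    (hγ : ∀ j, 0 < γ j) {k : Fin d → ℤ} (hk : weight α γ k < M) (j : Fin d) :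
    |(k j : ℝ)| ≤ (γ j * M) ^ (1 / α) := by
  have h1 : |(k j : ℝ)| ^ α / γ j ≤ weight α γ k := by
    refine (le_max_right 1 _).trans ?_
    unfold weight
    rw [← Finset.mul_prod_erase _ _ (Finset.mem_univ j)]
    refine le_mul_of_one_le_right (zero_le_one.trans (le_max_left _ _)) ?_
    exact Finset.one_le_prod fun _ _ => le_max_left _ _
  have h2 : |(k j : ℝ)| ^ α ≤ γ j * M := by
    have := (div_le_iff₀ (hγ j)).1 (h1.trans hk.le)
    linarith
  calc |(k j : ℝ)| = (|(k j : ℝ)| ^ α) ^ (1 / α) := by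
        rw [← Real.rpow_mul (abs_nonneg _), mul_one_div_cancel hα.ne', Real.rpow_one]
    _ ≤ _ := Real.rpow_le_rpow (by positivity) h2 (by positivity)

theorem mem_hyperbolicCross {d : ℕ} {α : ℝ} {γ : ℕ → ℝ} {M : ℝ} (hα : 0 < α)
    (hγ : ∀ j, 0 < γ j) {k : Fin d → ℤ} :
    k ∈ hyperbolicCross d α γ M ↔ weight α γ k < M := by
  simp only [hyperbolicCross, Finset.mem_filter, Fintype.mem_piFinset, Finset.mem_Icc,
    and_iff_right_iff_imp]
  intro hk j
  have h := (abs_le_of_weight_lt hα hγ hk j).trans (Int.le_ceil _)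
  rw [← abs_le]
  exact_mod_cast h

/-- The set `{k ∈ ℤ₊^d : r_{α,γ}(k) < M}`, i.e. the elements of the hyperbolic cross without
negative components. -/
def positiveCross (d : ℕ) (α : ℝ) (γ : ℕ → ℝ) (M : ℝ) : Finset (Fin d → ℕ) :=
  (Fintype.piFinset fun j : Fin d => Finset.range (⌈(γ j * M) ^ (1 / α)⌉₊ + 1)).filter
    fun k => weight α γ (fun j => (k j : ℤ)) < M

theorem mem_positiveCross {d : ℕ} {α : ℝ} {γ : ℕ → ℝ} {M : ℝ} (hα : 0 < α)
    (hγ : ∀ j, 0 < γ j) {k : Fin d → ℕ} :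
    k ∈ positiveCross d α γ M ↔ weight α γ (fun j => (k j : ℤ)) < M := by
  simp only [positiveCross, Finset.mem_filter, Fintype.mem_piFinset, Finset.mem_range,
    and_iff_right_iff_imp]
  intro hk j
  have h := (abs_le_of_weight_lt hα hγ hk j).trans (Nat.le_ceil _)
  have h' : ((k j : ℕ) : ℝ) ≤ (⌈(γ j * M) ^ (1 / α)⌉₊ : ℝ) := by simpa using h
  exact Nat.lt_succ_of_le (by exact_mod_cast h')

/-- The fiber of `l` in the frequency set `A`: the `k ∈ A` with `k · g ≡ l · g (mod N)`. -/
def fiber {d : ℕ} (A : Finset (Fin d → ℤ)) (N : ℕ) (g : Fin d → ℕ) (l : Fin d → ℤ) :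
    Finset (Fin d → ℤ) :=
  A.filter fun k => (N : ℤ) ∣ ∑ j, (k j - l j) * g j

/-- The maximum fiber length `R` (it is `0` if `A` is empty). -/
def maxFiber {d : ℕ} (A : Finset (Fin d → ℤ)) (N : ℕ) (g : Fin d → ℕ) : ℕ :=
  A.sup fun l => (fiber A N g l).card

/-- The set `ℋ \ {0}` of the non-zero differences of two elements of one fiber. -/
def fiberDiffs {d : ℕ} (A : Finset (Fin d → ℤ)) (N : ℕ) (g : Fin d → ℕ) :
    Finset (Fin d → ℤ) :=
  (A.biUnion fun l => (fiber A N g l).image fun k => k - l).erase 0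

/-! ### Construction of the shifts -/

/-- The projection `h · z`. -/
def dot {d : ℕ} (h z : Fin d → ℤ) : ℤ := ∑ j, h j * z j

/-- The elements of `H` whose rightmost non-zero component has index `j`. -/
def activeRows {d : ℕ} (H : Finset (Fin d → ℤ)) (j : Fin d) : Finset (Fin d → ℤ) :=
  H.filter fun h => h j ≠ 0 ∧ ∀ l, j < l → h l = 0

/-- The list `0, 1, -1, 2, -2, …, n, -n`. -/
def symmetricList (n : ℕ) : List ℤ :=
  0 :: (List.range n).flatMap fun i => [(i : ℤ) + 1, -((i : ℤ) + 1)]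

/-- The values forbidden for the `j`-th component of the projection vector, given its preceding
components. -/
def forbidden {d : ℕ} (H : Finset (Fin d → ℤ)) (z : Fin d → ℤ) (j : Fin d) : Finset ℤ :=
  ((activeRows H j).filter fun h => h j ∣ ∑ l ∈ Finset.Iio j, h l * z l).image
    fun h => -(∑ l ∈ Finset.Iio j, h l * z l) / h j

/-- The state of the symmetric component-by-component construction after `n` steps. -/
def projectionSteps {d : ℕ} (H : Finset (Fin d → ℤ)) : ℕ → Fin d → ℤ
  | 0 => 0
  | n + 1 =>
    if hn : n < d then
      Function.update (projectionSteps H n) ⟨n, hn⟩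
        (((symmetricList (((activeRows H ⟨n, hn⟩).card + 1) / 2)).find? fun x =>
          decide (x ∉ forbidden H (projectionSteps H n) ⟨n, hn⟩)).getD 0)
    else projectionSteps H n

/-- The projection vector `z` constructed for the set `H` of non-zero vectors. -/
def projectionVector {d : ℕ} (H : Finset (Fin d → ℤ)) : Fin d → ℤ := projectionSteps H d

/-- The smallest prime that is at least `n`. -/
def nextPrime (n : ℕ) : ℕ := Nat.find (Nat.exists_infinite_primes n)

theorem le_nextPrime (n : ℕ) : n ≤ nextPrime n := (Nat.find_spec (Nat.exists_infinite_primes n)).1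

theorem nextPrime_prime (n : ℕ) : (nextPrime n).Prime :=
  (Nat.find_spec (Nat.exists_infinite_primes n)).2

/-- The `k` consecutive primes beginning with the prime `p`. -/
def consecutivePrimes (p k : ℕ) : List ℕ :=
  (List.range k).map fun i => (fun q => nextPrime (q + 1))^[i] p

/-- The lattice `{i z / p}`, `i = 0, …, p - 1`, as a list of `p` shifts. -/
def latticeShifts {d : ℕ} (z : Fin d → ℤ) (p : ℕ) : List (Fin d → ℝ) :=
  (List.range p).map fun i => fun j => Int.fract ((i : ℝ) * z j / p)

/-- The union, with multiplicities, of the lattices `{i z / p}` for the listed primes `p`. -/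
def multiLatticeShifts {d : ℕ} (z : Fin d → ℤ) (P : List ℕ) : List (Fin d → ℝ) :=
  P.flatMap fun p => latticeShifts z p

theorem length_multiLatticeShifts {d : ℕ} (z : Fin d → ℤ) (P : List ℕ) :
    (multiLatticeShifts z P).length = P.sum := by
  simp [multiLatticeShifts, latticeShifts, List.length_flatMap]

/-- The polynomial curve `(i, i², …, i^d) / p mod 1`, `i = 0, …, p - 1`. -/
def polynomialShifts (d p : ℕ) : List (Fin d → ℝ) :=
  (List.range p).map fun i => fun j => Int.fract ((i : ℝ) ^ ((j : ℕ) + 1) / p)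

/-- The character `exp (2 π i k · x)`. -/
def fourierChar {d : ℕ} (k : Fin d → ℤ) (x : Fin d → ℝ) : ℂ :=
  Complex.exp (2 * Real.pi * Complex.I * ((∑ j, (k j : ℝ) * x j : ℝ) : ℂ))

/-- The exponential sum `∑_s exp (2 π i h · y_s)`. -/
def expSum {d : ℕ} (Y : List (Fin d → ℝ)) (h : Fin d → ℤ) : ℂ :=
  (Y.map fun y => fourierChar h y).sum

/-- The a priori primes: with `V = max_h |h · z|`, the first one is the smallest prime
`p₁ ≥ 2 (R - 1) ln V / (c t)`, where `c = 0.32`, and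
there are `k = ⌈2 (R - 1) ln V / (t ln p₁)⌉` of them. At least one prime is always taken;
this matters only if `V = 1`. -/
def ceilingPrimes {d : ℕ} (H : Finset (Fin d → ℤ)) (R : ℕ) (t : ℝ) (z : Fin d → ℤ) : List ℕ :=
  let V : ℕ := H.sup fun h => (dot h z).natAbs
  let p₁ : ℕ := nextPrime ⌈2 * ((R : ℝ) - 1) * Real.log V / (0.32 * t)⌉₊
  consecutivePrimes p₁ (max 1 ⌈2 * ((R : ℝ) - 1) * Real.log V / (t * Real.log p₁)⌉₊)

/-- Acceptance test of the polynomial strategy. -/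
def PolynomialTest {d : ℕ} (H : Finset (Fin d → ℤ)) (R : ℕ) (t : ℝ) (p : ℕ) : Prop :=
  ∀ h ∈ H, ‖expSum (polynomialShifts d p) h‖ ≤ t * p / ((R : ℝ) - 1)

/-- Acceptance test of the single-lattice strategy. -/
def SingleTest {d : ℕ} (H : Finset (Fin d → ℤ)) (z : Fin d → ℤ) (pmin : ℝ) (p : ℕ) : Prop :=
  pmin ≤ p ∧ ∀ h ∈ H, ¬ (p : ℤ) ∣ dot h z

/-- Acceptance test of the greedy multi-lattice strategy for the accumulated primes `P`. -/
def GreedyTest {d : ℕ} (H : Finset (Fin d → ℤ)) (R : ℕ) (t : ℝ) (z : Fin d → ℤ)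
    (P : List ℕ) : Prop :=
  ∀ h ∈ H, ((P.filter fun q => decide ((q : ℤ) ∣ dot h z)).sum : ℝ) / (P.sum : ℝ) ≤
    t / ((R : ℝ) - 1)

open Classical in
/-- The while-loop of the adaptive construction: `p` is the current prime, `best` the best list of
shifts so far (so `S_best` is its length), `P` the list of the primes accumulated by the greedy
strategy, and `found` tells whether the greedy accumulation is frozen. -/
def adaptiveLoop {d : ℕ} (H : Finset (Fin d → ℤ)) (R : ℕ) (t : ℝ) (z : Fin d → ℤ) (pmin : ℝ)
    (p : ℕ) (best : List (Fin d → ℝ)) (P : List ℕ) (found : Bool) : List (Fin d → ℝ) :=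
  if p < best.length then
    if PolynomialTest H R t p then polynomialShifts d p
    else if SingleTest H z pmin p then latticeShifts z p
    else if found = true then
      adaptiveLoop H R t z pmin (nextPrime (p + 1)) best P true
    else if GreedyTest H R t z (P ++ [p]) then
      if (P ++ [p]).sum < best.length then
        adaptiveLoop H R t z pmin (nextPrime (p + 1)) (multiLatticeShifts z (P ++ [p]))
          (P ++ [p]) true
      else adaptiveLoop H R t z pmin (nextPrime (p + 1)) best (P ++ [p]) true
    else adaptiveLoop H R t z pmin (nextPrime (p + 1)) best (P ++ [p]) false
  else best
termination_by best.length - p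
decreasing_by
  all_goals
    have h1 := le_nextPrime (p + 1)
    have h2 := length_multiLatticeShifts z (P ++ [p])
    omega

/-- The adaptive deterministic construction of the shifts. -/
def adaptiveShifts {d : ℕ} (α : ℝ) (γ : ℕ → ℝ) (N : ℕ) (g : Fin d → ℕ) (t : ℝ) :
    List (Fin d → ℝ) :=
  let M := truncation d α γ N
  let A := hyperbolicCross d α γ M
  let R := maxFiber A N g
  let H := fiberDiffs A N g
  let z := projectionVector H
  if R ≤ 1 then [0]
  else adaptiveLoop H R t z
    ((⌊(γ 0 * M) ^ (1 / α)⌋₊ : ℝ) * (⌊(γ 1 * M) ^ (1 / α)⌋₊ : ℝ) / N)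
    (nextPrime R) (multiLatticeShifts z (ceilingPrimes H R t z)) [] false

/-! ### The approximation -/

/-- The tent transformation `ψ(z) = 1 - |2 z - 1|`, componentwise. -/
def tent {d : ℕ} (z : Fin d → ℝ) : Fin d → ℝ := fun j => 1 - |2 * z j - 1|

/-- The observation
`(1/N) ∑_{n<N} u({n g / N + y}) exp (-2 π i l · (n g / N))`. It is the same for all frequencies `l`
of a fiber. -/
def observation {d : ℕ} (N : ℕ) (g : Fin d → ℕ) (u : (Fin d → ℝ) → ℝ) (l : Fin d → ℤ)
    (y : Fin d → ℝ) : ℂ :=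
  (1 / N : ℂ) * ∑ n ∈ Finset.range N,
    (u (fun j => Int.fract ((n : ℝ) * g j / N + y j)) : ℂ) *
      fourierChar (-l) (fun j => (n : ℝ) * g j / N)

/-- The system matrix `B_{s,m} = exp (2 π i l_m · y_s)` of the fiber of `k`. -/
def systemMatrix {d : ℕ} (A : Finset (Fin d → ℤ)) (N : ℕ) (g : Fin d → ℕ)
    (Y : List (Fin d → ℝ)) (k : Fin d → ℤ) : Matrix (Fin Y.length) (fiber A N g k) ℂ :=
  Matrix.of fun s m => fourierChar m.1 (Y.get s)

/-- The least-squares estimate of the Fourier coefficients of `u` on the fiber of `k`: the vector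
`D(-Δ) (Bᴴ B)⁻¹ Bᴴ b(Δ)` with `b_s(Δ)` the observation at the shift `y_s + Δ`. -/
def fiberEstimate {d : ℕ} (A : Finset (Fin d → ℤ)) (N : ℕ) (g : Fin d → ℕ)
    (Y : List (Fin d → ℝ)) (Δ : Fin d → ℝ) (u : (Fin d → ℝ) → ℝ) (k : Fin d → ℤ) :
    fiber A N g k → ℂ :=
  let B := systemMatrix A N g Y k
  (Matrix.diagonal (fun m : fiber A N g k => fourierChar m.1 (-Δ)) * (Bᴴ * B)⁻¹ * Bᴴ) *ᵥ
    fun s => observation N g u k (Y.get s + Δ)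

/-- The approximated Fourier coefficient of `u` at the frequency `k ∈ A`. -/
def coeffEstimate {d : ℕ} (A : Finset (Fin d → ℤ)) (N : ℕ) (g : Fin d → ℕ)
    (Y : List (Fin d → ℝ)) (Δ : Fin d → ℝ) (u : (Fin d → ℝ) → ℝ) (k : Fin d → ℤ) : ℂ :=
  if hk : k ∈ fiber A N g k then fiberEstimate A N g Y Δ u k ⟨k, hk⟩ else 0

/-- The multiple-shift approximation in the cosine space: with `ĉ_h` the approximated Fourier
coefficients of `f ∘ ψ`, it is `∑_{k ∈ A⁺} c̃_k φ_k`, where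
`c̃_k = 2^{-|k|₀/2} ∑_{|h| = k} ĉ_h`. -/
def cosineApprox {d : ℕ} (α : ℝ) (γ : ℕ → ℝ) (N : ℕ) (g : Fin d → ℕ) (Y : List (Fin d → ℝ))
    (Δ : Fin d → ℝ) (f : (Fin d → ℝ) → ℝ) (x : Fin d → ℝ) : ℂ :=
  let M := truncation d α γ N
  let A := hyperbolicCross d α γ M
  ∑ k ∈ positiveCross d α γ M,
    (1 / (Real.sqrt 2 : ℂ) ^ numNonzero k *
      ∑ h ∈ A.filter (fun h => ∀ j, (h j).natAbs = k j),
        coeffEstimate A N g Y Δ (fun z => f (tent z)) h) * (cosineBasis k x : ℂ)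

end

end MultiShift

/-! Write u = f ∘ ψ. Since cos(πnψ(x)) = cos(2πnx) on [0,1], u has an absolutely convergent Fourier
series: each cosine coefficient of f is spread evenly over the sign changes of its frequency, and
the weighted norm is preserved (`tsum_energyTerm_le`). For k in A, a lattice average at the shift y
sees the sum of û(h) e(h·y) over all h with h·g ≡ k·g (mod N) (`hasSum_observation`). The h in A
form the fiber, which the shifts must resolve; the other h are aliasing noise.

Stability. The Gram matrix of a fiber has the entries Σ_s e((n-m)·y_s). If the off-diagonal ones are
at most tS/(R-1), a Gershgorin argument bounds the matrix below by (1-t)S, so least squares is exact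
on the fiber and amplifies noise by a constant only (`gram_lower_bound`, `leastSquares_bound`). Each
acceptance test of the adaptive loop implies this condition, and the loop never lengthens the family
it starts from (`adaptiveLoop_spec`). The a priori family satisfies the condition because few primes
divide a non-zero h·z, their product being at most V. That family has O((R log V + 1)²) members
(`ceilingPrimes_spec`); for this its primes must lie in [p₁, 2p₁], which is the explicit Chebyshev
bound `le_card_bertrandPrimes`.

Fibers. In the component-by-component construction the minimum is at most the mean; together with
Jensen's inequality this forces every non-zero dual vector to have weight at least M/C
(`exists_truncation_le_weight`). Elements of a fiber are therefore far apart, and the pigeonhole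
principle over dyadic boxes gives R = O((log N)^(d-1)) (`card_le_of_separated`). Since log V = O(log
N), also S = O((log N)^(2d)).

Errors. A frequency outside A pollutes at most R frequencies of A (`sum_congruent_le`), so the error
is governed by R and the tail of û outside A: its ℓ¹ norm in the worst case, its ℓ² norm in the
randomized case, where averaging over Δ makes the aliasing terms orthogonal. As M is at least of
order N^(α-ε) and R is at most of order N^ε, the rates N^(-α+1/2+ε) and N^(-α+ε) follow for every ε
> 0.

Logarithms. As ε is arbitrary, the factor (log N)^((d-1)/2) comes for free. The power of log Ntot is
what S = O((log N)^(2d)) produces when the exponent of N is non-positive; for a positive exponent a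
smaller ε absorbs it (`exists_log_bounds`). -/

namespace MultiShift

noncomputable section

/-! ### Primes between `x` and `2 x` -/

/-- The primes in the interval `(n, 2n]`. -/
def bertrandPrimes (n : ℕ) : Finset ℕ := (Finset.Ioc n (2 * n)).filter Nat.Prime

/-- Erdős' analysis of the prime powers in binom(2n, n): primes up to √(2n) contribute at most 2n
each, further ones up to 2n/3 at most themselves (a primorial in total), those in (2n/3, n] nothing,
those in (n, 2n] at most 2n each. Keeping the last factor turns the proof of Bertrand's postulate
into a lower bound for the number of primes. -/
theorem centralBinom_le_bertrandPrimes {n : ℕ} (hn : 2 < n) :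
    n.centralBinom ≤ (2 * n) ^ Nat.sqrt (2 * n) * 4 ^ (2 * n / 3) *
      (2 * n) ^ (bertrandPrimes n).card := by
  have n2 : 1 ≤ 2 * n := by omega
  set S := (Finset.range (2 * n + 1)).filter Nat.Prime with hS
  let f := fun x => x ^ n.centralBinom.factorization x
  have h1 : ∏ p ∈ S, f p = n.centralBinom := by
    rw [← n.prod_pow_factorization_centralBinom]
    refine Finset.prod_filter_of_ne fun p _ h => ?_
    contrapose h
    simp [f, Nat.factorization_eq_zero_of_not_prime _ h]
  have h2 : ∀ p ∈ S, f p ≤ ((if p ≤ Nat.sqrt (2 * n) then 2 * n else 1) *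
      (if p ≤ 2 * n / 3 then p else 1)) * (if n < p then 2 * n else 1) := by
    intro p hp
    obtain ⟨hp1, hp2⟩ := Finset.mem_filter.1 hp
    have hpp := hp2.one_lt
    have hp3 : p ≤ 2 * n := by simpa [Nat.lt_succ_iff] using hp1
    have ha : 1 ≤ (if p ≤ Nat.sqrt (2 * n) then 2 * n else 1) := by split_ifs <;> omega
    have hb : 1 ≤ (if p ≤ 2 * n / 3 then p else 1) := by split_ifs <;> omega
    have hc : 1 ≤ (if n < p then 2 * n else 1) := by split_ifs <;> omega
    by_cases h : p ≤ Nat.sqrt (2 * n)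
    · have h4 : f p ≤ 2 * n := Nat.pow_factorization_choose_le (by omega)
      rw [if_pos h]
      calc f p ≤ 2 * n * 1 * 1 := by simpa using h4
        _ ≤ _ := Nat.mul_le_mul (Nat.mul_le_mul le_rfl hb) hc
    have h4 : f p ≤ p := (Nat.pow_le_pow_right hp2.pos
      (Nat.factorization_choose_le_one (Nat.sqrt_lt'.mp (not_le.1 h)))).trans (pow_one p).le
    by_cases h5 : p ≤ 2 * n / 3
    · rw [if_pos h5]
      calc f p ≤ 1 * p * 1 := by simpa using h4
        _ ≤ _ := Nat.mul_le_mul (Nat.mul_le_mul ha le_rfl) hc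
    by_cases h6 : n < p
    · rw [if_pos h6]
      calc f p ≤ 1 * 1 * (2 * n) := by simpa using h4.trans hp3
        _ ≤ _ := Nat.mul_le_mul (Nat.mul_le_mul ha hb) le_rfl
    · have : f p = 1 := by
        simp only [f]
        rw [Nat.factorization_centralBinom_of_two_mul_self_lt_three_mul hn (by omega) (by omega),
          pow_zero]
      rw [this]
      exact Nat.mul_pos (Nat.mul_pos ha hb) hc
  rw [← h1]
  refine (Finset.prod_le_prod' h2).trans ?_
  rw [Finset.prod_mul_distrib, Finset.prod_mul_distrib]
  refine Nat.mul_le_mul (Nat.mul_le_mul ?_ ?_) ?_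
  · rw [Finset.prod_ite, Finset.prod_const, Finset.prod_const_one, mul_one]
    refine Nat.pow_le_pow_right n2 ?_
    calc _ ≤ (Finset.Icc 1 (Nat.sqrt (2 * n))).card := Finset.card_le_card fun x hx => by
            simp only [hS, Finset.mem_filter] at hx
            exact Finset.mem_Icc.2 ⟨hx.1.2.one_lt.le, hx.2⟩
      _ = _ := by simp
  · refine le_trans ?_ (primorial_le_four_pow (2 * n / 3))
    rw [Finset.prod_ite, Finset.prod_const_one, mul_one, primorial]
    refine Finset.prod_le_prod_of_subset_of_one_le' (fun p hp => ?_) fun p hp _ => ?_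
    · simp only [hS, Finset.mem_filter, Finset.mem_range] at hp ⊢
      exact ⟨by omega, hp.1.2⟩
    · exact (Finset.mem_filter.1 hp).2.one_lt.le
  · rw [Finset.prod_ite, Finset.prod_const, Finset.prod_const_one, mul_one]
    refine Nat.pow_le_pow_right n2 (Finset.card_le_card fun p hp => ?_)
    simp only [hS, Finset.mem_filter, Finset.mem_range, bertrandPrimes, Finset.mem_Ioc] at hp ⊢
    exact ⟨⟨hp.2, by omega⟩, hp.1.2⟩

/-- Logarithms of 4ⁿ < n binom(2n, n) leave the main term (n/3) log 4 ≈ 0.462 n; the losses of order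
√n log n stay below 0.12 n from n = 2^14 on. -/
theorem le_card_bertrandPrimes_of_large {n : ℕ} (hn : 16384 ≤ n) :
    0.32 * (n : ℝ) ≤ Real.log n * (bertrandPrimes n).card := by
  set c := (bertrandPrimes n).card
  have hn0 : (0 : ℝ) < n := by exact_mod_cast (by omega : 0 < n)
  have hnR : (16384 : ℝ) ≤ n := by exact_mod_cast hn
  have h1 : (4 : ℝ) ^ n ≤ n * ((2 * n) ^ Nat.sqrt (2 * n) * 4 ^ (2 * n / 3) * (2 * n) ^ c) := by
    have h := (Nat.four_pow_lt_mul_centralBinom n (by omega)).le.trans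
      (Nat.mul_le_mul_left n (centralBinom_le_bertrandPrimes (by omega)))
    exact_mod_cast h
  have h2 := Real.log_le_log (by positivity) h1
  rw [Real.log_mul (by positivity) (by positivity), Real.log_mul (by positivity) (by positivity),
    Real.log_mul (by positivity) (by positivity), Real.log_pow, Real.log_pow, Real.log_pow,
    Real.log_pow] at h2
  set w : ℝ := Real.sqrt (2 * n) with hw
  have hw2 : w ^ 2 = 2 * n := Real.sq_sqrt (by positivity)
  have hw0 : (181 : ℝ) ≤ w := Real.le_sqrt_of_sq_le (by norm_num; linarith)
  have hl2 := Real.log_two_gt_d9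
  have hl2' := Real.log_two_lt_d9
  have hl4 : Real.log 4 = 2 * Real.log 2 := by
    rw [show (4 : ℝ) = 2 ^ 2 by norm_num, Real.log_pow]; norm_num
  have hl2n : Real.log (2 * n) = Real.log 2 + Real.log n := Real.log_mul (by norm_num) hn0.ne'
  have hlog : 14 * Real.log 2 ≤ Real.log n := by
    have := Real.log_le_log (by norm_num) hnR
    rwa [show (16384 : ℝ) = 2 ^ 14 by norm_num, Real.log_pow, Nat.cast_ofNat] at this
  -- Tangent of the logarithm at w = 181, where 181² ≤ 2^15: here 15 log 2 - 2 < 8.4 and 2/181 <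
  -- 0.01105.
  have hup : Real.log (2 * n) ≤ 8.4 + 0.01105 * w := by
    have h3 : Real.log (w ^ 2 / 2 ^ 15) ≤ 2 * (w / 181 - 1) := by
      have h4 : Real.log (w / 181) ≤ w / 181 - 1 := Real.log_le_sub_one_of_pos (by positivity)
      have h5 : Real.log (w ^ 2 / 2 ^ 15) ≤ Real.log ((w / 181) ^ 2) := by
        refine Real.log_le_log (by positivity) ?_
        rw [div_pow]
        gcongr
        norm_num
      rw [Real.log_pow, Nat.cast_ofNat] at h5
      linarith
    rw [Real.log_div (by positivity) (by positivity), hw2, Real.log_pow] at h3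
    push_cast at h3
    linarith
  have hs : ((Nat.sqrt (2 * n) : ℕ) : ℝ) ≤ w := by
    have := @Real.nat_sqrt_le_real_sqrt (2 * n)
    simpa [hw] using this
  have ht : ((2 * n / 3 : ℕ) : ℝ) ≤ 2 * n / 3 := by
    have := @Nat.cast_div_le ℝ _ _ _ (2 * n) 3
    simpa using this
  have hL : 0 < Real.log (2 * n) := by linarith
  have hA : (Nat.sqrt (2 * n) : ℝ) * Real.log (2 * n) ≤ w * (8.4 + 0.01105 * w) :=
    mul_le_mul hs hup hL.le (by positivity)
  have hB : ((2 * n / 3 : ℕ) : ℝ) * Real.log 4 ≤ 2 * n / 3 * Real.log 4 :=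
    mul_le_mul_of_nonneg_right ht (by linarith)
  -- 0.34286 is just above 0.32 · 15/14; the factor 15/14 pays for replacing log (2n) by log n,
  -- since log 2 ≤ (log n)/14.
  have hC : 0.34286 * (n : ℝ) ≤ c * Real.log (2 * n) := by
    have h6 : (n : ℝ) / 3 * Real.log 4 - (8.4 + 0.01105 * w) - w * (8.4 + 0.01105 * w) ≤
        c * Real.log (2 * n) := by linarith
    rw [hl4] at h6
    nlinarith
  have hD : Real.log (2 * n) ≤ 15 / 14 * Real.log n := by linarith
  have hE : (c : ℝ) * Real.log (2 * n) ≤ c * (15 / 14 * Real.log n) :=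
    mul_le_mul_of_nonneg_left hD (by positivity)
  linarith

/-! ### Prime counts below 2^14 by kernel computation -/

/-- Counts the integers in `[a, a + 2^k)` which are coprime to `F`. -/
def coprimeCount (F : ℕ) : ℕ → ℕ → ℕ
  | 0, a => if Nat.gcd a F = 1 then 1 else 0
  | k + 1, a => coprimeCount F k a + coprimeCount F k (a + 2 ^ k)

/-- The least prime factor of a composite a < (q+1)² is at most q and so divides q!. One gcd thus
certifies primality cheaply in the kernel. -/
theorem prime_of_gcd_factorial {a q : ℕ} (ha : 1 < a) (haq : a < (q + 1) ^ 2)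
    (h : Nat.gcd a q.factorial = 1) : a.Prime := by
  by_contra hp
  have h1 := Nat.minFac_sq_le_self (by omega) hp
  have h2 : a.minFac ≤ q := by
    by_contra h3
    have := Nat.pow_le_pow_left (by omega : q + 1 ≤ a.minFac) 2
    omega
  have h3 : a.minFac ∣ Nat.gcd a q.factorial :=
    Nat.dvd_gcd a.minFac_dvd (Nat.dvd_factorial a.minFac_pos h2)
  rw [h, Nat.dvd_one] at h3
  exact (Nat.minFac_prime (by omega : a ≠ 1)).one_lt.ne' h3

theorem coprimeCount_le {q : ℕ} : ∀ (k a : ℕ), 1 < a → a + 2 ^ k ≤ (q + 1) ^ 2 →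
    coprimeCount q.factorial k a ≤ ((Finset.Ico a (a + 2 ^ k)).filter Nat.Prime).card
  | 0, a, h1, h2 => by
    rw [coprimeCount]
    split_ifs with h
    · refine Finset.card_pos.2 ⟨a, ?_⟩
      simp only [Finset.mem_filter, Finset.mem_Ico, le_refl, true_and]
      exact ⟨by simp, prime_of_gcd_factorial h1 (by simpa using h2) h⟩
    · omega
  | k + 1, a, h1, h2 => by
    have h3 : 2 ^ (k + 1) = 2 ^ k + 2 ^ k := by ring
    have h4 : 0 < 2 ^ k := by positivity
    rw [coprimeCount, h3, ← add_assoc]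
    refine (Nat.add_le_add (coprimeCount_le k a h1 (by omega))
      (coprimeCount_le k (a + 2 ^ k) (by omega) (by omega))).trans (le_of_eq ?_)
    rw [← Finset.card_union_of_disjoint, ← Finset.filter_union,
      Finset.Ico_union_Ico_eq_Ico (by omega) (by omega)]
    refine Finset.disjoint_filter_filter (Finset.Ico_disjoint_Ico_consecutive _ _ _)

/-- The number of integers coprime to `F` in `[j 2^k, (j + n) 2^k)`. -/
def blockCount (F k j : ℕ) : ℕ → ℕ
  | 0 => 0
  | n + 1 => blockCount F k j n + coprimeCount F k ((j + n) * 2 ^ k)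

theorem blockCount_le {q k j : ℕ} (hj : 1 < j) : ∀ n : ℕ, (j + n) * 2 ^ k ≤ (q + 1) ^ 2 →
    blockCount q.factorial k j n ≤
      ((Finset.Ico (j * 2 ^ k) ((j + n) * 2 ^ k)).filter Nat.Prime).card
  | 0, _ => by simp [blockCount]
  | n + 1, h => by
    have h2 : (j + (n + 1)) * 2 ^ k = (j + n) * 2 ^ k + 2 ^ k := by ring
    have h5 : 0 < 2 ^ k := by positivity
    have h3 : j * 2 ^ k ≤ (j + n) * 2 ^ k := Nat.mul_le_mul_right _ (by omega)
    have h4 : 1 < j * 2 ^ k := lt_of_lt_of_le hj (Nat.le_mul_of_pos_right _ (by positivity))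
    rw [blockCount, h2]
    refine (Nat.add_le_add (blockCount_le hj n (by omega))
      (coprimeCount_le k _ (by omega) (by omega))).trans (le_of_eq ?_)
    rw [← Finset.card_union_of_disjoint, ← Finset.filter_union,
      Finset.Ico_union_Ico_eq_Ico h3 (by omega)]
    refine Finset.disjoint_filter_filter (Finset.Ico_disjoint_Ico_consecutive _ _ _)

/-- If (4+i) 2^k ≤ x < (5+i) 2^k, the 3+i blocks of length 2^k starting at (5+i) 2^k lie in (x, 2x].
The inequality is 0.32 x ≤ 0.693 (k+2) (count + 1) cleared of denominators, with x replaced by its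
upper end and log x by 0.693 (k+2). -/
theorem blockCount_check : ∀ k < 12, ∀ i < 4,
    32 * ((5 + i) * 2 ^ k) * 1000 ≤
      69300 * (k + 2) * (blockCount (2 ^ ((k + 5) / 2)).factorial k (5 + i) (3 + i) + 1) := by
  decide +kernel

/-- This is why the constant 0.32 occurs in the choice of p₁. The summand 1 counts the prime x
itself, and without it small x would be critical. The range splits at 2^14 into asymptotics and
computation. -/
theorem le_card_bertrandPrimes {x : ℕ} (hx : x.Prime) :
    0.32 * (x : ℝ) ≤ Real.log x * ((bertrandPrimes x).card + 1) := by
  have hx2 := hx.two_le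
  have hlog : 0 ≤ Real.log x := Real.log_natCast_nonneg x
  rcases le_or_gt 16384 x with h | h
  · have := le_card_bertrandPrimes_of_large h
    linarith
  have hl2 := Real.log_two_gt_d9
  rcases lt_or_ge x 4 with h4 | h4
  · have h5 : 1 ≤ (bertrandPrimes x).card := by
      obtain ⟨p, hp, h6, h7⟩ := Nat.exists_prime_lt_and_le_two_mul x (by omega)
      exact Finset.card_pos.2 ⟨p, by simp [bertrandPrimes, hp, h6, h7]⟩
    have h5' : (1 : ℝ) ≤ (bertrandPrimes x).card := by exact_mod_cast h5
    have h6 : (x : ℝ) ≤ 3 := by exact_mod_cast (by omega : x ≤ 3)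
    have h7 : Real.log 2 ≤ Real.log x :=
      Real.log_le_log (by norm_num) (by exact_mod_cast hx2)
    nlinarith
  · obtain ⟨k, hk⟩ : ∃ k, Nat.log 2 x = k + 2 :=
      ⟨Nat.log 2 x - 2, by have := Nat.le_log_of_pow_le (b := 2) (x := 2) (y := x) (by norm_num) h4; omega⟩
    have hk1 : 2 ^ (k + 2) ≤ x := hk ▸ Nat.pow_log_le_self 2 (by omega)
    have hk2 : x < 2 ^ (k + 3) := by
      have := Nat.lt_pow_succ_log_self (b := 2) (by norm_num) x
      rwa [hk] at this
    have hk12 : k < 12 := by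
      by_contra h6
      have := Nat.pow_le_pow_right (n := 2) (by norm_num) (by omega : 14 ≤ k + 2)
      norm_num at this
      omega
    have hpos : 0 < 2 ^ k := by positivity
    -- The three leading binary digits 4 + i of x, with i < 4, locate x up to a block of length 2^k.
    obtain ⟨i, hi⟩ : ∃ i, x / 2 ^ k = 4 + i :=
      ⟨x / 2 ^ k - 4, by
        have : 4 ≤ x / 2 ^ k := by rw [Nat.le_div_iff_mul_le hpos]; rw [pow_add] at hk1; omega
        omega⟩
    have hi4 : i < 4 := by
      have : x / 2 ^ k < 8 := by rw [Nat.div_lt_iff_lt_mul hpos]; rw [pow_add] at hk2; omega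
      omega
    have hx1 : (4 + i) * 2 ^ k ≤ x := hi ▸ Nat.div_mul_le_self x _
    have hx3 : x < (5 + i) * 2 ^ k := by
      have := Nat.lt_mul_div_succ x hpos
      rw [hi] at this
      calc x < _ := this
        _ = _ := by ring
    have hcard : blockCount (2 ^ ((k + 5) / 2)).factorial k (5 + i) (3 + i) ≤
        (bertrandPrimes x).card := by
      refine (blockCount_le (by omega) (3 + i) ?_).trans (Finset.card_le_card fun p hp => ?_)
      · calc (5 + i + (3 + i)) * 2 ^ k ≤ 16 * 2 ^ k := Nat.mul_le_mul_right _ (by omega)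
          _ = 2 ^ (k + 4) := by ring
          _ ≤ 2 ^ (2 * ((k + 5) / 2)) := Nat.pow_le_pow_right (by norm_num) (by omega)
          _ = (2 ^ ((k + 5) / 2)) ^ 2 := by rw [← pow_mul, mul_comm]
          _ ≤ _ := Nat.pow_le_pow_left (by omega) 2
      · simp only [Finset.mem_filter, Finset.mem_Ico, bertrandPrimes, Finset.mem_Ioc] at hp ⊢
        refine ⟨⟨by omega, ?_⟩, hp.2⟩
        have : (5 + i + (3 + i)) * 2 ^ k = 2 * ((4 + i) * 2 ^ k) := by ring
        omega
    have hchk := blockCount_check k hk12 i hi4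
    have h8 : 32 * x * 1000 ≤ 69300 * (k + 2) * ((bertrandPrimes x).card + 1) :=
      (by nlinarith : 32 * x * 1000 ≤ 32 * ((5 + i) * 2 ^ k) * 1000).trans
        (hchk.trans (Nat.mul_le_mul_left _ (by omega)))
    have h9 : 32 * (x : ℝ) * 1000 ≤ 69300 * (k + 2) * ((bertrandPrimes x).card + 1) := by
      exact_mod_cast h8
    have h10 : (k + 2) * Real.log 2 ≤ Real.log x := by
      have := Real.log_le_log (by positivity)
        (by exact_mod_cast hk1 : ((2 : ℝ) ^ (k + 2)) ≤ x)
      rwa [Real.log_pow, Nat.cast_add, Nat.cast_ofNat] at this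
    have h11 : (k + 2) * (0.693 : ℝ) ≤ Real.log x :=
      le_trans (mul_le_mul_of_nonneg_left (by linarith) (by positivity)) h10
    have h12 := mul_le_mul_of_nonneg_right h11
      (by positivity : (0 : ℝ) ≤ (bertrandPrimes x).card + 1)
    linarith

/-! ### Consecutive primes -/

/-- The `i`-th prime after the prime `p`. -/
def iterPrime (p i : ℕ) : ℕ := (fun q => nextPrime (q + 1))^[i] p

theorem iterPrime_succ (p i : ℕ) : iterPrime p (i + 1) = nextPrime (iterPrime p i + 1) :=
  Function.iterate_succ_apply' _ _ _

theorem iterPrime_prime {p : ℕ} (hp : p.Prime) : ∀ i, (iterPrime p i).Prime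
  | 0 => hp
  | i + 1 => by rw [iterPrime_succ]; exact nextPrime_prime _

theorem strictMono_iterPrime (p : ℕ) : StrictMono (iterPrime p) :=
  strictMono_nat_of_lt_succ fun i => by
    rw [iterPrime_succ]
    exact le_nextPrime _

theorem nextPrime_le {n p : ℕ} (hp : p.Prime) (h : n ≤ p) : nextPrime n ≤ p :=
  Nat.find_min' _ ⟨h, hp⟩

/-- By minimality of `nextPrime` no prime lies strictly between consecutive iterates. -/
theorem card_primes_below_iterPrime {p : ℕ} : ∀ i : ℕ,
    ((Finset.Ico p (iterPrime p i)).filter Nat.Prime).card ≤ i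
  | 0 => by simp [iterPrime]
  | i + 1 => by
    have hsub : (Finset.Ico p (iterPrime p (i + 1))).filter Nat.Prime ⊆
        insert (iterPrime p i) ((Finset.Ico p (iterPrime p i)).filter Nat.Prime) := by
      intro q hq
      simp only [Finset.mem_filter, Finset.mem_Ico, Finset.mem_insert] at hq ⊢
      by_contra hc
      have h1 : iterPrime p i + 1 ≤ q := by
        by_contra h
        exact hc (Or.inr ⟨⟨hq.1.1, by
          rcases lt_trichotomy q (iterPrime p i) with h2 | h2 | h2
          · exact h2
          · exact absurd (Or.inl h2) hc
          · omega⟩, hq.2⟩)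
      have := nextPrime_le hq.2 h1
      rw [← iterPrime_succ] at this
      omega
    exact (Finset.card_le_card hsub).trans ((Finset.card_insert_le _ _).trans
      (Nat.succ_le_succ (card_primes_below_iterPrime i)))

/-- Otherwise p and all primes of (p, 2p], which are more than i, would precede the i-th successor
of p. -/
theorem iterPrime_le_two_mul {p i : ℕ} (hp : p.Prime) (hi : i ≤ (bertrandPrimes p).card) :
    iterPrime p i ≤ 2 * p := by
  by_contra h
  have h1 : insert p (bertrandPrimes p) ⊆ (Finset.Ico p (iterPrime p i)).filter Nat.Prime := by
    intro q hq
    simp only [bertrandPrimes, Finset.mem_insert, Finset.mem_filter, Finset.mem_Ioc,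
      Finset.mem_Ico] at hq ⊢
    rcases hq with rfl | hq
    · exact ⟨⟨le_rfl, by omega⟩, hp⟩
    · exact ⟨⟨by omega, by omega⟩, hq.2⟩
  have h2 := (Finset.card_le_card h1).trans (card_primes_below_iterPrime i)
  rw [Finset.card_insert_of_notMem (by simp [bertrandPrimes])] at h2
  omega

theorem nextPrime_le_two_mul {n : ℕ} (hn : n ≠ 0) : nextPrime n ≤ 2 * n := by
  obtain ⟨p, hp, h1, h2⟩ := Nat.exists_prime_lt_and_le_two_mul n hn
  exact (nextPrime_le hp h1.le).trans h2

theorem consecutivePrimes_eq (p k : ℕ) :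
    consecutivePrimes p k = (List.range k).map (iterPrime p) := rfl

theorem nodup_consecutivePrimes (p k : ℕ) : (consecutivePrimes p k).Nodup := by
  rw [consecutivePrimes_eq]
  exact List.Nodup.map (strictMono_iterPrime p).injective List.nodup_range

theorem prime_of_mem_consecutivePrimes {p k q : ℕ} (hp : p.Prime)
    (hq : q ∈ consecutivePrimes p k) : q.Prime := by
  rw [consecutivePrimes_eq, List.mem_map] at hq
  obtain ⟨i, -, rfl⟩ := hq
  exact iterPrime_prime hp i

theorem le_of_mem_consecutivePrimes {p k q : ℕ} (hq : q ∈ consecutivePrimes p k) : p ≤ q := by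
  rw [consecutivePrimes_eq, List.mem_map] at hq
  obtain ⟨i, -, rfl⟩ := hq
  exact (strictMono_iterPrime p).monotone (Nat.zero_le i)

theorem le_two_mul_of_mem_consecutivePrimes {p k q : ℕ} (hp : p.Prime)
    (hk : k ≤ (bertrandPrimes p).card + 1) (hq : q ∈ consecutivePrimes p k) : q ≤ 2 * p := by
  rw [consecutivePrimes_eq, List.mem_map] at hq
  obtain ⟨i, hi, rfl⟩ := hq
  rw [List.mem_range] at hi
  exact iterPrime_le_two_mul hp (by omega)

theorem length_consecutivePrimes (p k : ℕ) : (consecutivePrimes p k).length = k := by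
  simp [consecutivePrimes_eq]

/-! ### The projection vector -/

theorem mem_symmetricList {n : ℕ} {x : ℤ} : x ∈ symmetricList n ↔ |x| ≤ n := by
  rw [abs_le]
  simp only [symmetricList, List.mem_cons, List.mem_flatMap, List.mem_range, List.not_mem_nil,
    or_false, List.bind_eq_flatMap, List.pure_def]
  constructor
  · rintro (h | ⟨_, ⟨i, hi, rfl⟩, h | h⟩) <;> omega
  · intro h
    rcases lt_trichotomy x 0 with h1 | h1 | h1
    · exact Or.inr ⟨_, ⟨x.natAbs - 1, by omega, rfl⟩, Or.inr (by omega)⟩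
    · exact Or.inl h1
    · exact Or.inr ⟨_, ⟨x.natAbs - 1, by omega, rfl⟩, Or.inl (by omega)⟩

theorem card_forbidden_le {d : ℕ} (H : Finset (Fin d → ℤ)) (z : Fin d → ℤ) (j : Fin d) :
    (forbidden H z j).card ≤ (activeRows H j).card :=
  Finset.card_image_le.trans (Finset.card_filter_le _ _)

/-- Counting: with n = ⌈|H_j|/2⌉ the list contains 2n + 1 > |H_j| integers, whereas each row forbids
at most one. Hence the search succeeds and the default value in `projectionSteps` is never used. -/
theorem exists_find_symmetricList {d : ℕ} (H : Finset (Fin d → ℤ)) (z : Fin d → ℤ) (j : Fin d) :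
    ∃ x : ℤ, (symmetricList (((activeRows H j).card + 1) / 2)).find?
      (fun x => decide (x ∉ forbidden H z j)) = some x ∧ x ∉ forbidden H z j ∧
        |x| ≤ (((activeRows H j).card + 1) / 2 : ℕ) := by
  set n := ((activeRows H j).card + 1) / 2 with hn
  have h1 : ((symmetricList n).find? fun x => decide (x ∉ forbidden H z j)).isSome := by
    rw [List.find?_isSome]
    by_contra hc
    push Not at hc
    have h2 : Finset.Icc (-(n : ℤ)) n ⊆ forbidden H z j := by
      intro x hx
      have := hc x (mem_symmetricList.2 (abs_le.2 (Finset.mem_Icc.1 hx)))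
      simpa using this
    have h3 := (Finset.card_le_card h2).trans (card_forbidden_le H z j)
    rw [Int.card_Icc] at h3
    omega
  obtain ⟨x, hx⟩ := Option.isSome_iff_exists.1 h1
  refine ⟨x, hx, ?_, mem_symmetricList.1 (List.mem_of_find?_eq_some hx)⟩
  simpa using List.find?_some hx

theorem projectionSteps_of_lt {d : ℕ} (H : Finset (Fin d → ℤ)) (l : Fin d) :
    ∀ n : ℕ, (l : ℕ) < n → projectionSteps H n l = projectionSteps H (l + 1) l := by
  intro n hn
  induction n, hn using Nat.le_induction with
  | base => rfl
  | succ n hn ih =>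
    rw [projectionSteps]
    split_ifs with h
    · rw [Function.update_of_ne, ih]
      intro hl
      have := congrArg Fin.val hl
      simp only at this
      omega
    · exact ih

theorem forbidden_congr {d : ℕ} (H : Finset (Fin d → ℤ)) {z z' : Fin d → ℤ} {j : Fin d}
    (h : ∀ l < j, z l = z' l) : forbidden H z j = forbidden H z' j := by
  have h1 : ∀ v : Fin d → ℤ, ∑ l ∈ Finset.Iio j, v l * z l = ∑ l ∈ Finset.Iio j, v l * z' l :=
    fun v => Finset.sum_congr rfl fun l hl => by rw [h l (Finset.mem_Iio.1 hl)]
  simp only [forbidden, h1]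

/-- Later steps change neither the j-th component nor the ones before it, so what held when z_j was
chosen holds for the final vector. -/
theorem projectionVector_spec {d : ℕ} (H : Finset (Fin d → ℤ)) (j : Fin d) :
    projectionVector H j ∉ forbidden H (projectionVector H) j ∧
      |projectionVector H j| ≤ (((activeRows H j).card + 1) / 2 : ℕ) := by
  obtain ⟨x, hx1, hx2, hx3⟩ := exists_find_symmetricList H (projectionSteps H j) j
  have h1 : projectionVector H j = x := by
    rw [projectionVector, projectionSteps_of_lt H j d j.2, projectionSteps, dif_pos j.2,
      Function.update_self, hx1, Option.getD_some]
  have h2 : forbidden H (projectionVector H) j = forbidden H (projectionSteps H j) j := by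
    refine forbidden_congr H fun l hl => ?_
    rw [projectionVector, projectionSteps_of_lt H l d l.2, projectionSteps_of_lt H l j hl]
  rw [h1, h2]
  exact ⟨hx2, hx3⟩

/-- Let j be the last index with h_j ≠ 0. If h·z vanished, z_j would equal -h_j⁻¹ Σ_{l<j} h_l z_l,
an integer forbidden at step j. -/
theorem dot_projectionVector_ne_zero {d : ℕ} {H : Finset (Fin d → ℤ)} {h : Fin d → ℤ}
    (hh : h ∈ H) (h0 : h ≠ 0) : dot h (projectionVector H) ≠ 0 := by
  set z := projectionVector H with hz
  have hne : (Finset.univ.filter fun l => h l ≠ 0).Nonempty := by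
    obtain ⟨l, hl⟩ := Function.ne_iff.1 h0
    exact ⟨l, by simpa using hl⟩
  set j := (Finset.univ.filter fun l => h l ≠ 0).max' hne with hj
  have hj0 : h j ≠ 0 := (Finset.mem_filter.1 (Finset.max'_mem _ hne)).2
  have hjl : ∀ l, j < l → h l = 0 := by
    intro l hl
    by_contra hc
    exact absurd (Finset.le_max' _ l (by simpa using hc)) (not_le.2 hl)
  have hdot : dot h z = ∑ l ∈ Finset.Iio j, h l * z l + h j * z j := by
    rw [dot, ← Finset.sum_subset (Finset.subset_univ (Finset.Iic j)), ← Finset.Iio_insert j,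
      Finset.sum_insert (by simp), add_comm]
    intro l _ hl
    rw [hjl l (by simpa using hl), zero_mul]
  intro hc
  refine (projectionVector_spec H j).1 ?_
  rw [forbidden, Finset.mem_image]
  have hs : ∑ l ∈ Finset.Iio j, h l * z l = h j * -z j := by rw [hdot] at hc; linarith
  refine ⟨h, ?_, ?_⟩
  · simp only [Finset.mem_filter, activeRows]
    exact ⟨⟨hh, hj0, hjl⟩, ⟨-z j, hs⟩⟩
  · rw [hs, ← mul_neg, neg_neg, Int.mul_ediv_cancel_left _ hj0]

theorem abs_projectionVector_le {d : ℕ} (H : Finset (Fin d → ℤ)) (j : Fin d) :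
    |projectionVector H j| ≤ H.card := by
  refine (projectionVector_spec H j).2.trans ?_
  have h1 : (activeRows H j).card ≤ H.card := Finset.card_filter_le _ _
  exact_mod_cast (by omega : ((activeRows H j).card + 1) / 2 ≤ H.card)

/-! ### Characters -/

theorem fourierChar_add {d : ℕ} (k : Fin d → ℤ) (x y : Fin d → ℝ) :
    fourierChar k (x + y) = fourierChar k x * fourierChar k y := by
  rw [fourierChar, fourierChar, fourierChar, ← Complex.exp_add]
  congr 1
  simp only [Pi.add_apply, mul_add, Finset.sum_add_distrib]
  push_cast
  ring

theorem fourierChar_add_left {d : ℕ} (k l : Fin d → ℤ) (x : Fin d → ℝ) :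
    fourierChar (k + l) x = fourierChar k x * fourierChar l x := by
  rw [fourierChar, fourierChar, fourierChar, ← Complex.exp_add]
  congr 1
  simp only [Pi.add_apply, Int.cast_add, add_mul, Finset.sum_add_distrib]
  push_cast
  ring

@[simp]
theorem fourierChar_zero {d : ℕ} (k : Fin d → ℤ) : fourierChar k 0 = 1 := by
  simp [fourierChar]

@[simp]
theorem fourierChar_zero_left {d : ℕ} (x : Fin d → ℝ) : fourierChar 0 x = 1 := by
  simp [fourierChar]

theorem norm_fourierChar {d : ℕ} (k : Fin d → ℤ) (x : Fin d → ℝ) : ‖fourierChar k x‖ = 1 := by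
  rw [fourierChar, show 2 * (Real.pi : ℂ) * Complex.I * ((∑ j, (k j : ℝ) * x j : ℝ) : ℂ) =
    ((2 * Real.pi * ∑ j, (k j : ℝ) * x j : ℝ) : ℂ) * Complex.I by push_cast; ring]
  exact Complex.norm_exp_ofReal_mul_I _

theorem star_fourierChar {d : ℕ} (k : Fin d → ℤ) (x : Fin d → ℝ) :
    star (fourierChar k x) = fourierChar (-k) x := by
  rw [fourierChar, fourierChar, Complex.star_def, ← Complex.exp_conj]
  congr 1
  simp [Complex.conj_ofNat, neg_mul, Finset.sum_neg_distrib]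

theorem fourierChar_intCast {d : ℕ} (k m : Fin d → ℤ) :
    fourierChar k (fun j => (m j : ℝ)) = 1 := by
  rw [fourierChar, Complex.exp_eq_one_iff]
  refine ⟨∑ j, k j * m j, ?_⟩
  push_cast
  ring

theorem fourierChar_fract {d : ℕ} (k : Fin d → ℤ) (x : Fin d → ℝ) :
    fourierChar k (fun j => Int.fract (x j)) = fourierChar k x := by
  have h : x = (fun j => Int.fract (x j)) + fun j => (⌊x j⌋ : ℝ) := by
    funext j
    simp
  conv_rhs => rw [h, fourierChar_add, fourierChar_intCast, mul_one]

theorem fourierChar_latticePoint {d : ℕ} (h z : Fin d → ℤ) (i p : ℕ) :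
    fourierChar h (fun j => (i : ℝ) * z j / p) =
      Complex.exp (2 * Real.pi * Complex.I * (dot h z / p)) ^ i := by
  rw [fourierChar, ← Complex.exp_nat_mul]
  congr 1
  have : ∑ j, (h j : ℝ) * ((i : ℝ) * z j / p) = i * (dot h z / p) := by
    rw [dot, Int.cast_sum, Finset.sum_div, Finset.mul_sum]
    refine Finset.sum_congr rfl fun j _ => ?_
    push_cast
    ring
  rw [this]
  push_cast
  ring

/-- A geometric sum of a p-th root of unity, which equals 1 exactly when p divides h·z. It serves
both for the shifts and for the rank-one lattice average. -/
theorem sum_fourierChar_lattice {d : ℕ} (h z : Fin d → ℤ) {p : ℕ} (hp : p ≠ 0) :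
    ∑ i ∈ Finset.range p, fourierChar h (fun j => (i : ℝ) * z j / p) =
      if (p : ℤ) ∣ dot h z then (p : ℂ) else 0 := by
  have hpC : (p : ℂ) ≠ 0 := by exact_mod_cast hp
  simp only [fourierChar_latticePoint]
  set ζ := Complex.exp (2 * Real.pi * Complex.I * (dot h z / p)) with hζ
  have h1 : ζ = 1 ↔ (p : ℤ) ∣ dot h z := by
    rw [hζ, Complex.exp_eq_one_iff]
    constructor
    · rintro ⟨n, hn⟩
      refine ⟨n, ?_⟩
      rw [mul_comm (n : ℂ), mul_right_inj' Complex.two_pi_I_ne_zero, div_eq_iff hpC] at hn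
      rw [mul_comm]
      exact_mod_cast hn
    · rintro ⟨n, hn⟩
      refine ⟨n, ?_⟩
      rw [hn, Int.cast_mul, Int.cast_natCast, mul_div_cancel_left₀ _ hpC, mul_comm]
  split_ifs with hd
  · rw [h1.2 hd]
    simp
  · have h2 : ζ ≠ 1 := fun hc => hd (h1.1 hc)
    have h3 : ζ ^ p = 1 := by
      rw [hζ, ← Complex.exp_nat_mul, Complex.exp_eq_one_iff]
      refine ⟨dot h z, ?_⟩
      field_simp
    rw [geom_sum_eq h2, h3, sub_self, zero_div]

/-! ### The construction of the shifts -/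

theorem list_sum_map_range {M : Type*} [AddCommMonoid M] (f : ℕ → M) (n : ℕ) :
    ((List.range n).map f).sum = ∑ i ∈ Finset.range n, f i := by
  induction n with
  | zero => simp
  | succ n ih => rw [List.range_succ, List.map_append, List.sum_append, ih, Finset.sum_range_succ]; simp

theorem expSum_append {d : ℕ} (Y Y' : List (Fin d → ℝ)) (h : Fin d → ℤ) :
    expSum (Y ++ Y') h = expSum Y h + expSum Y' h := by
  simp [expSum]

theorem latticeShifts_eq {d : ℕ} (z : Fin d → ℤ) (p : ℕ) : latticeShifts z p =
    (List.range p).map fun i : ℕ => fun j => Int.fract ((i : ℝ) * z j / p) := by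
  simp only [latticeShifts, List.bind_eq_flatMap, List.pure_def, ← List.map_eq_flatMap,
    List.map_map]
  rfl

/-- The members of a list of primes which divide `x`. -/
def badPrimes (P : List ℕ) (x : ℤ) : List ℕ := P.filter fun q : ℕ => decide ((q : ℤ) ∣ x)

theorem sum_badPrimes (P : List ℕ) (x : ℤ) :
    ((P.filter fun q => decide ((q : ℤ) ∣ x)).sum : ℝ) = ((badPrimes P x).sum : ℕ) := by
  simp only [badPrimes, List.bind_eq_flatMap, List.pure_def, ← List.map_eq_flatMap]
  induction P with
  | nil => simp
  | cons p P ih =>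
    by_cases h : (p : ℤ) ∣ x <;> simp [h, ih]

theorem expSum_latticeShifts {d : ℕ} (h z : Fin d → ℤ) {p : ℕ} (hp : p ≠ 0) :
    expSum (latticeShifts z p) h = if (p : ℤ) ∣ dot h z then (p : ℂ) else 0 := by
  rw [← sum_fourierChar_lattice h z hp, ← list_sum_map_range, expSum, latticeShifts_eq, List.map_map]
  congr 2
  funext i
  exact fourierChar_fract h _

/-- A prime lattice contributes either nothing or all of its p points, so the exponential sum is the
total of the primes dividing h·z. This turns the spectral condition into one on divisors. -/
theorem expSum_multiLatticeShifts {d : ℕ} (h z : Fin d → ℤ) : ∀ {P : List ℕ}, (∀ q ∈ P, q ≠ 0) →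
    expSum (multiLatticeShifts z P) h = ((badPrimes P (dot h z)).sum : ℕ)
  | [], _ => by simp [multiLatticeShifts, expSum, badPrimes]
  | p :: P, hP => by
    have ih := expSum_multiLatticeShifts h z (P := P) fun q hq => hP q (List.mem_cons_of_mem _ hq)
    rw [multiLatticeShifts, List.flatMap_cons, expSum_append,
      expSum_latticeShifts h z (hP p List.mem_cons_self), badPrimes, List.filter_cons]
    rw [multiLatticeShifts, badPrimes] at ih
    rw [ih]
    by_cases hd : (p : ℤ) ∣ dot h z <;> simp [hd]

/-- The exponential sums over `Y` are small compared with the number of shifts. -/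
def GoodShifts {d : ℕ} (H : Finset (Fin d → ℤ)) (R : ℕ) (t : ℝ) (Y : List (Fin d → ℝ)) : Prop :=
  1 ≤ Y.length ∧ ∀ h ∈ H, ‖expSum Y h‖ * ((R : ℝ) - 1) ≤ t * Y.length

theorem length_latticeShifts {d : ℕ} (z : Fin d → ℤ) (p : ℕ) :
    (latticeShifts z p).length = p := by simp [latticeShifts]

theorem length_polynomialShifts (d p : ℕ) : (polynomialShifts d p).length = p := by
  simp [polynomialShifts]

theorem PolynomialTest.goodShifts {d : ℕ} {H : Finset (Fin d → ℤ)} {R : ℕ} {t : ℝ} {p : ℕ}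
    (hR : 2 ≤ R) (hp : p ≠ 0) (h : PolynomialTest H R t p) :
    GoodShifts H R t (polynomialShifts d p) := by
  have hR' : (0 : ℝ) < (R : ℝ) - 1 := by
    have : (2 : ℝ) ≤ R := by exact_mod_cast hR
    linarith
  refine ⟨by rw [length_polynomialShifts]; omega, fun v hv => ?_⟩
  rw [length_polynomialShifts]
  exact (le_div_iff₀ hR').1 (h v hv)

theorem SingleTest.goodShifts {d : ℕ} {H : Finset (Fin d → ℤ)} {R : ℕ} {t : ℝ} {z : Fin d → ℤ}
    {pmin : ℝ} {p : ℕ} (ht : 0 < t) (hp : p ≠ 0) (h : SingleTest H z pmin p) :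
    GoodShifts H R t (latticeShifts z p) := by
  refine ⟨by rw [length_latticeShifts]; omega, fun v hv => ?_⟩
  rw [expSum_latticeShifts v z hp, if_neg (h.2 v hv), norm_zero, zero_mul]
  positivity

theorem GreedyTest.goodShifts {d : ℕ} {H : Finset (Fin d → ℤ)} {R : ℕ} {t : ℝ} {z : Fin d → ℤ}
    {P : List ℕ} (hR : 2 ≤ R) (hP : ∀ q ∈ P, q ≠ 0) (hsum : 1 ≤ P.sum)
    (h : GreedyTest H R t z P) : GoodShifts H R t (multiLatticeShifts z P) := by
  have hR' : (0 : ℝ) < (R : ℝ) - 1 := by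
    have : (2 : ℝ) ≤ R := by exact_mod_cast hR
    linarith
  have hs : (0 : ℝ) < P.sum := by exact_mod_cast hsum
  refine ⟨by rwa [length_multiLatticeShifts], fun v hv => ?_⟩
  rw [length_multiLatticeShifts, expSum_multiLatticeShifts v z hP, Complex.norm_natCast]
  have h1 := h v hv
  rw [sum_badPrimes, div_le_div_iff₀ hs hR'] at h1
  linarith

/-- Loop invariant: `best` is always good. Every replacement has passed a test implying goodness and
is shorter than what it replaces. The number n bounds the loop variant `best.length - p`, which
drops as p increases and `best` does not grow. -/
theorem adaptiveLoop_spec {d : ℕ} {H : Finset (Fin d → ℤ)} {R : ℕ} {t : ℝ} {z : Fin d → ℤ}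
    {pmin : ℝ} (hR : 2 ≤ R) (ht : 0 < t) (n : ℕ) : ∀ (p : ℕ) (best : List (Fin d → ℝ))
    (P : List ℕ) (found : Bool), best.length - p ≤ n → p.Prime → (∀ q ∈ P, q ≠ 0) →
    GoodShifts H R t best →
    GoodShifts H R t (adaptiveLoop H R t z pmin p best P found) ∧
      (adaptiveLoop H R t z pmin p best P found).length ≤ best.length := by
  induction n with
  | zero =>
    intro p best P found hn hp hP hb
    rw [adaptiveLoop, if_neg (by omega)]
    exact ⟨hb, le_rfl⟩
  | succ n ih =>
    intro p best P found hn hp hP hb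
    have hnext := le_nextPrime (p + 1)
    have hnp := nextPrime_prime (p + 1)
    have hP' : ∀ q ∈ P ++ [p], q ≠ 0 := by
      intro q hq
      rcases List.mem_append.1 hq with hq | hq
      · exact hP q hq
      · rw [List.mem_singleton.1 hq]; exact hp.ne_zero
    rw [adaptiveLoop]
    split_ifs with h1 h2 h3 h4 h5 h6
    · exact ⟨h2.goodShifts hR hp.ne_zero, by rw [length_polynomialShifts]; exact h1.le⟩
    · exact ⟨h3.goodShifts ht hp.ne_zero, by rw [length_latticeShifts]; exact h1.le⟩
    · exact ih _ _ _ _ (by omega) hnp hP hb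
    · have h7 := ih (nextPrime (p + 1)) (multiLatticeShifts z (P ++ [p])) (P ++ [p]) true
        (by rw [length_multiLatticeShifts]; omega) hnp hP'
        (h5.goodShifts hR hP' (by have := hp.pos; rw [List.sum_append, List.sum_singleton]; omega))
      refine ⟨h7.1, h7.2.trans ?_⟩
      rw [length_multiLatticeShifts]
      exact h6.le
    · exact ih _ _ _ _ (by omega) hnp hP' hb
    · exact ih _ _ _ _ (by omega) hnp hP' hb
    · exact ⟨hb, le_rfl⟩

/-- Distinct primes dividing V have a product dividing V. This limits how many primes of size at
least p can be bad for one h. -/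
theorem pow_length_le_of_primes_dvd {p V : ℕ} (hV : V ≠ 0) : ∀ {L : List ℕ}, L.Nodup →
    (∀ q ∈ L, q.Prime ∧ p ≤ q ∧ q ∣ V) → p ^ L.length ≤ V := by
  intro L hnd hL
  have h1 : L.prod ∣ V := by
    rw [← List.prod_toFinset _ hnd |>.trans (by simp : (L.map fun q => q).prod = L.prod)]
    refine Finset.prod_primes_dvd V (fun q hq => ?_) fun q hq => ?_
    · exact (hL q (List.mem_toFinset.1 hq)).1.prime
    · exact (hL q (List.mem_toFinset.1 hq)).2.2
  refine le_trans ?_ (Nat.le_of_dvd (Nat.pos_of_ne_zero hV) h1)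
  exact List.pow_card_le_prod (M := ℕ) L p fun q hq => (hL q hq).2.1

/-- The a priori primes give good shifts, and there are only few of them. -/
theorem ceilingPrimes_spec {d : ℕ} {H : Finset (Fin d → ℤ)} {R : ℕ} {t : ℝ} {z : Fin d → ℤ}
    {V : ℕ} (hV : V = H.sup fun h => (dot h z).natAbs)
    (hR : 2 ≤ R) (ht0 : 0 < t) (ht1 : t < 1) (hz : ∀ h ∈ H, dot h z ≠ 0) :
    GoodShifts H R t (multiLatticeShifts z (ceilingPrimes H R t z)) ∧
      ((multiLatticeShifts z (ceilingPrimes H R t z)).length : ℝ) ≤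
        (40 / t * (((R : ℝ) - 1) * Real.log V + 1)) ^ 2 := by
  set Q : ℝ := 2 * ((R : ℝ) - 1) * Real.log V with hQ
  set p := nextPrime ⌈Q / (0.32 * t)⌉₊ with hp
  set k := max 1 ⌈Q / (t * Real.log p)⌉₊ with hk
  have hL : ceilingPrimes H R t z = consecutivePrimes p k := by
    subst hV; rfl
  have hpp : p.Prime := nextPrime_prime _
  have hR' : (1 : ℝ) ≤ (R : ℝ) - 1 := by
    have : (2 : ℝ) ≤ R := by exact_mod_cast hR
    linarith
  have hQ0 : 0 ≤ Q := by
    have := Real.log_natCast_nonneg V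
    positivity
  have hpQ : Q / (0.32 * t) ≤ p := (Nat.le_ceil _).trans (by exact_mod_cast le_nextPrime _)
  have hp2 : (2 : ℝ) ≤ p := by exact_mod_cast hpp.two_le
  have hlp : Real.log 2 ≤ Real.log p := Real.log_le_log (by norm_num) hp2
  have hl2 := Real.log_two_gt_d9
  have hlp0 : 0 < Real.log p := by linarith
  -- The lower bound on p₁ and the constant 0.32 ensure that all k primes fit into [p₁, 2p₁].
  have hkc : k ≤ (bertrandPrimes p).card + 1 := by
    refine max_le (by omega) (Nat.ceil_le.2 ?_)
    rw [div_le_iff₀ (by positivity)]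
    rw [div_le_iff₀ (by positivity)] at hpQ
    have h1 := mul_le_mul_of_nonneg_right (le_card_bertrandPrimes hpp) ht0.le
    push_cast
    linarith
  have hk1 : 1 ≤ k := le_max_left _ _
  have hkQ : Q ≤ k * (t * Real.log p) := by
    rw [← div_le_iff₀ (by positivity)]
    exact (Nat.le_ceil _).trans (by exact_mod_cast le_max_right _ _)
  have hmem : ∀ q ∈ consecutivePrimes p k, q.Prime ∧ p ≤ q ∧ q ≤ 2 * p := fun q hq =>
    ⟨prime_of_mem_consecutivePrimes hpp hq, le_of_mem_consecutivePrimes hq,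
      le_two_mul_of_mem_consecutivePrimes hpp hkc hq⟩
  have hsum1 : k * p ≤ (consecutivePrimes p k).sum := by
    have := List.card_nsmul_le_sum (consecutivePrimes p k) p fun q hq => (hmem q hq).2.1
    rwa [length_consecutivePrimes, smul_eq_mul] at this
  have hsum2 : (consecutivePrimes p k).sum ≤ k * (2 * p) := by
    have := List.sum_le_card_nsmul (consecutivePrimes p k) (2 * p) fun q hq => (hmem q hq).2.2
    rwa [length_consecutivePrimes, smul_eq_mul] at this
  rw [hL]
  have hsum1' : (k : ℝ) * p ≤ (consecutivePrimes p k).sum := by exact_mod_cast hsum1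
  refine ⟨?_, ?_⟩
  · refine GreedyTest.goodShifts hR (fun q hq => (hmem q hq).1.ne_zero)
      ((Nat.mul_pos hk1 hpp.pos).trans_le hsum1) fun h hh => ?_
    rw [sum_badPrimes]
    set B := badPrimes (consecutivePrimes p k) (dot h z) with hB
    have hBmem : ∀ q ∈ B, q ∈ consecutivePrimes p k ∧ (q : ℤ) ∣ dot h z := fun q hq => by
      simpa [hB, badPrimes] using hq
    have hBV : p ^ B.length ≤ V := by
      have h1 : p ^ B.length ≤ (dot h z).natAbs := by
        refine pow_length_le_of_primes_dvd (Int.natAbs_ne_zero.2 (hz h hh))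
          ((nodup_consecutivePrimes p k).filter _) fun q hq => ?_
        obtain ⟨h1, h2⟩ := hBmem q hq
        exact ⟨(hmem q h1).1, (hmem q h1).2.1, Int.natCast_dvd.1 h2⟩
      refine h1.trans ?_
      rw [hV]
      exact Finset.le_sup (f := fun h => (dot h z).natAbs) hh
    -- At most log V / log p₁ primes are bad, each at most 2p₁, while the total is at least k p₁.
    -- The factor 2 in the definition of k compensates for the 2 in 2p₁.
    have hBlog : B.length * Real.log p ≤ Real.log V := by
      rw [← Real.log_pow]
      exact Real.log_le_log (by positivity) (by exact_mod_cast hBV)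
    have hBs : B.sum ≤ B.length * (2 * p) := by
      have := List.sum_le_card_nsmul B (2 * p) fun q hq => (hmem q (hBmem q hq).1).2.2
      rwa [smul_eq_mul] at this
    have hBs' : (B.sum : ℝ) ≤ B.length * (2 * p) := by exact_mod_cast hBs
    rw [div_le_div_iff₀ (lt_of_lt_of_le (by positivity) hsum1') (by linarith)]
    have h3 : 2 * ((R : ℝ) - 1) * B.length ≤ k * t := by
      refine le_of_mul_le_mul_right ?_ hlp0
      calc 2 * ((R : ℝ) - 1) * B.length * Real.log p
          = 2 * ((R : ℝ) - 1) * (B.length * Real.log p) := by ring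
        _ ≤ 2 * ((R : ℝ) - 1) * Real.log V := by gcongr
        _ ≤ k * t * Real.log p := by rw [← hQ]; linarith
    calc (B.sum : ℝ) * ((R : ℝ) - 1) ≤ B.length * (2 * p) * ((R : ℝ) - 1) := by gcongr
      _ = 2 * ((R : ℝ) - 1) * B.length * p := by ring
      _ ≤ k * t * p := by gcongr
      _ = t * (k * p) := by ring
      _ ≤ t * (consecutivePrimes p k).sum := by gcongr
  · rw [length_multiLatticeShifts]
    have h1 : ((consecutivePrimes p k).sum : ℝ) ≤ k * (2 * p) := by exact_mod_cast hsum2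
    refine h1.trans ?_
    set W := ((R : ℝ) - 1) * Real.log V with hW
    have hW0 : 0 ≤ W := by
      have := Real.log_natCast_nonneg V
      positivity
    have hQW : Q = 2 * W := by rw [hQ, hW]; ring
    have hp_le : (p : ℝ) ≤ 2 * (Q / (0.32 * t) + 1) + 2 := by
      -- For log V = 0 the ceiling is 0 and the next prime is 2; Bertrand's postulate covers the
      -- other case.
      rcases Nat.eq_zero_or_pos ⌈Q / (0.32 * t)⌉₊ with h0 | h0
      · have h2 : p ≤ 2 := by rw [hp, h0]; exact nextPrime_le Nat.prime_two (by norm_num)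
        have h3 : (p : ℝ) ≤ 2 := by exact_mod_cast h2
        have : 0 ≤ Q / (0.32 * t) := by positivity
        linarith
      · have h2 : (p : ℝ) ≤ 2 * (⌈Q / (0.32 * t)⌉₊ : ℝ) := by
          exact_mod_cast nextPrime_le_two_mul h0.ne'
        have h3 := Nat.ceil_lt_add_one (a := Q / (0.32 * t)) (by positivity)
        linarith
    have hk_le : (k : ℝ) ≤ Q / (t * Real.log p) + 1 := by
      rw [hk, Nat.cast_max]
      refine max_le ?_ (Nat.ceil_lt_add_one (by positivity)).le
      have : 0 ≤ Q / (t * Real.log p) := by positivity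
      push_cast
      linarith
    -- With 1 ≤ 1/t and log p > 1/2 both k and p become 1/t times an affine function of W; the
    -- generous (4W+1)(25W+8) ≤ 1600 (W+1)² yields the square of 40.
    have ht' : 1 ≤ 1 / t := by rw [le_div_iff₀ ht0]; linarith
    have hp_le' : (p : ℝ) ≤ 1 / t * (12.5 * W + 4) := by
      have h2 : Q / (0.32 * t) = 1 / t * (6.25 * W) := by
        rw [hQW]
        field_simp
        ring
      rw [h2] at hp_le
      nlinarith
    have hk_le' : (k : ℝ) ≤ 1 / t * (4 * W + 1) := by
      have h2 : Q / (t * Real.log p) ≤ 1 / t * (4 * W) := by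
        rw [hQW, div_le_iff₀ (by positivity)]
        have h3 : 1 / t * (4 * W) * (t * Real.log p) = 4 * W * Real.log p := by field_simp
        rw [h3]
        nlinarith
      linarith
    calc (k : ℝ) * (2 * p) ≤ (1 / t * (4 * W + 1)) * (2 * (1 / t * (12.5 * W + 4))) := by gcongr
      _ = (1 / t) ^ 2 * ((4 * W + 1) * (25 * W + 8)) := by ring
      _ ≤ (1 / t) ^ 2 * (1600 * (W + 1) ^ 2) :=
        mul_le_mul_of_nonneg_left (by nlinarith) (by positivity)
      _ = _ := by ring

/-- The adaptively constructed shifts are good, and their number is bounded in terms of the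
maximum fiber length and the size of the projections. -/
theorem adaptiveShifts_spec {d : ℕ} (α : ℝ) (γ : ℕ → ℝ) (N : ℕ) (g : Fin d → ℕ) {t : ℝ}
    (ht0 : 0 < t) (ht1 : t < 1) {A : Finset (Fin d → ℤ)} {R V : ℕ}
    {H : Finset (Fin d → ℤ)} (hA : A = hyperbolicCross d α γ (truncation d α γ N))
    (hR : R = maxFiber A N g) (hH : H = fiberDiffs A N g)
    (hV : V = H.sup fun h => (dot h (projectionVector H)).natAbs) :
    1 ≤ (adaptiveShifts α γ N g t).length ∧
    (2 ≤ R → ∀ h ∈ H, ‖expSum (adaptiveShifts α γ N g t) h‖ * ((R : ℝ) - 1) ≤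
      t * (adaptiveShifts α γ N g t).length) ∧
    ((adaptiveShifts α γ N g t).length : ℝ) ≤
        (40 / t * ((R : ℝ) * Real.log V + 1)) ^ 2 := by
  have hV0 := Real.log_natCast_nonneg V
  have hone : (1 : ℝ) ≤ 40 / t := by rw [le_div_iff₀ ht0]; linarith
  rcases Nat.lt_or_ge R 2 with h | h
  · have hY : adaptiveShifts α γ N g t = [0] := by
      rw [adaptiveShifts, ← hA, ← hR, if_pos (by omega)]
    rw [hY]
    refine ⟨le_rfl, fun hc => by omega, ?_⟩
    have : (1 : ℝ) ≤ 40 / t * ((R : ℝ) * Real.log V + 1) :=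
      one_le_mul_of_one_le_of_one_le hone (le_add_of_nonneg_left (by positivity))
    simpa using one_le_pow₀ this (n := 2)
  · set z := projectionVector H with hz
    set pmin : ℝ := (⌊(γ 0 * truncation d α γ N) ^ (1 / α)⌋₊ : ℝ) *
      (⌊(γ 1 * truncation d α γ N) ^ (1 / α)⌋₊ : ℝ) / N with hpmin
    have hY : adaptiveShifts α γ N g t = adaptiveLoop H R t z pmin (nextPrime R)
        (multiLatticeShifts z (ceilingPrimes H R t z)) [] false := by
      rw [adaptiveShifts, ← hA, ← hR, ← hH, if_neg (by omega)]
    have hc := ceilingPrimes_spec hV h ht0 ht1 fun v hv =>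
      dot_projectionVector_ne_zero hv (by
        rw [hH, fiberDiffs] at hv
        exact (Finset.mem_erase.1 hv).1)
    have hs := adaptiveLoop_spec (z := z) (pmin := pmin) h ht0 _ (nextPrime R) _ [] false le_rfl
      (nextPrime_prime R) (by simp) hc.1
    rw [← hY] at hs
    refine ⟨hs.1.1, fun _ => hs.1.2, ?_⟩
    refine (Nat.cast_le.2 hs.2).trans (hc.2.trans ?_)
    have hR1 : (2 : ℝ) ≤ R := by exact_mod_cast h
    have h5 : 0 ≤ ((R : ℝ) - 1) * Real.log V := mul_nonneg (by linarith) hV0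
    have h6 : ((R : ℝ) - 1) * Real.log V ≤ R * Real.log V := by nlinarith
    gcongr

/-! ### Sums over the weights -/

/-- The value `ζ(s)` for real `s`. -/
def realZeta (s : ℝ) : ℝ := (riemannZeta (s : ℂ)).re

theorem realZeta_eq_tsum {s : ℝ} (hs : 1 < s) :
    realZeta s = ∑' n : ℕ, ((n : ℝ) + 1) ^ (-s) := by
  have h1 : riemannZeta (s : ℂ) = ((∑' n : ℕ, ((n : ℝ) + 1) ^ (-s) : ℝ) : ℂ) := by
    rw [zeta_eq_tsum_one_div_nat_add_one_cpow (by simpa using hs), Complex.ofReal_tsum]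
    refine tsum_congr fun n => ?_
    rw [Complex.ofReal_cpow (by positivity), Complex.ofReal_neg, Complex.cpow_neg, one_div]
    push_cast
    rfl
  rw [realZeta, h1, Complex.ofReal_re]

theorem realZeta_nonneg {s : ℝ} (hs : 1 < s) : 0 ≤ realZeta s := by
  rw [realZeta_eq_tsum hs]
  exact tsum_nonneg fun n => by positivity

theorem ofReal_realZeta {s : ℝ} (hs : 1 < s) :
    ENNReal.ofReal (realZeta s) = ∑' n : ℕ, ENNReal.ofReal (((n : ℝ) + 1) ^ (-s)) := by
  rw [realZeta_eq_tsum hs, ENNReal.ofReal_tsum_of_nonneg (fun n => by positivity)]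
  have := (summable_nat_add_iff 1).2 (Real.summable_nat_rpow.2 (by linarith : -s < -1))
  simpa using this

theorem tsum_int_abs_rpow {s : ℝ} (hs : 1 < s) :
    ∑' m : ℤ, (if m = 0 then 0 else ENNReal.ofReal (|(m : ℝ)| ^ (-s))) =
      ENNReal.ofReal (2 * realZeta s) := by
  set f : ℤ → ℝ≥0∞ := fun m => if m = 0 then 0 else ENNReal.ofReal (|(m : ℝ)| ^ (-s)) with hf
  have h1 : ∀ n : ℕ, f (-((n : ℤ) + 1)) = ENNReal.ofReal (((n : ℝ) + 1) ^ (-s)) := by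
    intro n
    have h : -((n : ℤ) + 1) ≠ 0 := by omega
    simp only [hf, if_neg h]
    congr 2
    push_cast
    rw [abs_neg, abs_of_nonneg (by positivity)]
  have h2 : ∀ n : ℕ, f ((n + 1 : ℕ) : ℤ) = ENNReal.ofReal (((n : ℝ) + 1) ^ (-s)) := by
    intro n
    have h : ((n + 1 : ℕ) : ℤ) ≠ 0 := by omega
    simp only [hf, if_neg h]
    congr 2
    push_cast
    rw [abs_of_nonneg (by positivity)]
  have h3 : HasSum (fun n : ℕ => f n) (ENNReal.ofReal (realZeta s)) := by
    rw [ofReal_realZeta hs, ← zero_add (∑' _, _)]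
    have h0 : f ((0 : ℕ) : ℤ) = 0 := by simp [hf]
    have : ∑' n : ℕ, f n = 0 + ∑' n : ℕ, ENNReal.ofReal (((n : ℝ) + 1) ^ (-s)) := by
      rw [tsum_eq_zero_add' ENNReal.summable, h0]
      simp_rw [h2]
    rw [← this]
    exact ENNReal.summable.hasSum
  have h4 : HasSum (fun n : ℕ => f (-((n : ℤ) + 1))) (ENNReal.ofReal (realZeta s)) := by
    rw [ofReal_realZeta hs]
    simp_rw [h1]
    exact ENNReal.summable.hasSum
  rw [(h3.of_nat_of_neg_add_one h4).tsum_eq, two_mul,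
    ENNReal.ofReal_add (realZeta_nonneg hs) (realZeta_nonneg hs)]

/-- One factor of `r_{α,γ}(k)^{-p}`. -/
def factorPow (α c p : ℝ) (m : ℤ) : ℝ≥0∞ := ENNReal.ofReal ((max 1 (|(m : ℝ)| ^ α / c)) ^ (-p))

/-- The power `r_{α,γ}(k)^{-p}` in `ℝ≥0∞`. -/
def weightPow {s : ℕ} (α : ℝ) (γ : ℕ → ℝ) (p : ℝ) (k : Fin s → ℤ) : ℝ≥0∞ :=
  ENNReal.ofReal (weight α γ k ^ (-p))

theorem weight_pos {d : ℕ} (α : ℝ) (γ : ℕ → ℝ) (k : Fin d → ℤ) : 0 < weight α γ k :=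
  zero_lt_one.trans_le (one_le_weight α γ k)

theorem weightPow_eq_prod {s : ℕ} (α : ℝ) (γ : ℕ → ℝ) (p : ℝ) (k : Fin s → ℤ) :
    weightPow α γ p k = ∏ j : Fin s, factorPow α (γ j) p (k j) := by
  rw [weightPow, weight, ← Real.finsetProd_rpow _ _ fun j _ => zero_le_one.trans (le_max_left _ _),
    ENNReal.ofReal_prod_of_nonneg fun j _ =>
      Real.rpow_nonneg (zero_le_one.trans (le_max_left _ _)) _]
  rfl

theorem weightPow_rpow {s : ℕ} (α : ℝ) (γ : ℕ → ℝ) (p q : ℝ) (hq : 0 ≤ q) (k : Fin s → ℤ) :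
    weightPow α γ p k ^ q = weightPow α γ (p * q) k := by
  have h := (weight_pos α γ k).le
  rw [weightPow, weightPow, ENNReal.ofReal_rpow_of_nonneg (by positivity) hq, ← Real.rpow_mul h]
  ring_nf

theorem weightPow_snoc {s : ℕ} (α : ℝ) (γ : ℕ → ℝ) (p : ℝ) (k : Fin s → ℤ) (m : ℤ) :
    weightPow (s := s + 1) α γ p (Fin.snoc k m) = weightPow α γ p k * factorPow α (γ s) p m := by
  rw [weightPow_eq_prod, weightPow_eq_prod, Fin.prod_univ_castSucc]
  simp

theorem factorPow_zero {α : ℝ} (hα : 0 < α) (c p : ℝ) : factorPow α c p 0 = 1 := by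
  simp [factorPow, Real.zero_rpow hα.ne']

theorem factorPow_le {α c p : ℝ} (hc : 0 < c) (hp : 0 ≤ p) {m : ℤ} (hm : m ≠ 0) :
    factorPow α c p m ≤ ENNReal.ofReal (c ^ p) * ENNReal.ofReal (|(m : ℝ)| ^ (-(α * p))) := by
  have hm' : 0 < |(m : ℝ)| := abs_pos.2 (by exact_mod_cast hm)
  rw [factorPow, ← ENNReal.ofReal_mul (by positivity)]
  refine ENNReal.ofReal_le_ofReal ?_
  calc (max 1 (|(m : ℝ)| ^ α / c)) ^ (-p) ≤ (|(m : ℝ)| ^ α / c) ^ (-p) :=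
        Real.rpow_le_rpow_of_nonpos (by positivity) (le_max_right _ _) (by linarith)
    _ = _ := by
        rw [Real.div_rpow (by positivity) hc.le, ← Real.rpow_mul hm'.le, Real.rpow_neg hc.le,
          div_inv_eq_mul, mul_comm]
        ring_nf

theorem tsum_factorPow_ne_zero_le {α c p : ℝ} (hc : 0 < c) (hp : 0 ≤ p) (hαp : 1 < α * p) :
    ∑' m : ℤ, (if m = 0 then 0 else factorPow α c p m) ≤
      ENNReal.ofReal (2 * c ^ p * realZeta (α * p)) := by
  have h : 2 * c ^ p * realZeta (α * p) = c ^ p * (2 * realZeta (α * p)) := by ring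
  rw [h, ENNReal.ofReal_mul (by positivity), ← tsum_int_abs_rpow hαp, ← ENNReal.tsum_mul_left]
  refine ENNReal.tsum_le_tsum fun m => ?_
  split_ifs with hm
  · exact zero_le
  · exact factorPow_le hc hp hm

/-- Passing to m = N m' gains N^(-αp) ≤ 1/N. In the averaging argument this offsets the fact that
every x is admissible when N divides m. -/
theorem tsum_factorPow_dvd_le {α c p : ℝ} (hc : 0 < c) (hp : 0 ≤ p) (hαp : 1 < α * p)
    {N : ℕ} (hN : N ≠ 0) :
    ∑' m : ℤ, (if m ≠ 0 ∧ (N : ℤ) ∣ m then factorPow α c p m else 0) ≤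
      ENNReal.ofReal (2 * c ^ p * realZeta (α * p) / N) := by
  have hN0 : (0 : ℝ) < N := by exact_mod_cast Nat.pos_of_ne_zero hN
  have hN1 : (1 : ℝ) ≤ N := by exact_mod_cast Nat.one_le_iff_ne_zero.2 hN
  have hNZ : (N : ℤ) ≠ 0 := by exact_mod_cast hN
  have h : 2 * c ^ p * realZeta (α * p) / N = c ^ p / N * (2 * realZeta (α * p)) := by ring
  have hinj : Function.Injective fun m : ℤ => (N : ℤ) * m := fun a b hab =>
    mul_left_cancel₀ hNZ hab
  rw [h, ENNReal.ofReal_mul (by positivity), ← tsum_int_abs_rpow hαp, ← ENNReal.tsum_mul_left,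
    ← hinj.tsum_eq]
  · refine ENNReal.tsum_le_tsum fun m => ?_
    by_cases hm : m = 0
    · simp [hm]
    · have hNm : (N : ℤ) * m ≠ 0 := mul_ne_zero hNZ hm
      rw [if_pos ⟨hNm, dvd_mul_right _ _⟩, if_neg hm]
      refine (factorPow_le hc hp hNm).trans ?_
      rw [← ENNReal.ofReal_mul (by positivity), ← ENNReal.ofReal_mul (by positivity)]
      refine ENNReal.ofReal_le_ofReal ?_
      rw [Int.cast_mul, abs_mul, Int.cast_natCast, Nat.abs_cast,
        Real.mul_rpow hN0.le (abs_nonneg _), ← mul_assoc]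
      refine mul_le_mul_of_nonneg_right ?_ (by positivity)
      rw [div_eq_mul_inv]
      refine mul_le_mul_of_nonneg_left ?_ (by positivity)
      rw [← Real.rpow_neg_one]
      exact Real.rpow_le_rpow_of_exponent_le hN1 (by linarith)
  · intro m hm
    by_contra hc'
    refine hm (if_neg fun h => hc' ?_)
    obtain ⟨-, m', rfl⟩ := h
    exact ⟨m', rfl⟩

theorem tsum_factorPow_le {α c p : ℝ} (hα : 0 < α) (hc : 0 < c) (hp : 0 ≤ p)
    (hαp : 1 < α * p) :
    ∑' m : ℤ, factorPow α c p m ≤ ENNReal.ofReal (1 + 2 * c ^ p * realZeta (α * p)) := by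
  have h1 : ∀ m : ℤ, factorPow α c p m = (if m = 0 then 1 else 0) +
      (if m = 0 then 0 else factorPow α c p m) := by
    intro m
    by_cases hm : m = 0
    · simp [hm, factorPow_zero hα]
    · simp [hm]
  have h2 := realZeta_nonneg hαp
  rw [tsum_congr h1, ENNReal.tsum_add, tsum_ite_eq, ENNReal.ofReal_add zero_le_one (by positivity),
    ENNReal.ofReal_one]
  exact add_le_add le_rfl (tsum_factorPow_ne_zero_le hc hp hαp)

/-- The product `∏_j (1 + 2 γ_j^p ζ(α p))`. -/
def zetaProd (s : ℕ) (α : ℝ) (γ : ℕ → ℝ) (p : ℝ) : ℝ :=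
  ∏ j : Fin s, (1 + 2 * γ j ^ p * realZeta (α * p))

theorem one_le_zetaProd {s : ℕ} {α : ℝ} {γ : ℕ → ℝ} {p : ℝ} (hγ : ∀ j, 0 < γ j)
    (hαp : 1 < α * p) : 1 ≤ zetaProd s α γ p := by
  refine Finset.one_le_prod fun j _ => ?_
  have h1 := realZeta_nonneg hαp
  have h2 := Real.rpow_nonneg (hγ j).le p
  show 1 ≤ 1 + 2 * γ j ^ p * realZeta (α * p)
  nlinarith [mul_nonneg h2 h1]

theorem zetaProd_succ (s : ℕ) (α : ℝ) (γ : ℕ → ℝ) (p : ℝ) :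
    zetaProd (s + 1) α γ p = zetaProd s α γ p * (1 + 2 * γ s ^ p * realZeta (α * p)) := by
  rw [zetaProd, Fin.prod_univ_castSucc]
  simp [zetaProd]

theorem tsum_pi_snoc {s : ℕ} (F : (Fin (s + 1) → ℤ) → ℝ≥0∞) :
    ∑' k, F k = ∑' (m : ℤ) (k : Fin s → ℤ), F (Fin.snoc k m) := by
  rw [← ENNReal.tsum_prod, ← (Fin.snocEquiv fun _ => ℤ).tsum_eq F]
  rfl

/-- The weight is a product, so the sum factorizes coordinate by coordinate; αp > 1 makes each
factor finite. -/
theorem tsum_weightPow_le {α : ℝ} {γ : ℕ → ℝ} {p : ℝ} (hα : 0 < α) (hγ : ∀ j, 0 < γ j)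
    (hp : 0 ≤ p) (hαp : 1 < α * p) : ∀ s : ℕ,
    ∑' k : Fin s → ℤ, weightPow α γ p k ≤ ENNReal.ofReal (zetaProd s α γ p)
  | 0 => by
    rw [tsum_eq_single 0 fun b hb => absurd (Subsingleton.elim b 0) hb]
    simp [weightPow, weight, zetaProd]
  | s + 1 => by
    rw [tsum_pi_snoc, zetaProd_succ,
      ENNReal.ofReal_mul (zero_le_one.trans (one_le_zetaProd hγ hαp))]
    simp_rw [weightPow_snoc, ENNReal.tsum_mul_right, ENNReal.tsum_mul_left]
    exact mul_le_mul' (tsum_weightPow_le hα hγ hp hαp s) (tsum_factorPow_le hα (hγ s) hp hαp)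

/-! ### The truncation parameter -/

/-- The expression whose supremum is the truncation parameter. -/
def truncationTerm (d : ℕ) (α : ℝ) (γ : ℕ → ℝ) (N : ℕ) (l : ℝ) : ℝ :=
  ((N : ℝ) / 2 * (zetaProd d α γ l)⁻¹) ^ (1 / l)

theorem truncation_eq (d : ℕ) (α : ℝ) (γ : ℕ → ℝ) (N : ℕ) :
    truncation d α γ N = sSup (truncationTerm d α γ N '' Set.Ioc (1 / α) 2) := by
  simp only [truncation, Finset.prod_inv_distrib]
  rfl

theorem one_lt_mul_of_one_div_lt {α l : ℝ} (hα : 0 < α) (hl : 1 / α < l) : 1 < α * l := by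
  rw [div_lt_iff₀ hα] at hl
  linarith

theorem truncationTerm_le {d : ℕ} {α : ℝ} {γ : ℕ → ℝ} {N : ℕ} (hα : 0 < α) (hγ : ∀ j, 0 < γ j)
    {l : ℝ} (hl : 1 / α < l) : truncationTerm d α γ N l ≤ ((N : ℝ) / 2) ^ (1 / l) := by
  have hl0 : 0 < l := (by positivity : 0 < 1 / α).trans hl
  have h1 := one_le_zetaProd (s := d) hγ (one_lt_mul_of_one_div_lt hα hl)
  refine Real.rpow_le_rpow (by positivity) ?_ (by positivity)
  exact mul_le_of_le_one_right (by positivity) (inv_le_one_of_one_le₀ h1)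

theorem truncationTerm_le_rpow {d : ℕ} {α : ℝ} {γ : ℕ → ℝ} {N : ℕ} (hα : 0 < α)
    (hγ : ∀ j, 0 < γ j) (hN : 2 ≤ N) {l : ℝ} (hl : 1 / α < l) :
    truncationTerm d α γ N l ≤ ((N : ℝ) / 2) ^ α := by
  have hN' : (2 : ℝ) ≤ N := by exact_mod_cast hN
  refine (truncationTerm_le hα hγ hl).trans ?_
  refine Real.rpow_le_rpow_of_exponent_le (by linarith) ?_
  rw [one_div_le ((by positivity : 0 < 1 / α).trans hl) hα]
  exact hl.le

theorem truncation_le {d : ℕ} {α : ℝ} {γ : ℕ → ℝ} {N : ℕ} (hα : 1 / 2 < α) {B : ℝ}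
    (hB : ∀ l, 1 / α < l → l ≤ 2 → truncationTerm d α γ N l ≤ B) : truncation d α γ N ≤ B := by
  rw [truncation_eq]
  refine csSup_le ⟨_, Set.mem_image_of_mem _ (?_ : (2 : ℝ) ∈ _)⟩ ?_
  · exact ⟨by rw [one_div_lt (by linarith) (by norm_num)]; exact hα, le_rfl⟩
  · rintro _ ⟨l, hl, rfl⟩
    exact hB l hl.1 hl.2

theorem truncation_le_rpow {d : ℕ} {α : ℝ} {γ : ℕ → ℝ} {N : ℕ} (hα : 1 / 2 < α)
    (hγ : ∀ j, 0 < γ j) (hN : 2 ≤ N) : truncation d α γ N ≤ ((N : ℝ) / 2) ^ α :=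
  truncation_le hα fun _ hl _ => truncationTerm_le_rpow (by linarith) hγ hN hl

theorem truncationTerm_le_truncation {d : ℕ} {α : ℝ} {γ : ℕ → ℝ} {N : ℕ} (hα : 1 / 2 < α)
    (hγ : ∀ j, 0 < γ j) (hN : 2 ≤ N) {l : ℝ} (hl : 1 / α < l) (hl2 : l ≤ 2) :
    truncationTerm d α γ N l ≤ truncation d α γ N := by
  rw [truncation_eq]
  refine le_csSup ⟨((N : ℝ) / 2) ^ α, ?_⟩ ⟨l, ⟨hl, hl2⟩, rfl⟩
  rintro _ ⟨l', hl', rfl⟩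
  exact truncationTerm_le_rpow (by linarith) hγ hN hl'.1

/-- The truncation parameter is nearly of order `N^α`. -/
theorem exists_le_truncation (d : ℕ) {α : ℝ} {γ : ℕ → ℝ} (hα : 1 / 2 < α) (hγ : ∀ j, 0 < γ j)
    {ε : ℝ} (hε : 0 < ε) :
    ∃ c : ℝ, 0 < c ∧ ∀ N : ℕ, 2 ≤ N → c * (N : ℝ) ^ (α - ε) ≤ truncation d α γ N := by
  -- The exponent 1/λ should be close to α, but λ ≤ 2 requires 1/λ ≥ 1/2; δ respects both, and the
  -- supremum is bounded below by the single term λ = 1/(α - δ).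
  set δ := min ε (α - 1 / 2) with hδ
  have hδ0 : 0 < δ := lt_min hε (by linarith)
  have hδ1 : 1 / 2 ≤ α - δ := by
    have := min_le_right ε (α - 1 / 2)
    linarith
  have hpos : 0 < α - δ := by linarith
  set l := 1 / (α - δ) with hl
  have hl1 : 1 / α < l := one_div_lt_one_div_of_lt hpos (by linarith)
  have hl2 : l ≤ 2 := by rw [hl, one_div_le hpos (by norm_num)]; exact hδ1
  have hz := one_le_zetaProd (s := d) hγ (one_lt_mul_of_one_div_lt (by linarith) hl1)
  have hz0 : 0 < zetaProd d α γ l := by linarith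
  refine ⟨(1 / 2 * (zetaProd d α γ l)⁻¹) ^ (α - δ), by positivity, fun N hN => ?_⟩
  refine le_trans ?_ (truncationTerm_le_truncation hα hγ hN hl1 hl2)
  have hN1 : (1 : ℝ) ≤ N := by exact_mod_cast (by omega : 1 ≤ N)
  rw [truncationTerm, show 1 / l = α - δ by rw [hl, one_div_one_div],
    show (N : ℝ) / 2 * (zetaProd d α γ l)⁻¹ = (1 / 2 * (zetaProd d α γ l)⁻¹) * N by ring,
    Real.mul_rpow (x := 1 / 2 * (zetaProd d α γ l)⁻¹) (y := N) (by positivity) (by positivity)]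
  gcongr
  exact min_le_left ε (α - 1 / 2)

theorem truncation_pos {d : ℕ} {α : ℝ} {γ : ℕ → ℝ} {N : ℕ} (hα : 1 / 2 < α)
    (hγ : ∀ j, 0 < γ j) (hN : 2 ≤ N) : 0 < truncation d α γ N := by
  obtain ⟨c, hc, h⟩ := exists_le_truncation d (α := α) (γ := γ) hα hγ (ε := 1) one_pos
  have hN0 : (0 : ℝ) < N := by exact_mod_cast (by omega : 0 < N)
  exact (mul_pos hc (Real.rpow_pos_of_pos hN0 _)).trans_le (h N hN)

/-! ### Component-by-component construction -/

/-- Jensen's inequality for sums, i.e. subadditivity of x ↦ x^q for q ≤ 1. It lets a vector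
minimizing one exponent be analysed for every smaller exponent p > 1/α. -/
theorem tsum_rpow_le_tsum_rpow {ι : Type*} (f : ι → ℝ≥0∞) {q : ℝ} (hq0 : 0 < q) (hq1 : q ≤ 1) :
    (∑' i, f i) ^ q ≤ ∑' i, f i ^ q := by
  have hfin : ∀ s : Finset ι, (∑ i ∈ s, f i) ^ q ≤ ∑ i ∈ s, f i ^ q := by
    classical
    intro s
    induction s using Finset.induction_on with
    | empty => simp [ENNReal.zero_rpow_of_pos hq0]
    | insert a s ha ih =>
      rw [Finset.sum_insert ha, Finset.sum_insert ha]
      exact (ENNReal.rpow_add_le_add_rpow _ _ hq0.le hq1).trans (add_le_add le_rfl ih)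
  rw [← ENNReal.le_rpow_inv_iff hq0]
  refine ENNReal.summable.tsum_le_of_sum_le fun s => ?_
  rw [ENNReal.le_rpow_inv_iff hq0]
  exact (hfin s).trans (ENNReal.sum_le_tsum s)

open Classical in
/-- The sum of `r_{α,γ}(k)^{-p}` over the non-zero elements of the dual lattice. -/
def dualSum {s : ℕ} (α : ℝ) (γ : ℕ → ℝ) (p : ℝ) (N : ℕ) (v : Fin s → ℕ) : ℝ≥0∞ :=
  ∑' k : Fin s → ℤ, if k ≠ 0 ∧ (N : ℤ) ∣ ∑ j, k j * v j then weightPow α γ p k else 0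

open Classical in
/-- The part of the sum over the dual lattice of `(v, x)` with non-zero last component. -/
def lastSum {s : ℕ} (α : ℝ) (γ : ℕ → ℝ) (p : ℝ) (N : ℕ) (v : Fin s → ℕ) (x : ℕ) : ℝ≥0∞ :=
  ∑' (m : ℤ) (k : Fin s → ℤ), if m ≠ 0 ∧ (N : ℤ) ∣ ∑ j, k j * v j + m * x then
    weightPow α γ p k * factorPow α (γ s) p m else 0

theorem dualSum_le {s : ℕ} {α : ℝ} {γ : ℕ → ℝ} {p : ℝ} (N : ℕ) (v : Fin s → ℕ) (hα : 0 < α)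
    (hγ : ∀ j, 0 < γ j) (hp : 0 ≤ p) (hαp : 1 < α * p) :
    dualSum α γ p N v ≤ ENNReal.ofReal (zetaProd s α γ p) := by
  refine le_trans (ENNReal.tsum_le_tsum fun k => ?_) (tsum_weightPow_le hα hγ hp hαp s)
  split_ifs
  · exact le_rfl
  · exact zero_le

/-- Transfers the criterion to `ℝ≥0∞`, where sums can be split and rearranged freely; α > 1/2
supplies the summability without which the real sum would be 0 by default. -/
theorem ofReal_integrationError {s : ℕ} {α : ℝ} {γ : ℕ → ℝ} (N : ℕ) (v : Fin s → ℕ)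
    (hα : 1 / 2 < α) (hγ : ∀ j, 0 < γ j) :
    ENNReal.ofReal (integrationError α γ N v) = dualSum α γ 2 N v := by
  classical
  have h1 : ∀ k : Fin s → ℤ, ENNReal.ofReal (1 / weight α γ k ^ 2) = weightPow α γ 2 k := by
    intro k
    rw [weightPow, Real.rpow_neg (weight_pos α γ k).le, one_div]
    norm_cast
  have h2 : ∑' k : ↥(dualLattice N v \ {0}), ENNReal.ofReal (1 / weight α γ (k : Fin s → ℤ) ^ 2) =
      dualSum α γ 2 N v := by
    simp_rw [h1]
    rw [tsum_subtype (dualLattice N v \ {0}) (weightPow α γ 2), dualSum]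
    refine tsum_congr fun k => ?_
    rw [Set.indicator_apply]
    refine if_congr ?_ rfl rfl
    simp [dualLattice, and_comm]
  have h3 : dualSum α γ 2 N v ≠ ∞ :=
    ((dualSum_le N v (by linarith) hγ zero_le_two (by linarith)).trans_lt ENNReal.ofReal_lt_top).ne
  rw [integrationError, ENNReal.ofReal_tsum_of_nonneg, h2]
  · intro k
    positivity
  · rw [← h2] at h3
    have h4 := ENNReal.summable_toReal h3
    refine h4.congr fun k => ?_
    rw [ENNReal.toReal_ofReal]
    positivity

theorem dualSum_snoc {s : ℕ} {α : ℝ} {γ : ℕ → ℝ} {p : ℝ} (N : ℕ) (v : Fin s → ℕ) (x : ℕ)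
    (hα : 0 < α) : dualSum (s := s + 1) α γ p N (Fin.snoc v x) =
      dualSum α γ p N v + lastSum α γ p N v x := by
  classical
  rw [dualSum, tsum_pi_snoc, lastSum]
  have h1 : ∀ (m : ℤ) (k : Fin s → ℤ),
      (if (Fin.snoc k m : Fin (s + 1) → ℤ) ≠ 0 ∧ (N : ℤ) ∣ ∑ j, (Fin.snoc k m : Fin (s + 1) → ℤ) j *
        ((Fin.snoc v x : Fin (s + 1) → ℕ) j : ℤ)
        then weightPow (s := s + 1) α γ p (Fin.snoc k m) else 0) =
      (if m = 0 then (if k ≠ 0 ∧ (N : ℤ) ∣ ∑ j, k j * v j then weightPow α γ p k else 0) else 0) +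
      (if m ≠ 0 ∧ (N : ℤ) ∣ ∑ j, k j * v j + m * x then
        weightPow α γ p k * factorPow α (γ s) p m else 0) := by
    intro m k
    have hsum : ∑ j, (Fin.snoc k m : Fin (s + 1) → ℤ) j *
        ((Fin.snoc v x : Fin (s + 1) → ℕ) j : ℤ) = ∑ j, k j * v j + m * x := by
      rw [Fin.sum_univ_castSucc]
      simp
    have hzero : (Fin.snoc k m : Fin (s + 1) → ℤ) = 0 ↔ k = 0 ∧ m = 0 := by
      constructor
      · intro h
        refine ⟨funext fun j => ?_, ?_⟩
        · simpa using congrFun h j.castSucc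
        · simpa using congrFun h (Fin.last s)
      · rintro ⟨rfl, rfl⟩
        funext j
        refine Fin.lastCases ?_ (fun i => ?_) j <;> simp
    rw [hsum, weightPow_snoc]
    by_cases hm : m = 0
    · subst hm
      simp [hzero, factorPow_zero hα]
    · simp [hzero, hm]
  simp_rw [h1, ENNReal.tsum_add]
  congr 1
  rw [tsum_eq_single 0]
  · simp [dualSum]
  · intro m hm
    simp [hm]

/-- If N does not divide m, then m is invertible modulo the prime N and determines x. -/
theorem card_filter_dvd_le {N : ℕ} (hN : N.Prime) (a : ℤ) {m : ℤ} (hm : ¬ (N : ℤ) ∣ m) :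
    ((Finset.Icc 1 (N - 1)).filter fun x : ℕ => (N : ℤ) ∣ a + m * x).card ≤ 1 := by
  refine Finset.card_le_one.2 fun x hx y hy => ?_
  simp only [Finset.mem_filter, Finset.mem_Icc] at hx hy
  have h1 : (N : ℤ) ∣ m * ((x : ℤ) - y) := by
    have := dvd_sub hx.2 hy.2
    ring_nf at this ⊢
    exact this
  have h2 := ((Nat.prime_iff_prime_int.1 hN).dvd_or_dvd h1).resolve_left hm
  have h3 : (x : ℤ) - y = 0 := by
    refine Int.eq_zero_of_abs_lt_dvd h2 ?_
    rw [abs_lt]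
    omega
  omega

/-- The average of `lastSum` over all choices of the last component. -/
theorem sum_lastSum_le {s : ℕ} {α : ℝ} {γ : ℕ → ℝ} {p : ℝ} {N : ℕ} (hN : N.Prime)
    (v : Fin s → ℕ) (hα : 0 < α) (hγ : ∀ j, 0 < γ j) (hp : 0 ≤ p) (hαp : 1 < α * p) :
    ∑ x ∈ Finset.Icc 1 (N - 1), lastSum α γ p N v x ≤
      2 * (ENNReal.ofReal (zetaProd s α γ p) *
        ENNReal.ofReal (2 * γ s ^ p * realZeta (α * p))) := by
  classical
  set c := 2 * γ s ^ p * realZeta (α * p) with hc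
  have hc0 : 0 ≤ c := by
    have h1 := realZeta_nonneg hαp
    have h2 := Real.rpow_nonneg (hγ s).le p
    positivity
  set T : ℝ≥0∞ := ∑' k : Fin s → ℤ, weightPow α γ p k with hT
  have hTle : T ≤ ENNReal.ofReal (zetaProd s α γ p) := tsum_weightPow_le hα hγ hp hαp s
  have h1 : ∀ (m : ℤ) (k : Fin s → ℤ), ∑ x ∈ Finset.Icc 1 (N - 1),
      (if m ≠ 0 ∧ (N : ℤ) ∣ ∑ j, k j * v j + m * x then
        weightPow α γ p k * factorPow α (γ s) p m else 0) ≤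
      weightPow α γ p k * ((if m = 0 then 0 else factorPow α (γ s) p m) +
        ((N - 1 : ℕ) : ℝ≥0∞) * (if m ≠ 0 ∧ (N : ℤ) ∣ m then factorPow α (γ s) p m else 0)) := by
    intro m k
    by_cases hm : m = 0
    · simp [hm]
    simp only [ne_eq, hm, not_false_eq_true, true_and, if_false]
    rw [← Finset.sum_filter, Finset.sum_const, nsmul_eq_mul]
    by_cases hd : (N : ℤ) ∣ m
    · rw [if_pos hd]
      have h2 : (((Finset.Icc 1 (N - 1)).filter fun x : ℕ =>
          (N : ℤ) ∣ ∑ j, k j * v j + m * x).card : ℝ≥0∞) ≤ ((N - 1 : ℕ) : ℝ≥0∞) := by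
        have := Finset.card_filter_le (Finset.Icc 1 (N - 1)) fun x : ℕ =>
          (N : ℤ) ∣ ∑ j, k j * v j + m * x
        rw [Nat.card_Icc, Nat.add_sub_cancel] at this
        exact_mod_cast this
      calc _ ≤ ((N - 1 : ℕ) : ℝ≥0∞) * (weightPow α γ p k * factorPow α (γ s) p m) :=
            mul_le_mul' h2 le_rfl
        _ = weightPow α γ p k * (((N - 1 : ℕ) : ℝ≥0∞) * factorPow α (γ s) p m) := by ring
        _ ≤ _ := mul_le_mul' le_rfl le_add_self
    · rw [if_neg hd, mul_zero, add_zero]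
      have h2 : (((Finset.Icc 1 (N - 1)).filter fun x : ℕ =>
          (N : ℤ) ∣ ∑ j, k j * v j + m * x).card : ℝ≥0∞) ≤ 1 := by
        exact_mod_cast card_filter_dvd_le hN _ hd
      calc _ ≤ 1 * (weightPow α γ p k * factorPow α (γ s) p m) := mul_le_mul' h2 le_rfl
        _ = _ := one_mul _
  -- The sparsity of the multiples of N outweighs their N - 1 admissible values, so the two kinds of
  -- m cost c each.
  have h2 : ((N - 1 : ℕ) : ℝ≥0∞) * ENNReal.ofReal (c / N) ≤ ENNReal.ofReal c := by
    have hN0 : (0 : ℝ) < N := by exact_mod_cast hN.pos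
    rw [← ENNReal.ofReal_natCast, ← ENNReal.ofReal_mul (by positivity)]
    refine ENNReal.ofReal_le_ofReal ?_
    rw [mul_div_assoc', div_le_iff₀ hN0, mul_comm]
    exact mul_le_mul_of_nonneg_left (by exact_mod_cast Nat.sub_le N 1) hc0
  calc ∑ x ∈ Finset.Icc 1 (N - 1), lastSum α γ p N v x
      = ∑' (m : ℤ) (k : Fin s → ℤ), ∑ x ∈ Finset.Icc 1 (N - 1),
        (if m ≠ 0 ∧ (N : ℤ) ∣ ∑ j, k j * v j + m * x then
          weightPow α γ p k * factorPow α (γ s) p m else 0) := by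
        simp only [lastSum]
        rw [← Summable.tsum_finsetSum fun _ _ => ENNReal.summable]
        refine tsum_congr fun m => ?_
        rw [← Summable.tsum_finsetSum fun _ _ => ENNReal.summable]
    _ ≤ ∑' (m : ℤ) (k : Fin s → ℤ), weightPow α γ p k *
        ((if m = 0 then 0 else factorPow α (γ s) p m) + ((N - 1 : ℕ) : ℝ≥0∞) *
          (if m ≠ 0 ∧ (N : ℤ) ∣ m then factorPow α (γ s) p m else 0)) :=
        ENNReal.tsum_le_tsum fun m => ENNReal.tsum_le_tsum fun k => h1 m k
    _ = T * (∑' m : ℤ, (if m = 0 then 0 else factorPow α (γ s) p m) + ((N - 1 : ℕ) : ℝ≥0∞) *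
          ∑' m : ℤ, (if m ≠ 0 ∧ (N : ℤ) ∣ m then factorPow α (γ s) p m else 0)) := by
        simp_rw [ENNReal.tsum_mul_right, ENNReal.tsum_mul_left, ENNReal.tsum_add,
          ENNReal.tsum_mul_left]
        rfl
    _ ≤ ENNReal.ofReal (zetaProd s α γ p) * (ENNReal.ofReal c +
          ((N - 1 : ℕ) : ℝ≥0∞) * ENNReal.ofReal (c / N)) := by
        refine mul_le_mul' hTle (add_le_add (tsum_factorPow_ne_zero_le (hγ s) hp hαp)
          (mul_le_mul' le_rfl (tsum_factorPow_dvd_le (hγ s) hp hαp hN.ne_zero)))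
    _ ≤ ENNReal.ofReal (zetaProd s α γ p) * (ENNReal.ofReal c + ENNReal.ofReal c) :=
        mul_le_mul' le_rfl (add_le_add le_rfl h2)
    _ = _ := by ring

theorem factorPow_rpow (α c p : ℝ) {q : ℝ} (hq : 0 ≤ q) (m : ℤ) :
    factorPow α c p m ^ q = factorPow α c (p * q) m := by
  have h : 0 ≤ max 1 (|(m : ℝ)| ^ α / c) := zero_le_one.trans (le_max_left _ _)
  rw [factorPow, factorPow, ENNReal.ofReal_rpow_of_nonneg (by positivity) hq, ← Real.rpow_mul h]
  ring_nf

theorem lastSum_rpow_le {s : ℕ} (α : ℝ) (γ : ℕ → ℝ) (p : ℝ) (N : ℕ) (v : Fin s → ℕ) (x : ℕ)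
    {q : ℝ} (hq0 : 0 < q) (hq1 : q ≤ 1) :
    lastSum α γ p N v x ^ q ≤ lastSum α γ (p * q) N v x := by
  classical
  refine (tsum_rpow_le_tsum_rpow _ hq0 hq1).trans (ENNReal.tsum_le_tsum fun m => ?_)
  refine (tsum_rpow_le_tsum_rpow _ hq0 hq1).trans (ENNReal.tsum_le_tsum fun k => ?_)
  split_ifs
  · rw [ENNReal.mul_rpow_of_nonneg _ _ hq0.le, weightPow_rpow _ _ _ _ hq0.le,
      factorPow_rpow _ _ _ hq0.le]
  · simp [hq0]

theorem initialPart_eq_snoc {d : ℕ} (g : Fin d → ℕ) (n : ℕ) (hn : n < d) :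
    initialPart g ⟨n, hn⟩ =
      (Fin.snoc (fun i : Fin n => g (Fin.castLE hn.le i)) (g ⟨n, hn⟩) : Fin (n + 1) → ℕ) := by
  funext j
  refine Fin.lastCases ?_ (fun i => ?_) j
  · rw [Fin.snoc_last]
    rfl
  · rw [Fin.snoc_castSucc]
    rfl

theorem initialPart_update {d : ℕ} (g : Fin d → ℕ) (n : ℕ) (hn : n < d) (x : ℕ) :
    initialPart (Function.update g ⟨n, hn⟩ x) ⟨n, hn⟩ =
      (Fin.snoc (fun i : Fin n => g (Fin.castLE hn.le i)) x : Fin (n + 1) → ℕ) := by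
  rw [initialPart_eq_snoc, Function.update_self]
  congr 1
  funext i
  refine Function.update_of_ne ?_ _ _
  intro h
  have h1 := congrArg Fin.val h
  have h2 := i.isLt
  simp only [Fin.val_castLE] at h1
  omega

/-- The part of the criterion without the new component does not depend on x, so the minimizer of
the whole minimizes `lastSum`. -/
theorem IsCBC.lastSum_le {d : ℕ} {α : ℝ} {γ : ℕ → ℝ} {N : ℕ} {g : Fin d → ℕ}
    (hg : IsCBC α γ N g) (hα : 1 / 2 < α) (hγ : ∀ j, 0 < γ j) (hN : N.Prime)
    (n : ℕ) (hn : n < d) {x : ℕ} (hx : x ∈ Finset.Icc 1 (N - 1)) :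
    lastSum α γ 2 N (fun i : Fin n => g (Fin.castLE hn.le i)) (g ⟨n, hn⟩) ≤
      lastSum α γ 2 N (fun i : Fin n => g (Fin.castLE hn.le i)) x := by
  have hα0 : 0 < α := by linarith
  rcases Nat.eq_zero_or_pos n with h0 | h0
  · subst h0
    -- The first component is prescribed rather than minimized, but every unit modulo N defines the
    -- same one-dimensional dual lattice.
    have key : ∀ y ∈ Finset.Icc 1 (N - 1), ∀ m : ℤ, (N : ℤ) ∣ m * y ↔ (N : ℤ) ∣ m := by
      intro y hy m
      rw [Finset.mem_Icc] at hy
      refine ⟨fun h => ((Nat.prime_iff_prime_int.1 hN).dvd_or_dvd h).resolve_right fun h' => ?_,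
        fun h => h.mul_right _⟩
      have := Nat.le_of_dvd (by omega) (Int.natCast_dvd_natCast.1 h')
      omega
    refine le_of_eq (tsum_congr fun m => tsum_congr fun k => if_congr ?_ rfl rfl)
    rw [Finset.univ_eq_empty, Finset.sum_empty, zero_add, zero_add, key _ (hg.mem _) m,
      key _ hx m]
  · have h1 := ENNReal.ofReal_le_ofReal (hg.minimal ⟨n, hn⟩ (by simpa using h0.ne') x hx)
    rw [ofReal_integrationError _ _ hα hγ, ofReal_integrationError _ _ hα hγ,
      initialPart_eq_snoc, initialPart_update, dualSum_snoc _ _ _ hα0,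
      dualSum_snoc _ _ _ hα0] at h1
    -- Cancellation in `ℝ≥0∞` needs the common part to be finite.
    refine (ENNReal.add_le_add_iff_left ?_).1 h1
    exact ((dualSum_le N _ hα0 hγ zero_le_two (by linarith)).trans_lt ENNReal.ofReal_lt_top).ne

/-- Induction on the dimension. By Jensen the (p/2)-th power of the new part is at most the sum with
exponent p, whose minimum over x is at most its mean. The increments add up because `zetaProd` grows
by exactly the factor 1 + c. -/
theorem IsCBC.dualSum_rpow_le {d : ℕ} {α : ℝ} {γ : ℕ → ℝ} {N : ℕ} {g : Fin d → ℕ}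
    (hg : IsCBC α γ N g) (hα : 1 / 2 < α) (hγ : ∀ j, 0 < γ j) (hN : N.Prime)
    {p : ℝ} (hp : 1 / α < p) (hp2 : p ≤ 2) : ∀ (n : ℕ) (hn : n ≤ d),
    dualSum α γ 2 N (fun i : Fin n => g (Fin.castLE hn i)) ^ (p / 2) ≤
      ENNReal.ofReal (4 / N) * ENNReal.ofReal (zetaProd n α γ p) := by
  have hα0 : 0 < α := by linarith
  have hp0 : 0 < p := (by positivity : 0 < 1 / α).trans hp
  have hαp := one_lt_mul_of_one_div_lt hα0 hp
  intro n
  induction n with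
  | zero =>
    intro hn
    have : dualSum α γ 2 N (fun i : Fin 0 => g (Fin.castLE hn i)) = 0 := by
      rw [dualSum, ENNReal.tsum_eq_zero]
      intro k
      exact if_neg fun h => h.1 (Subsingleton.elim _ _)
    rw [this, ENNReal.zero_rpow_of_pos (by positivity)]
    exact zero_le
  | succ n ih =>
    intro hn
    have h1 : (fun i : Fin (n + 1) => g (Fin.castLE hn i)) = initialPart g ⟨n, hn⟩ := rfl
    rw [h1, initialPart_eq_snoc, dualSum_snoc _ _ _ hα0]
    set v : Fin n → ℕ := fun i => g (Fin.castLE (Nat.le_of_succ_le hn) i) with hv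
    set θ := lastSum α γ 2 N v (g ⟨n, hn⟩) with hθ
    set c := 2 * γ n ^ p * realZeta (α * p) with hc
    have hc0 : 0 ≤ c := by
      have h1 := realZeta_nonneg hαp
      have h2 := Real.rpow_nonneg (hγ n).le p
      positivity
    have hz := one_le_zetaProd (s := n) hγ hαp
    have h2 : ((N - 1 : ℕ) : ℝ≥0∞) * θ ^ (p / 2) ≤
        2 * (ENNReal.ofReal (zetaProd n α γ p) * ENNReal.ofReal c) := by
      refine le_trans ?_ (sum_lastSum_le hN v hα0 hγ hp0.le hαp)
      have h3 : ((N - 1 : ℕ) : ℝ≥0∞) * θ ^ (p / 2) =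
          ∑ _x ∈ Finset.Icc 1 (N - 1), θ ^ (p / 2) := by
        rw [Finset.sum_const, Nat.card_Icc, Nat.add_sub_cancel, nsmul_eq_mul]
      rw [h3]
      refine Finset.sum_le_sum fun x hx => ?_
      have h4 := lastSum_rpow_le α γ 2 N v x (q := p / 2) (by positivity) (by linarith)
      rw [mul_div_cancel₀ p (two_ne_zero' ℝ)] at h4
      exact (ENNReal.rpow_le_rpow (hg.lastSum_le hα hγ hN n hn hx) (by positivity)).trans h4
    have h5 : θ ^ (p / 2) ≤ ENNReal.ofReal (4 / N) *
        (ENNReal.ofReal (zetaProd n α γ p) * ENNReal.ofReal c) := by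
      have hN2 : (2 : ℝ) ≤ N := by exact_mod_cast hN.two_le
      -- N - 1 ≥ N/2 turns the mean into 2/N times the sum; with the factor 2 of `sum_lastSum_le`
      -- this gives 4/N.
      have h6 : (1 : ℝ≥0∞) ≤ ENNReal.ofReal (2 / N) * ((N - 1 : ℕ) : ℝ≥0∞) := by
        rw [← ENNReal.ofReal_natCast, ← ENNReal.ofReal_mul (by positivity), ENNReal.one_le_ofReal,
          Nat.cast_sub hN.one_le, div_mul_eq_mul_div, le_div_iff₀ (by linarith)]
        push_cast
        linarith
      calc θ ^ (p / 2) = 1 * θ ^ (p / 2) := (one_mul _).symm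
        _ ≤ ENNReal.ofReal (2 / N) * ((N - 1 : ℕ) : ℝ≥0∞) * θ ^ (p / 2) := mul_le_mul' h6 le_rfl
        _ = ENNReal.ofReal (2 / N) * (((N - 1 : ℕ) : ℝ≥0∞) * θ ^ (p / 2)) := mul_assoc _ _ _
        _ ≤ ENNReal.ofReal (2 / N) *
            (2 * (ENNReal.ofReal (zetaProd n α γ p) * ENNReal.ofReal c)) := mul_le_mul' le_rfl h2
        _ = _ := by
          rw [← mul_assoc]
          congr 1
          rw [show (4 : ℝ) / N = 2 / N * 2 by ring, ENNReal.ofReal_mul (by positivity)]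
          simp
    calc _ ≤ dualSum α γ 2 N v ^ (p / 2) + θ ^ (p / 2) :=
          ENNReal.rpow_add_le_add_rpow _ _ (by positivity) (by linarith)
      _ ≤ _ := add_le_add (ih (Nat.le_of_succ_le hn)) h5
      _ = _ := by
        rw [zetaProd_succ, ← hc, mul_add, mul_one, ENNReal.ofReal_add (by linarith)
          (mul_nonneg (by linarith) hc0),
          ENNReal.ofReal_mul (p := zetaProd n α γ p) (q := c) (by linarith), mul_add]

/-- One term is bounded by the whole sum over the dual lattice. -/
theorem IsCBC.weight_rpow_le {d : ℕ} {α : ℝ} {γ : ℕ → ℝ} {N : ℕ} {g : Fin d → ℕ}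
    (hg : IsCBC α γ N g) (hα : 1 / 2 < α) (hγ : ∀ j, 0 < γ j) (hN : N.Prime)
    {p : ℝ} (hp : 1 / α < p) (hp2 : p ≤ 2) {h : Fin d → ℤ} (h0 : h ≠ 0)
    (hd : (N : ℤ) ∣ ∑ j, h j * g j) :
    weight α γ h ^ (-p) ≤ 4 / N * zetaProd d α γ p := by
  classical
  have hα0 : 0 < α := by linarith
  have hp0 : 0 < p := (by positivity : 0 < 1 / α).trans hp
  have hz := one_le_zetaProd (s := d) hγ (one_lt_mul_of_one_div_lt hα0 hp)
  have h1 : weightPow α γ 2 h ≤ dualSum α γ 2 N g := by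
    have := ENNReal.le_tsum (f := fun k : Fin d → ℤ =>
      if k ≠ 0 ∧ (N : ℤ) ∣ ∑ j, k j * g j then weightPow α γ 2 k else 0) h
    rwa [if_pos ⟨h0, hd⟩] at this
  have h2 := (ENNReal.rpow_le_rpow h1 (by positivity : 0 ≤ p / 2)).trans
    (hg.dualSum_rpow_le hα hγ hN hp hp2 d le_rfl)
  rw [weightPow_rpow _ _ _ _ (by positivity), mul_div_cancel₀ p (two_ne_zero' ℝ),
    ← ENNReal.ofReal_mul (by positivity), weightPow] at h2
  exact (ENNReal.ofReal_le_ofReal_iff (mul_nonneg (by positivity) (by linarith))).1 h2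

/-- M was designed for this comparison: N/2 over the zeta product is at most 2 r(h)^p. The p-th root
costs 2^(1/p) ≤ 2^α, uniformly in p. -/
theorem truncationTerm_le_weight {d : ℕ} {α : ℝ} {γ : ℕ → ℝ} {N : ℕ} (hα : 0 < α)
    (hγ : ∀ j, 0 < γ j) (hN : 0 < N) {p : ℝ} (hp : 1 / α < p) {h : Fin d → ℤ}
    (hw : weight α γ h ^ (-p) ≤ 4 / N * zetaProd d α γ p) :
    truncationTerm d α γ N p ≤ 2 ^ α * weight α γ h := by
  have hp0 : 0 < p := (by positivity : 0 < 1 / α).trans hp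
  have hz := one_le_zetaProd (s := d) hγ (one_lt_mul_of_one_div_lt hα hp)
  have hz0 : 0 < zetaProd d α γ p := by linarith
  have hN0 : (0 : ℝ) < N := by exact_mod_cast hN
  have hw0 := weight_pos α γ h
  rw [Real.rpow_neg hw0.le, inv_le_iff_one_le_mul₀ (by positivity)] at hw
  have h1 : (N : ℝ) / 2 * (zetaProd d α γ p)⁻¹ ≤ 2 * weight α γ h ^ p := by
    rw [← div_eq_mul_inv, div_le_iff₀ hz0]
    rw [div_mul_eq_mul_div, div_mul_eq_mul_div, le_div_iff₀ hN0] at hw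
    linarith
  calc truncationTerm d α γ N p ≤ (2 * weight α γ h ^ p) ^ (1 / p) :=
        Real.rpow_le_rpow (by positivity) h1 (by positivity)
    _ = 2 ^ (1 / p) * weight α γ h := by
        rw [Real.mul_rpow (by norm_num) (by positivity), ← Real.rpow_mul hw0.le,
          mul_one_div_cancel hp0.ne', Real.rpow_one]
    _ ≤ _ := by
        refine mul_le_mul_of_nonneg_right ?_ hw0.le
        refine Real.rpow_le_rpow_of_exponent_le (by norm_num) ?_
        rw [one_div_le hp0 hα]
        exact hp.le

/-- The substitute criterion uses a power of the original weight, so its conclusions translate back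
by rescaling the exponent p. -/
theorem weight_substitute {d : ℕ} {α β : ℝ} {γ : ℕ → ℝ} (hα : 0 < α) (hβ : 0 < β)
    (hγ : ∀ j, 0 < γ j) (k : Fin d → ℤ) :
    weight β (fun j => γ j ^ (β / α)) k = weight α γ k ^ (β / α) := by
  have hq : 0 ≤ β / α := by positivity
  rw [weight, weight, ← Real.finsetProd_rpow _ _ fun j _ => zero_le_one.trans (le_max_left _ _)]
  refine Finset.prod_congr rfl fun j _ => ?_
  have h1 : |(k j : ℝ)| ^ β / γ j ^ (β / α) = (|(k j : ℝ)| ^ α / γ j) ^ (β / α) := by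
    rw [Real.div_rpow (by positivity) (hγ j).le, ← Real.rpow_mul (abs_nonneg _),
      mul_div_cancel₀ β hα.ne']
  have h2 : 0 ≤ |(k j : ℝ)| ^ α / γ j := div_nonneg (by positivity) (hγ j).le
  show max 1 (|(k j : ℝ)| ^ β / γ j ^ (β / α)) = _
  rw [h1]
  rcases le_total 1 (|(k j : ℝ)| ^ α / γ j) with h | h
  · rw [max_eq_right h, max_eq_right (Real.one_le_rpow h hq)]
  · rw [max_eq_left h, max_eq_left (Real.rpow_le_one h2 h hq), Real.one_rpow]

/-- Non-zero elements of the dual lattice have large weight. -/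
theorem exists_truncation_le_weight (d : ℕ) {α : ℝ} {γ : ℕ → ℝ} (hα : 1 / 2 < α)
    (hγ : ∀ j, 0 < γ j) :
    ∃ C : ℝ, 0 < C ∧ ∀ (N : ℕ) (g : Fin d → ℕ), N.Prime → IsGeneratingVector α γ N g →
      ∀ h : Fin d → ℤ, h ≠ 0 → (N : ℤ) ∣ ∑ j, h j * g j →
        truncation d α γ N ≤ C * weight α γ h := by
  have hα0 : 0 < α := by linarith
  set β : ℝ := (⌊α⌋₊ : ℝ) with hβ
  -- Exponents p' ≤ 2 for the smoothness β correspond to p = p' β/α, so the substitute construction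
  -- controls only p ≤ l.
  set l := 2 * (β / α) with hl
  set K := max 1 (zetaProd d α γ l ^ (1 / l)) with hK
  have hK1 : 1 ≤ K := le_max_left _ _
  refine ⟨2 ^ α * K, by positivity, fun N g hN hg h h0 hd => ?_⟩
  have hw0 := weight_pos α γ h
  have hN2 : (2 : ℝ) ≤ N := by exact_mod_cast hN.two_le
  have hle : 2 ^ α * weight α γ h ≤ 2 ^ α * K * weight α γ h := by
    have : 0 ≤ 2 ^ α * weight α γ h := by positivity
    nlinarith
  rcases hg with hg | ⟨hα1, hg⟩
  · exact truncation_le hα fun p hp hp2 =>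
      (truncationTerm_le_weight hα0 hγ hN.pos hp (hg.weight_rpow_le hα hγ hN hp hp2 h0 hd)).trans hle
  · have hβ1 : 1 ≤ β := by
      have : 1 ≤ ⌊α⌋₊ := Nat.one_le_floor_iff α |>.2 hα1
      rw [hβ]
      exact_mod_cast this
    have hβ0 : 0 < β := by linarith
    have hq : 0 < β / α := by positivity
    have hγ' : ∀ j, 0 < γ j ^ (β / α) := fun j => Real.rpow_pos_of_pos (hγ j) _
    have hl1 : 1 / α < l := by
      rw [hl, div_lt_iff₀ hα0, mul_assoc, div_mul_cancel₀ _ hα0.ne']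
      linarith
    have hl0 : 0 < l := by positivity
    have hsmall : ∀ p, 1 / α < p → p ≤ l → truncationTerm d α γ N p ≤ 2 ^ α * weight α γ h := by
      intro p hp hpl
      have hp0 : 0 < p := (by positivity : 0 < 1 / α).trans hp
      set p' := p / (β / α) with hp'
      have hpp : β / α * p' = p := mul_div_cancel₀ p hq.ne'
      have h1 : 1 / β < p' := by
        rw [hp', lt_div_iff₀ hq, one_div_mul_eq_div, div_div, mul_comm α, ← div_div,
          div_self hβ0.ne']
        exact hp
      have h2 : p' ≤ 2 := by rw [hp', div_le_iff₀ hq]; exact hpl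
      have h3 := hg.weight_rpow_le (by linarith) hγ' hN h1 h2 h0 hd
      refine truncationTerm_le_weight hα0 hγ hN.pos hp ?_
      rw [weight_substitute hα0 hβ0 hγ, ← Real.rpow_mul hw0.le, mul_neg, hpp] at h3
      refine h3.trans (le_of_eq ?_)
      congr 1
      refine Finset.prod_congr rfl fun j _ => ?_
      rw [← Real.rpow_mul (hγ _).le, hpp, show β * p' = α * p by rw [← hpp]; field_simp]
    refine truncation_le hα fun p hp hp2 => ?_
    rcases le_or_gt p l with h1 | h1
    · exact (hsmall p hp h1).trans hle
    -- For p in (l, 2] the term is at most (N/2)^(1/l), which is the term at l up to the constant K.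
    · have hz := one_le_zetaProd (s := d) hγ (one_lt_mul_of_one_div_lt hα0 hl1)
      have hz0 : 0 < zetaProd d α γ l := by linarith
      calc truncationTerm d α γ N p ≤ ((N : ℝ) / 2) ^ (1 / p) := truncationTerm_le hα0 hγ hp
        _ ≤ ((N : ℝ) / 2) ^ (1 / l) :=
            Real.rpow_le_rpow_of_exponent_le (by linarith) (one_div_le_one_div_of_le hl0 h1.le)
        _ = truncationTerm d α γ N l * zetaProd d α γ l ^ (1 / l) := by
            rw [truncationTerm, ← Real.mul_rpow (by positivity) hz0.le, inv_mul_cancel_right₀ hz0.ne']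
        _ ≤ (2 ^ α * weight α γ h) * K :=
            mul_le_mul (hsmall l hl1 le_rfl) (le_max_right _ _) (by positivity) (by positivity)
        _ = _ := by ring

/-! ### The maximum fiber length -/

/-- One factor `max {1, |m|^α / c}` of the weight function. -/
def weightFactor (α c : ℝ) (m : ℤ) : ℝ := max 1 (|(m : ℝ)| ^ α / c)

/-- The dyadic level of one factor of the weight function. -/
def weightLevel (α c : ℝ) (m : ℤ) : ℕ := Nat.log 2 ⌊weightFactor α c m⌋₊

theorem one_le_weightFactor (α c : ℝ) (m : ℤ) : 1 ≤ weightFactor α c m := le_max_left _ _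

theorem two_pow_weightLevel_le (α c : ℝ) (m : ℤ) :
    (2 : ℝ) ^ weightLevel α c m ≤ weightFactor α c m := by
  have h1 := one_le_weightFactor α c m
  have h2 : 1 ≤ ⌊weightFactor α c m⌋₊ := (Nat.one_le_floor_iff _).2 h1
  calc (2 : ℝ) ^ weightLevel α c m ≤ (⌊weightFactor α c m⌋₊ : ℝ) := by
        exact_mod_cast Nat.pow_log_le_self 2 (by omega)
    _ ≤ _ := Nat.floor_le (by linarith)

theorem weightFactor_lt (α c : ℝ) (m : ℤ) :
    weightFactor α c m < 2 ^ (weightLevel α c m + 1) := by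
  have h1 : ⌊weightFactor α c m⌋₊ < 2 ^ (weightLevel α c m + 1) :=
    Nat.lt_pow_succ_log_self (by norm_num) _
  have h2 := Nat.lt_floor_add_one (weightFactor α c m)
  have h3 : ((⌊weightFactor α c m⌋₊ : ℝ) + 1) ≤ 2 ^ (weightLevel α c m + 1) := by
    exact_mod_cast h1
  linarith

/-- The levels of `k`, the one of the index `i` being raised such that the levels sum up to `L`. -/
def raisedLevel {d : ℕ} (α : ℝ) (γ : ℕ → ℝ) (L : ℕ) (i : Fin d) (k : Fin d → ℤ) (j : Fin d) : ℕ :=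
  if j = i then L - ∑ l ∈ Finset.univ.erase i, weightLevel α (γ l) (k l)
  else weightLevel α (γ j) (k j)

theorem sum_weightLevel_le {d : ℕ} {α : ℝ} {γ : ℕ → ℝ} {M : ℝ} {k : Fin d → ℤ}
    (hk : weight α γ k < M) :
    ∑ j : Fin d, weightLevel α (γ j) (k j) ≤ Nat.log 2 ⌊M⌋₊ := by
  refine Nat.le_log_of_pow_le (by norm_num) (Nat.le_floor ?_)
  rw [← Finset.prod_pow_eq_pow_sum]
  push_cast
  refine le_trans ?_ hk.le
  exact Finset.prod_le_prod (fun j _ => by positivity) fun j _ => two_pow_weightLevel_le _ _ _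

theorem sum_raisedLevel {d : ℕ} {α : ℝ} {γ : ℕ → ℝ} {M : ℝ} {k : Fin d → ℤ}
    (hk : weight α γ k < M) (i : Fin d) :
    ∑ j, raisedLevel α γ (Nat.log 2 ⌊M⌋₊) i k j = Nat.log 2 ⌊M⌋₊ := by
  have h1 := sum_weightLevel_le hk
  rw [← Finset.add_sum_erase _ _ (Finset.mem_univ i)] at h1 ⊢
  have h2 : ∑ j ∈ Finset.univ.erase i, raisedLevel α γ (Nat.log 2 ⌊M⌋₊) i k j =
      ∑ l ∈ Finset.univ.erase i, weightLevel α (γ l) (k l) :=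
    Finset.sum_congr rfl fun j hj => if_neg (Finset.ne_of_mem_erase hj)
  rw [h2, raisedLevel, if_pos rfl]
  omega

theorem weightLevel_le_raisedLevel {d : ℕ} {α : ℝ} {γ : ℕ → ℝ} {M : ℝ} {k : Fin d → ℤ}
    (hk : weight α γ k < M) (i j : Fin d) :
    weightLevel α (γ j) (k j) ≤ raisedLevel α γ (Nat.log 2 ⌊M⌋₊) i k j := by
  have h1 := sum_weightLevel_le hk
  rw [← Finset.add_sum_erase _ _ (Finset.mem_univ i)] at h1
  rw [raisedLevel]
  split_ifs with h
  · subst h; omega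
  · exact le_rfl

/-- The number of cells per coordinate. -/
def cellBound (α η : ℝ) : ℕ := ⌈(2 / η) ^ (1 / α)⌉₊

/-- A set of frequencies in a hyperbolic cross, all of whose differences have large weight, is
small. -/
theorem card_le_of_separated {d : ℕ} (i : Fin d) {α : ℝ} {γ : ℕ → ℝ} (hα : 0 < α)
    (hγ : ∀ j, 0 < γ j) {C η M : ℝ} (hC : 0 < C) (hη0 : 0 < η) (hη1 : η ≤ 1)
    (hη : C * η * (1 + ∑ j : Fin d, γ j) < 1) {F : Finset (Fin d → ℤ)}
    (hF : ∀ k ∈ F, weight α γ k < M)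
    (hsep : ∀ k ∈ F, ∀ l ∈ F, k ≠ l → M ≤ C * weight α γ (k - l)) :
    F.card ≤ (Nat.log 2 ⌊M⌋₊ + 1) ^ (d - 1) * (2 * cellBound α η + 1) ^ d := by
  classical
  set L := Nat.log 2 ⌊M⌋₊ with hL
  set B := cellBound α η with hB
  -- Side lengths of cells so small that two frequencies in one cell differ in the j-th coordinate
  -- by at most (γ_j 2^(a_j) η)^(1/α), where a_j is the raised level.
  let σ : (Fin d → ℤ) → Fin d → ℝ := fun k j => (γ j * 2 ^ raisedLevel α γ L i k j * η) ^ (1 / α)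
  have hσ0 : ∀ k j, 0 < σ k j := fun k j =>
    Real.rpow_pos_of_pos (mul_pos (mul_pos (hγ j) (by positivity)) hη0) _
  have hσα : ∀ k j, σ k j ^ α = γ j * 2 ^ raisedLevel α γ L i k j * η := fun k j => by
    rw [← Real.rpow_mul (mul_pos (mul_pos (hγ j) (by positivity)) hη0).le,
      one_div_mul_cancel hα.ne', Real.rpow_one]
  -- Pigeonholes: levels and cell indices. The level at i is not recorded, since the levels must sum
  -- up to L; this saves one logarithm and gives the exponent d - 1.
  let Φ : (Fin d → ℤ) → Fin d → ℕ × ℤ := fun k j =>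
    (if j = i then 0 else weightLevel α (γ j) (k j), ⌊(k j : ℝ) / σ k j⌋)
  let T : Finset (Fin d → ℕ × ℤ) := Fintype.piFinset fun j =>
    (if j = i then {0} else Finset.range (L + 1)) ×ˢ Finset.Icc (-(B : ℤ)) B
  have hT : T.card = (L + 1) ^ (d - 1) * (2 * B + 1) ^ d := by
    rw [Fintype.card_piFinset]
    simp_rw [Finset.card_product]
    rw [Finset.prod_mul_distrib]
    congr 1
    · rw [← Finset.mul_prod_erase _ _ (Finset.mem_univ i), if_pos rfl, Finset.card_singleton,
        one_mul, Finset.prod_congr rfl fun j hj => by rw [if_neg (Finset.ne_of_mem_erase hj)],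
        Finset.prod_const, Finset.card_range, Finset.card_erase_of_mem (Finset.mem_univ i),
        Finset.card_univ, Fintype.card_fin]
    · rw [Finset.prod_const, Int.card_Icc, Finset.card_univ, Fintype.card_fin]
      congr 1
      omega
  rw [← hT]
  refine Finset.card_le_card_of_injOn Φ (fun k hk => ?_) fun k hk l hl hkl => ?_
  · rw [Finset.mem_coe, Fintype.mem_piFinset]
    intro j
    rw [Finset.mem_product]
    constructor
    · by_cases hj : j = i
      · simp [Φ, hj]
      · simp only [Φ, hj, if_false, Finset.mem_range]
        have h1 := sum_weightLevel_le (hF k hk)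
        have h2 := Finset.single_le_sum (f := fun j : Fin d => weightLevel α (γ j) (k j))
          (fun _ _ => Nat.zero_le _) (Finset.mem_univ j)
        omega
    -- A coordinate of level at most a_j satisfies |k_j|^α < γ_j 2^(a_j+1), hence |k_j| ≤
    -- (2/η)^(1/α) σ_j. This is the origin of `cellBound`.
    · have h1 : |(k j : ℝ)| ^ α / γ j < 2 ^ (raisedLevel α γ L i k j + 1) := by
        refine ((le_max_right _ _).trans_lt (weightFactor_lt α (γ j) (k j))).trans_le ?_
        exact pow_le_pow_right₀ (by norm_num)
          (Nat.succ_le_succ (weightLevel_le_raisedLevel (hF k hk) i j))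
      rw [div_lt_iff₀ (hγ j)] at h1
      have h2 : |(k j : ℝ)| ≤ (2 / η) ^ (1 / α) * σ k j := by
        rw [← Real.mul_rpow (by positivity)
          (mul_pos (mul_pos (hγ j) (by positivity)) hη0).le]
        calc |(k j : ℝ)| = (|(k j : ℝ)| ^ α) ^ (1 / α) := by
              rw [← Real.rpow_mul (abs_nonneg _), mul_one_div_cancel hα.ne', Real.rpow_one]
          _ ≤ _ := by
              refine Real.rpow_le_rpow (by positivity) (h1.le.trans (le_of_eq ?_)) (by positivity)
              field_simp
              ring
      have h3 : |(k j : ℝ) / σ k j| ≤ B := by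
        rw [abs_div, abs_of_pos (hσ0 k j), div_le_iff₀ (hσ0 k j)]
        exact h2.trans (mul_le_mul_of_nonneg_right (Nat.le_ceil _) (hσ0 k j).le)
      rw [abs_le] at h3
      rw [Finset.mem_Icc]
      refine ⟨Int.le_floor.2 (by push_cast; exact h3.1), ?_⟩
      have h4 := (Int.floor_le ((k j : ℝ) / σ k j)).trans h3.2
      exact_mod_cast h4
  · by_contra hne
    have hlev : ∀ j, j ≠ i → weightLevel α (γ j) (k j) = weightLevel α (γ j) (l j) := by
      intro j hj
      have := congrArg Prod.fst (congrFun hkl j)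
      simpa [Φ, hj] using this
    have hrais : raisedLevel α γ L i k = raisedLevel α γ L i l := by
      funext j
      rw [raisedLevel, raisedLevel]
      split_ifs with h
      · rw [Finset.sum_congr rfl fun j hj => hlev j (Finset.ne_of_mem_erase hj)]
      · exact hlev j h
    have hσ : σ k = σ l := by
      funext j
      simp only [σ, hrais]
    have hdist : ∀ j, |((k j - l j : ℤ) : ℝ)| ≤ σ k j := by
      intro j
      have h1 := congrArg Prod.snd (congrFun hkl j)
      simp only [Φ, ← hσ] at h1
      have h2 := (Int.abs_sub_lt_one_of_floor_eq_floor h1).le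
      rw [← sub_div, abs_div, abs_of_pos (hσ0 k j), div_le_one (hσ0 k j)] at h2
      exact_mod_cast h2
    have hpow : ∀ j, |((k j - l j : ℤ) : ℝ)| ^ α ≤ γ j * 2 ^ raisedLevel α γ L i k j * η :=
      fun j => (Real.rpow_le_rpow (abs_nonneg _) (hdist j) hα.le).trans (hσα k j).le
    obtain ⟨j₀, hj₀⟩ := Function.ne_iff.1 hne
    set Γ := 1 + ∑ j : Fin d, γ j with hΓ
    have hγΓ : γ j₀ ≤ Γ := by
      have := Finset.single_le_sum (f := fun j : Fin d => γ j) (fun j _ => (hγ j).le)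
        (Finset.mem_univ j₀)
      linarith
    have hΓ1 : 1 ≤ Γ := by
      have : 0 ≤ ∑ j : Fin d, γ j := Finset.sum_nonneg fun j _ => (hγ j).le
      linarith
    -- In a coordinate where k and l differ, the integer difference is at least 1 in modulus, so
    -- even the constant 1 in the maximum is at most γ_j 2^(a_j) η. That coordinate provides the
    -- small factor ηΓ; the others give at most 2^(a_j).
    have hfac : ∀ j : Fin d, weightFactor α (γ j) (k j - l j) ≤
        2 ^ raisedLevel α γ L i k j * (if j = j₀ then η * Γ else 1) := by
      intro j
      have h2p : (1 : ℝ) ≤ 2 ^ raisedLevel α γ L i k j := one_le_pow₀ (by norm_num)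
      have h1 : |((k j - l j : ℤ) : ℝ)| ^ α / γ j ≤ 2 ^ raisedLevel α γ L i k j * η := by
        rw [div_le_iff₀ (hγ j)]
        exact (hpow j).trans (le_of_eq (by ring))
      split_ifs with h
      · subst h
        refine max_le ?_ (h1.trans ?_)
        · have h2 : (1 : ℝ) ≤ |((k j - l j : ℤ) : ℝ)| := by
            have : 1 ≤ |k j - l j| := Int.one_le_abs (sub_ne_zero.2 hj₀)
            exact_mod_cast this
          have h3 := (Real.one_le_rpow h2 hα.le).trans (hpow j)
          refine h3.trans ?_
          rw [mul_comm (γ j), mul_assoc, mul_comm (γ j)]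
          gcongr
        · gcongr
          exact le_mul_of_one_le_right hη0.le hΓ1
      · rw [mul_one]
        exact max_le h2p (h1.trans (mul_le_of_le_one_right (by positivity) hη1))
    have hw : weight α γ (k - l) ≤ 2 ^ L * (η * Γ) := by
      calc weight α γ (k - l) = ∏ j : Fin d, weightFactor α (γ j) (k j - l j) := rfl
        _ ≤ ∏ j : Fin d, (2 ^ raisedLevel α γ L i k j * (if j = j₀ then η * Γ else 1)) :=
            Finset.prod_le_prod (fun j _ => zero_le_one.trans (one_le_weightFactor _ _ _))
              fun j _ => hfac j
        _ = 2 ^ L * (η * Γ) := by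
            rw [Finset.prod_mul_distrib, Finset.prod_ite_eq' Finset.univ j₀,
              Finset.prod_pow_eq_pow_sum, sum_raisedLevel (hF k hk) i]
            simp [hL]
    have hM1 : 1 ≤ M := (one_le_weight α γ k).trans (hF k hk).le
    have h2L : (2 : ℝ) ^ L ≤ M := by
      have h1 : 1 ≤ ⌊M⌋₊ := (Nat.one_le_floor_iff _).2 hM1
      calc (2 : ℝ) ^ L ≤ (⌊M⌋₊ : ℝ) := by exact_mod_cast Nat.pow_log_le_self 2 (by omega)
        _ ≤ _ := Nat.floor_le (by linarith)
    -- Two frequencies in one pigeonhole would give M ≤ CηΓ M < M.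
    have h1 := hsep k hk l hl hne
    have h3 : M ≤ C * (M * (η * Γ)) := h1.trans (mul_le_mul_of_nonneg_left
      (hw.trans (mul_le_mul_of_nonneg_right h2L (by positivity))) hC.le)
    have h4 : C * (M * (η * Γ)) = C * η * Γ * M := by ring
    rw [h4] at h3
    nlinarith

theorem mem_fiber {d : ℕ} {A : Finset (Fin d → ℤ)} {N : ℕ} {g : Fin d → ℕ} {k l : Fin d → ℤ} :
    k ∈ fiber A N g l ↔ k ∈ A ∧ (N : ℤ) ∣ ∑ j, (k j - l j) * g j := Finset.mem_filter

theorem dvd_of_mem_fiber {d : ℕ} {A : Finset (Fin d → ℤ)} {N : ℕ} {g : Fin d → ℕ}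
    {k k' l : Fin d → ℤ} (hk : k ∈ fiber A N g l) (hk' : k' ∈ fiber A N g l) :
    (N : ℤ) ∣ ∑ j, (k - k') j * g j := by
  have h := dvd_sub (mem_fiber.1 hk).2 (mem_fiber.1 hk').2
  rw [← Finset.sum_sub_distrib] at h
  refine (congrArg _ (Finset.sum_congr rfl fun j _ => ?_)).mpr h
  rw [Pi.sub_apply]
  ring

/-- The maximum fiber length is at most of order `(log N)^(d-1)`. -/
theorem exists_maxFiber_le {d : ℕ} (hd : 1 ≤ d) {α : ℝ} {γ : ℕ → ℝ} (hα : 1 / 2 < α)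
    (hγ : ∀ j, 0 < γ j) :
    ∃ K : ℝ, 0 < K ∧ ∀ (N : ℕ) (g : Fin d → ℕ), N.Prime → IsGeneratingVector α γ N g →
      (maxFiber (hyperbolicCross d α γ (truncation d α γ N)) N g : ℝ) ≤
        K * Real.log N ^ (d - 1) := by
  have hα0 : 0 < α := by linarith
  obtain ⟨C, hC, hw⟩ := exists_truncation_le_weight d hα hγ
  set Γ := 1 + ∑ j : Fin d, γ j with hΓ
  have hΓ1 : 1 ≤ Γ := by
    have : 0 ≤ ∑ j : Fin d, γ j := Finset.sum_nonneg fun j _ => (hγ j).le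
    linarith
  -- Any η in (0, 1] with CηΓ < 1 serves.
  set η := 1 / (C * Γ + 1) with hη
  have hη0 : 0 < η := by positivity
  have hη1 : η ≤ 1 := by
    rw [hη, div_le_one (by positivity)]
    have : 0 < C * Γ := by positivity
    linarith
  have hη2 : C * η * Γ < 1 := by
    rw [hη, mul_one_div, div_mul_eq_mul_div, div_lt_one (by positivity)]
    linarith
  have hl2 : 0 < Real.log 2 := Real.log_pos (by norm_num)
  refine ⟨((α + 1) / Real.log 2) ^ (d - 1) * (2 * cellBound α η + 1) ^ d, by positivity,
    fun N g hN hg => ?_⟩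
  set M := truncation d α γ N with hM
  set A := hyperbolicCross d α γ M with hA
  have h1 : maxFiber A N g ≤
      (Nat.log 2 ⌊M⌋₊ + 1) ^ (d - 1) * (2 * cellBound α η + 1) ^ d := by
    refine Finset.sup_le fun l hl => ?_
    refine card_le_of_separated ⟨0, hd⟩ hα0 hγ hC hη0 hη1 hη2
      (fun k hk => (mem_hyperbolicCross hα0 hγ).1 (mem_fiber.1 hk).1) fun k hk k' hk' hne => ?_
    exact hw N g hN hg _ (sub_ne_zero.2 hne) (dvd_of_mem_fiber hk hk')
  have h2 : (maxFiber A N g : ℝ) ≤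
      ((Nat.log 2 ⌊M⌋₊ : ℝ) + 1) ^ (d - 1) * (2 * cellBound α η + 1) ^ d := by
    exact_mod_cast h1
  have hN2 : (2 : ℝ) ≤ N := by exact_mod_cast hN.two_le
  have hlN : Real.log 2 ≤ Real.log N := Real.log_le_log (by norm_num) hN2
  -- M ≤ N^α bounds the binary logarithm, and 1 ≤ log N / log 2 absorbs the summand 1.
  have h3 : (Nat.log 2 ⌊M⌋₊ : ℝ) + 1 ≤ (α + 1) / Real.log 2 * Real.log N := by
    have h4 : (Nat.log 2 ⌊M⌋₊ : ℝ) * Real.log 2 ≤ α * Real.log N := by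
      rcases Nat.eq_zero_or_pos ⌊M⌋₊ with h0 | h0
      · rw [h0, Nat.log_zero_right, Nat.cast_zero, zero_mul]
        have : 0 ≤ Real.log N := by linarith
        positivity
      · have hM0 : 0 < M := truncation_pos hα hγ hN.two_le
        have h5 : (2 : ℝ) ^ Nat.log 2 ⌊M⌋₊ ≤ (N : ℝ) ^ α := by
          calc (2 : ℝ) ^ Nat.log 2 ⌊M⌋₊ ≤ (⌊M⌋₊ : ℝ) := by
                exact_mod_cast Nat.pow_log_le_self 2 (by omega)
            _ ≤ M := Nat.floor_le hM0.le
            _ ≤ ((N : ℝ) / 2) ^ α := truncation_le_rpow hα hγ hN.two_le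
            _ ≤ _ := Real.rpow_le_rpow (by positivity) (by linarith) hα0.le
        have h6 := Real.log_le_log (by positivity) h5
        rwa [Real.log_pow, Real.log_rpow (by linarith)] at h6
    rw [div_mul_eq_mul_div, le_div_iff₀ hl2, add_mul, add_mul]
    linarith
  refine h2.trans ?_
  rw [mul_right_comm, ← mul_pow]
  gcongr

/-! ### The size of the projections and the number of shifts -/

/-- Every quantity involved is polynomial in N: |h_j| = O(N), |A| = O(N^d), and |z_j| ≤ |H| ≤ |A|².
Hence V = O(N^(2d+1)). -/
theorem exists_log_projection_le {d : ℕ} {α : ℝ} {γ : ℕ → ℝ} (hα : 1 / 2 < α)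
    (hγ : ∀ j, 0 < γ j) :
    ∃ K : ℝ, 0 < K ∧ ∀ (N : ℕ) (g : Fin d → ℕ), N.Prime →
      ∀ A H, A = hyperbolicCross d α γ (truncation d α γ N) → H = fiberDiffs A N g →
      Real.log (H.sup fun h => (dot h (projectionVector H)).natAbs : ℕ) ≤ K * Real.log N := by
  have hα0 : 0 < α := by linarith
  set G : ℝ := ∑ j : Fin d, γ j ^ (1 / α) with hG
  have hγ1 : ∀ j : Fin d, 0 ≤ γ j ^ (1 / α) := fun j => Real.rpow_nonneg (hγ j).le _
  have hG0 : 0 ≤ G := Finset.sum_nonneg fun j _ => hγ1 j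
  set W : ℝ := (d : ℝ) * (2 * G) * ((2 * G + 3) ^ d * (2 * G + 3) ^ d) + 1 with hW
  have hW1 : 1 ≤ W := by
    have : 0 ≤ (d : ℝ) * (2 * G) * ((2 * G + 3) ^ d * (2 * G + 3) ^ d) := by positivity
    linarith
  have hl2 : 0 < Real.log 2 := Real.log_pos (by norm_num)
  have hlW := Real.log_nonneg hW1
  refine ⟨Real.log W / Real.log 2 + (2 * d + 1), by positivity, fun N g hN A H hA hH => ?_⟩
  set M := truncation d α γ N with hM
  have hN2 : (2 : ℝ) ≤ N := by exact_mod_cast hN.two_le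
  have hN0 : (0 : ℝ) < N := by linarith
  have hlN : Real.log 2 ≤ Real.log N := Real.log_le_log (by norm_num) hN2
  have hM0 : 0 < M := truncation_pos hα hγ hN.two_le
  have hMN : M ^ (1 / α) ≤ N := by
    calc M ^ (1 / α) ≤ (((N : ℝ) / 2) ^ α) ^ (1 / α) :=
          Real.rpow_le_rpow hM0.le (truncation_le_rpow hα hγ hN.two_le) (by positivity)
      _ = (N : ℝ) / 2 := by
          rw [← Real.rpow_mul (by positivity), mul_one_div_cancel hα0.ne', Real.rpow_one]
      _ ≤ N := by linarith
  have hside : ∀ j : Fin d, (γ j * M) ^ (1 / α) ≤ G * N := by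
    intro j
    rw [Real.mul_rpow (hγ j).le hM0.le]
    refine mul_le_mul ?_ hMN (by positivity) hG0
    exact Finset.single_le_sum (f := fun j : Fin d => γ j ^ (1 / α)) (fun j _ => hγ1 j)
      (Finset.mem_univ j)
  have hAcard : (A.card : ℝ) ≤ ((2 * G + 3) * N) ^ d := by
    have h1 : A.card ≤ ∏ j : Fin d, (Finset.Icc (-⌈(γ j * M) ^ (1 / α)⌉)
        ⌈(γ j * M) ^ (1 / α)⌉).card := by
      rw [hA, hyperbolicCross, ← Fintype.card_piFinset]
      exact Finset.card_filter_le _ _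
    calc (A.card : ℝ) ≤ ∏ j : Fin d, ((Finset.Icc (-⌈(γ j * M) ^ (1 / α)⌉)
          ⌈(γ j * M) ^ (1 / α)⌉).card : ℝ) := by exact_mod_cast h1
      _ ≤ ∏ _j : Fin d, ((2 * G + 3) * N) := by
          refine Finset.prod_le_prod (fun _ _ => by positivity) fun j _ => ?_
          have h2 : 0 ≤ (γ j * M) ^ (1 / α) :=
            Real.rpow_nonneg (mul_pos (hγ j) hM0).le _
          have h3 : 0 ≤ ⌈(γ j * M) ^ (1 / α)⌉ := Int.ceil_nonneg h2
          have h4 := Int.ceil_lt_add_one ((γ j * M) ^ (1 / α))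
          have h5 : ((Finset.Icc (-⌈(γ j * M) ^ (1 / α)⌉)
              ⌈(γ j * M) ^ (1 / α)⌉).card : ℤ) = 2 * ⌈(γ j * M) ^ (1 / α)⌉ + 1 := by
            rw [Int.card_Icc]
            omega
          have h6 : ((Finset.Icc (-⌈(γ j * M) ^ (1 / α)⌉)
              ⌈(γ j * M) ^ (1 / α)⌉).card : ℝ) = 2 * (⌈(γ j * M) ^ (1 / α)⌉ : ℝ) + 1 := by
            exact_mod_cast h5
          rw [h6]
          nlinarith [hside j]
      _ = _ := by simp
  have hHcard : H.card ≤ A.card * A.card := by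
    rw [hH, fiberDiffs]
    refine (Finset.card_erase_le).trans (Finset.card_biUnion_le_card_mul _ _ _ fun l _ => ?_)
    exact Finset.card_image_le.trans (Finset.card_filter_le _ _)
  have hHcard' : (H.card : ℝ) ≤ ((2 * G + 3) * N) ^ d * ((2 * G + 3) * N) ^ d :=
    (by exact_mod_cast hHcard : (H.card : ℝ) ≤ A.card * A.card).trans
      (mul_le_mul hAcard hAcard (by positivity) (by positivity))
  have hV : ∀ h ∈ H, ((dot h (projectionVector H)).natAbs : ℝ) ≤ W * N ^ (2 * d + 1) := by
    intro h hh
    have hcomp : ∀ j : Fin d, |(h j : ℝ)| ≤ 2 * G * N := by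
      intro j
      rw [hH, fiberDiffs, Finset.mem_erase, Finset.mem_biUnion] at hh
      obtain ⟨-, l, hl, hk⟩ := hh
      obtain ⟨k, hk', rfl⟩ := Finset.mem_image.1 hk
      have hkA := (mem_fiber.1 hk').1
      rw [hA, mem_hyperbolicCross hα0 hγ] at hkA hl
      have h1 := (abs_le_of_weight_lt hα0 hγ hkA j).trans (hside j)
      have h2 := (abs_le_of_weight_lt hα0 hγ hl j).trans (hside j)
      rw [Pi.sub_apply, Int.cast_sub]
      have := abs_sub (k j : ℝ) (l j : ℝ)
      linarith
    have hz : ∀ j : Fin d, |(projectionVector H j : ℝ)| ≤ H.card := fun j => by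
      exact_mod_cast abs_projectionVector_le H j
    calc ((dot h (projectionVector H)).natAbs : ℝ)
        = |∑ j, (h j : ℝ) * (projectionVector H j : ℝ)| := by
          rw [Nat.cast_natAbs, dot]
          push_cast
          rfl
      _ ≤ ∑ j, |(h j : ℝ) * (projectionVector H j : ℝ)| := Finset.abs_sum_le_sum_abs _ _
      _ ≤ ∑ _j : Fin d, (2 * G * N) * (((2 * G + 3) * N) ^ d * ((2 * G + 3) * N) ^ d) := by
          refine Finset.sum_le_sum fun j _ => ?_
          rw [abs_mul]
          exact mul_le_mul (hcomp j) ((hz j).trans hHcard') (abs_nonneg _) (by positivity)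
      _ = (W - 1) * N ^ (2 * d + 1) := by
          rw [Finset.sum_const, Finset.card_univ, Fintype.card_fin, nsmul_eq_mul, hW, mul_pow,
            add_sub_cancel_right]
          ring
      _ ≤ W * N ^ (2 * d + 1) := by gcongr; linarith
  have hVsup : ((H.sup fun h => (dot h (projectionVector H)).natAbs : ℕ) : ℝ) ≤
      W * N ^ (2 * d + 1) := by
    have h1 : (H.sup fun h => (dot h (projectionVector H)).natAbs) ≤
        ⌊W * (N : ℝ) ^ (2 * d + 1)⌋₊ := Finset.sup_le fun h hh => Nat.le_floor (hV h hh)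
    exact (Nat.le_floor_iff (by positivity)).1 h1
  have hfin : Real.log (W * (N : ℝ) ^ (2 * d + 1)) ≤
      (Real.log W / Real.log 2 + (2 * d + 1)) * Real.log N := by
    rw [Real.log_mul (by positivity) (by positivity), Real.log_pow, add_mul]
    push_cast
    have h1 : Real.log W ≤ Real.log W / Real.log 2 * Real.log N := by
      rw [div_mul_eq_mul_div, le_div_iff₀ hl2]
      exact mul_le_mul_of_nonneg_left hlN hlW
    linarith
  refine le_trans ?_ hfin
  -- V = 0 occurs if there are no differences; the logarithm is then 0 by convention.
  rcases Nat.eq_zero_or_pos (H.sup fun h => (dot h (projectionVector H)).natAbs) with h0 | h0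
  · rw [h0, Nat.cast_zero, Real.log_zero]
    have : (1 : ℝ) ≤ W * (N : ℝ) ^ (2 * d + 1) :=
      one_le_mul_of_one_le_of_one_le hW1 (one_le_pow₀ (by linarith))
    exact Real.log_nonneg this
  · exact Real.log_le_log (by exact_mod_cast h0) hVsup

/-- The number of shifts is at most of order `(log N)^(2d)`. -/
theorem exists_length_adaptiveShifts_le {d : ℕ} (hd : 1 ≤ d) {α : ℝ} {γ : ℕ → ℝ}
    (hα : 1 / 2 < α) (hγ : ∀ j, 0 < γ j) {t : ℝ} (ht0 : 0 < t) (ht1 : t < 1) :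
    ∃ K : ℝ, 0 < K ∧ ∀ (N : ℕ) (g : Fin d → ℕ), N.Prime → IsGeneratingVector α γ N g →
      ((adaptiveShifts α γ N g t).length : ℝ) ≤ K * Real.log N ^ (2 * d) := by
  obtain ⟨K₁, hK₁, h₁⟩ := exists_maxFiber_le hd hα hγ
  obtain ⟨K₂, hK₂, h₂⟩ := exists_log_projection_le (d := d) hα hγ
  have hl2 : 0 < Real.log 2 := Real.log_pos (by norm_num)
  refine ⟨(40 / t * (K₁ * K₂ + 1 / Real.log 2 ^ d)) ^ 2, by positivity, fun N g hN hg => ?_⟩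
  have h3 := (adaptiveShifts_spec α γ N g ht0 ht1 rfl rfl rfl rfl).2.2
  have h4 := h₁ N g hN hg
  have h5 := h₂ N g hN _ _ rfl rfl
  have hN2 : (2 : ℝ) ≤ N := by exact_mod_cast hN.two_le
  have hlN : Real.log 2 ≤ Real.log N := Real.log_le_log (by norm_num) hN2
  refine h3.trans ?_
  rw [mul_comm 2 d, pow_mul, ← mul_pow]
  refine pow_le_pow_left₀ (by have := Real.log_natCast_nonneg; positivity) ?_ 2
  rw [mul_assoc]
  refine mul_le_mul_of_nonneg_left ?_ (by positivity)
  -- The summand 1 is absorbed into (log N)^d, as N ≥ 2.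
  have h6 : (1 : ℝ) ≤ 1 / Real.log 2 ^ d * Real.log N ^ d := by
    rw [one_div_mul_eq_div, one_le_div (by positivity)]
    exact pow_le_pow_left₀ hl2.le hlN d
  have h7 : Real.log N ^ (d - 1) * Real.log N = Real.log N ^ d := by
    rw [← pow_succ, Nat.sub_add_cancel hd]
  calc _ ≤ K₁ * Real.log N ^ (d - 1) * (K₂ * Real.log N) + 1 :=
        add_le_add (mul_le_mul h4 h5 (Real.log_natCast_nonneg _)
          (mul_nonneg hK₁.le (pow_nonneg (hl2.le.trans hlN) _))) le_rfl
    _ = K₁ * K₂ * Real.log N ^ d + 1 := by rw [← h7]; ring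
    _ ≤ _ := by rw [add_mul]; linarith

/-! ### Orthonormal systems -/

open MeasureTheory in
/-- Bessel's inequality for absolutely convergent series in a bounded orthonormal system. -/
theorem lintegral_tsum_sq_le {Ω ι : Type*} [MeasurableSpace Ω] [Countable ι] [DecidableEq ι] (μ : Measure Ω)
    [IsFiniteMeasure μ] {e : ι → Ω → ℂ} {K : ℝ} (hm : ∀ i, AEStronglyMeasurable (e i) μ)
    (hK : ∀ i x, ‖e i x‖ ≤ K)
    (horth : ∀ i j, ∫ x, star (e i x) * e j x ∂μ = if i = j then 1 else 0)
    {a : ι → ℂ} (ha : Summable fun i => ‖a i‖) :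
    ∫⁻ x, ‖∑' i, a i * e i x‖ₑ ^ 2 ∂μ ≤ ∑' i, ‖a i‖ₑ ^ 2 := by
  rcases isEmpty_or_nonempty ι with hι | ⟨⟨i₀⟩⟩
  · simp
  rcases isEmpty_or_nonempty Ω with hΩ | ⟨⟨x₀⟩⟩
  · simp
  have hK0 : 0 ≤ K := (norm_nonneg _).trans (hK i₀ x₀)
  have hsx : ∀ x, Summable fun i => ‖a i * e i x‖ := fun x =>
    Summable.of_nonneg_of_le (fun _ => norm_nonneg _)
      (fun i => by rw [norm_mul]; exact mul_le_mul_of_nonneg_left (hK i x) (norm_nonneg _))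
      (ha.mul_right K)
  -- The squared modulus of the series as a double series over pairs. Absolute convergence permits
  -- termwise integration, and orthonormality leaves the diagonal.
  let F : ι × ι → Ω → ℂ := fun q x => star (a q.1 * e q.1 x) * (a q.2 * e q.2 x)
  have hFm : ∀ q, AEStronglyMeasurable (F q) μ := fun q =>
    (((hm q.1).const_mul _).star).mul ((hm q.2).const_mul _)
  have hFn : ∀ q x, ‖F q x‖ ≤ ‖a q.1‖ * ‖a q.2‖ * (K * K) := by
    intro q x
    simp only [F]
    rw [norm_mul, norm_star, norm_mul, norm_mul]
    calc _ ≤ ‖a q.1‖ * K * (‖a q.2‖ * K) := by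
          gcongr
          · exact hK _ _
          · exact hK _ _
      _ = _ := by ring
  have hFi : ∀ q, Integrable (F q) μ := fun q =>
    Integrable.of_bound (hFm q) _ (ae_of_all _ (hFn q))
  have hsum : Summable fun q : ι × ι => ‖a q.1‖ * ‖a q.2‖ :=
    ha.mul_of_nonneg ha (fun _ => norm_nonneg _) fun _ => norm_nonneg _
  have hFs : Summable fun q => ∫ x, ‖F q x‖ ∂μ := by
    refine Summable.of_nonneg_of_le (fun q => integral_nonneg fun _ => norm_nonneg _) (fun q => ?_)
      (hsum.mul_right (K * K * μ.real Set.univ))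
    calc ∫ x, ‖F q x‖ ∂μ ≤ ∫ _x, ‖a q.1‖ * ‖a q.2‖ * (K * K) ∂μ :=
          integral_mono (hFi q).norm (integrable_const _) (hFn q)
      _ = _ := by rw [integral_const, smul_eq_mul]; ring
  have hsq : ∀ x, ∑' q, F q x = ((‖∑' i, a i * e i x‖ ^ 2 : ℝ) : ℂ) := by
    intro x
    rw [← tsum_mul_tsum_of_summable_norm (f := fun i => star (a i * e i x))
      (by simpa only [norm_star] using hsx x) (hsx x), ← tsum_star]
    simp only [Complex.star_def]
    rw [Complex.conj_mul']
    norm_cast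
  have hint := hasSum_integral_of_summable_integral_norm hFi hFs
  have hFval : ∀ q : ι × ι, ∫ x, F q x ∂μ = if q.1 = q.2 then ((‖a q.1‖ ^ 2 : ℝ) : ℂ) else 0 := by
    intro q
    have h1 : ∀ x, F q x = (star (a q.1) * a q.2) * (star (e q.1 x) * e q.2 x) := by
      intro x
      simp only [F, star_mul']
      ring
    simp_rw [h1]
    rw [integral_const_mul, horth]
    split_ifs with h
    · rw [← h, mul_one, Complex.star_def, Complex.conj_mul']
      norm_cast
    · rw [mul_zero]
  have hsumsq : Summable fun i => ‖a i‖ ^ 2 := by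
    have := hsum.comp_injective (i := fun i : ι => (i, i)) fun i j h => (Prod.ext_iff.1 h).1
    refine this.congr fun i => ?_
    simp [sq]
  have hval : ∫ x, ‖∑' i, a i * e i x‖ ^ 2 ∂μ = ∑' i, ‖a i‖ ^ 2 := by
    have h1 := hint.tsum_eq
    simp_rw [hsq] at h1
    rw [integral_complex_ofReal] at h1
    have h2 : ∑' q : ι × ι, ∫ x, F q x ∂μ = ((∑' i, ‖a i‖ ^ 2 : ℝ) : ℂ) := by
      rw [Complex.ofReal_tsum, ← Function.Injective.tsum_eq (g := fun i : ι => (i, i))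
        (fun i j h => (Prod.ext_iff.1 h).1)]
      · refine tsum_congr fun i => ?_
        rw [hFval, if_pos rfl]
      · intro q hq
        have : q.1 = q.2 := by
          by_contra h
          exact hq ((hFval q).trans (if_neg h))
        exact ⟨q.1, Prod.ext rfl this⟩
    rw [h2] at h1
    exact_mod_cast h1.symm
  -- Integrability is needed to identify the Bochner integral just computed with the Lebesgue
  -- integral.
  have hI : Integrable (fun x => ‖∑' i, a i * e i x‖ ^ 2) μ := by
    refine Integrable.of_bound (C := (∑' i, ‖a i‖ * K) ^ 2) ?_ (ae_of_all _ fun x => ?_)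
    · refine AEStronglyMeasurable.pow (AEStronglyMeasurable.norm ?_) 2
      refine (AEMeasurable.tsum fun i => ((hm i).const_mul (a i)).aemeasurable) |>.aestronglyMeasurable
    · rw [norm_pow, norm_norm]
      refine pow_le_pow_left₀ (norm_nonneg _) ?_ 2
      refine (norm_tsum_le_tsum_norm (hsx x)).trans ((hsx x).tsum_le_tsum (fun i => ?_)
        (ha.mul_right K))
      rw [norm_mul]
      exact mul_le_mul_of_nonneg_left (hK i x) (norm_nonneg _)
  have h1 : ∀ z : ℂ, ‖z‖ₑ ^ 2 = ENNReal.ofReal (‖z‖ ^ 2) := fun z => by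
    rw [ENNReal.ofReal_pow (norm_nonneg _), ofReal_norm]
  simp_rw [h1]
  rw [← ofReal_integral_eq_lintegral_ofReal hI (ae_of_all _ fun x => by positivity), hval,
    ENNReal.ofReal_tsum_of_nonneg (fun _ => by positivity) hsumsq]

open MeasureTheory in
theorem volume_restrict_unitCube (d : ℕ) :
    (volume : Measure (Fin d → ℝ)).restrict (unitCube d) =
      Measure.pi fun _ : Fin d => (volume : Measure ℝ).restrict (Set.Icc 0 1) := by
  rw [unitCube, ← Set.pi_univ_Icc, volume_pi, Measure.restrict_pi_pi]
  rfl

open MeasureTheory in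
instance isProbabilityMeasure_unitCube (d : ℕ) :
    IsProbabilityMeasure ((volume : Measure (Fin d → ℝ)).restrict (unitCube d)) := by
  rw [volume_restrict_unitCube]
  have : IsProbabilityMeasure ((volume : Measure ℝ).restrict (Set.Icc 0 1)) := ⟨by simp⟩
  infer_instance

open MeasureTheory in
/-- Products of orthonormal functions on `[0,1]` are orthonormal on the cube. -/
theorem integral_unitCube_star_mul_prod {κ : Type*} [DecidableEq κ] {d : ℕ} (u : κ → ℝ → ℂ)
    (hu : ∀ a b, ∫ x in Set.Icc (0 : ℝ) 1, star (u a x) * u b x = if a = b then 1 else 0)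
    (k l : Fin d → κ) :
    ∫ x in unitCube d, star (∏ j, u (k j) (x j)) * ∏ j, u (l j) (x j) =
      if k = l then 1 else 0 := by
  rw [volume_restrict_unitCube]
  have h1 : ∀ x : Fin d → ℝ, star (∏ j, u (k j) (x j)) * ∏ j, u (l j) (x j) =
      ∏ j, (star (u (k j) (x j)) * u (l j) (x j)) := by
    intro x
    rw [Finset.prod_mul_distrib, star_prod]
  simp_rw [h1]
  rw [integral_fintype_prod_eq_prod (fun j y => star (u (k j) y) * u (l j) y)]
  simp_rw [hu]
  split_ifs with h
  · subst h
    simp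
  · obtain ⟨j, hj⟩ := Function.ne_iff.1 h
    exact Finset.prod_eq_zero (Finset.mem_univ j) (if_neg hj)

/-- The univariate character `exp (2 π i m x)`. -/
def expFun (m : ℤ) (x : ℝ) : ℂ := Complex.exp (2 * Real.pi * Complex.I * m * x)

theorem fourierChar_eq_prod {d : ℕ} (k : Fin d → ℤ) (x : Fin d → ℝ) :
    fourierChar k x = ∏ j, expFun (k j) (x j) := by
  simp only [expFun]
  rw [fourierChar, ← Complex.exp_sum]
  congr 1
  push_cast
  rw [Finset.mul_sum]
  exact Finset.sum_congr rfl fun j _ => by ring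

open MeasureTheory in
theorem integral_expFun (a b : ℤ) :
    ∫ x in Set.Icc (0 : ℝ) 1, star (expFun a x) * expFun b x = if a = b then 1 else 0 := by
  have h1 : ∀ x : ℝ, star (expFun a x) * expFun b x =
      Complex.exp (2 * Real.pi * Complex.I * ((b - a : ℤ) : ℂ) * x) := by
    intro x
    rw [expFun, expFun, Complex.star_def, ← Complex.exp_conj, ← Complex.exp_add]
    congr 1
    simp [Complex.conj_ofNat]
    ring
  simp_rw [h1]
  rw [integral_Icc_eq_integral_Ioc, ← intervalIntegral.integral_of_le zero_le_one]
  split_ifs with h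
  · subst h
    simp
  · have h2 : 2 * Real.pi * Complex.I * ((b - a : ℤ) : ℂ) ≠ 0 :=
      mul_ne_zero Complex.two_pi_I_ne_zero (by exact_mod_cast sub_ne_zero.2 (Ne.symm h))
    rw [integral_exp_mul_complex h2]
    have h3 : Complex.exp (2 * Real.pi * Complex.I * ((b - a : ℤ) : ℂ) * (1 : ℝ)) = 1 := by
      rw [Complex.exp_eq_one_iff]
      exact ⟨b - a, by push_cast; ring⟩
    rw [h3]
    simp

open MeasureTheory in
theorem integral_cos_pi_mul (n : ℤ) :
    ∫ x in (0 : ℝ)..1, Real.cos (Real.pi * n * x) = if n = 0 then 1 else 0 := by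
  split_ifs with h
  · subst h
    simp
  · have h1 : Real.pi * n ≠ 0 := mul_ne_zero Real.pi_ne_zero (by exact_mod_cast h)
    rw [intervalIntegral.integral_comp_mul_left _ h1, integral_cos]
    simp only [mul_one, mul_zero, Real.sin_zero, sub_zero]
    rw [mul_comm, Real.sin_int_mul_pi, smul_zero]

/-- The univariate half-period cosine functions. -/
def cosFun (n : ℕ) (x : ℝ) : ℝ := (if n = 0 then 1 else Real.sqrt 2) * Real.cos (Real.pi * n * x)

theorem sqrt_two_pow_numNonzero {d : ℕ} (k : Fin d → ℕ) :
    Real.sqrt 2 ^ numNonzero k = ∏ j, (if k j = 0 then 1 else Real.sqrt 2) := by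
  rw [numNonzero, ← Finset.prod_const, Finset.prod_filter]
  exact Finset.prod_congr rfl fun j _ => by split_ifs <;> simp_all

theorem cosineBasis_eq_prod {d : ℕ} (k : Fin d → ℕ) (x : Fin d → ℝ) :
    cosineBasis k x = ∏ j, cosFun (k j) (x j) := by
  simp only [cosFun]
  rw [cosineBasis, sqrt_two_pow_numNonzero, ← Finset.prod_mul_distrib]

theorem abs_cosineBasis_le {d : ℕ} (k : Fin d → ℕ) (x : Fin d → ℝ) :
    |cosineBasis k x| ≤ Real.sqrt 2 ^ numNonzero k := by
  rw [cosineBasis, abs_mul, abs_of_nonneg (by positivity), Finset.abs_prod]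
  refine mul_le_of_le_one_right (by positivity) ?_
  exact Finset.prod_le_one (fun _ _ => abs_nonneg _) fun _ _ => Real.abs_cos_le_one _

open MeasureTheory in
theorem integral_cosFun (a b : ℕ) :
    ∫ x in Set.Icc (0 : ℝ) 1, star ((cosFun a x : ℝ) : ℂ) * ((cosFun b x : ℝ) : ℂ) =
      if a = b then 1 else 0 := by
  have h1 : ∀ x : ℝ, star ((cosFun a x : ℝ) : ℂ) * ((cosFun b x : ℝ) : ℂ) =
      ((cosFun a x * cosFun b x : ℝ) : ℂ) := by
    intro x
    simp
  simp_rw [h1]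
  rw [integral_complex_ofReal]
  have h2 : ∫ x in Set.Icc (0 : ℝ) 1, cosFun a x * cosFun b x = if a = b then 1 else 0 := by
    rw [integral_Icc_eq_integral_Ioc, ← intervalIntegral.integral_of_le zero_le_one]
    set ca : ℝ := if a = 0 then 1 else Real.sqrt 2 with hca
    set cb : ℝ := if b = 0 then 1 else Real.sqrt 2 with hcb
    have h3 : ∀ x : ℝ, cosFun a x * cosFun b x = ca * cb / 2 *
        (Real.cos (Real.pi * ((a : ℤ) - b : ℤ) * x) + Real.cos (Real.pi * ((a : ℤ) + b : ℤ) * x)) := by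
      intro x
      have h4 := Real.cos_sub (Real.pi * a * x) (Real.pi * b * x)
      have h5 := Real.cos_add (Real.pi * a * x) (Real.pi * b * x)
      have h6 : Real.pi * (((a : ℤ) - b : ℤ) : ℝ) * x = Real.pi * a * x - Real.pi * b * x := by
        push_cast; ring
      have h7 : Real.pi * (((a : ℤ) + b : ℤ) : ℝ) * x = Real.pi * a * x + Real.pi * b * x := by
        push_cast; ring
      rw [h6, h7, h4, h5, cosFun, cosFun]
      ring
    simp_rw [h3]
    rw [intervalIntegral.integral_const_mul, intervalIntegral.integral_add
      ((by fun_prop : Continuous _).intervalIntegrable _ _)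
      ((by fun_prop : Continuous _).intervalIntegrable _ _), integral_cos_pi_mul,
      integral_cos_pi_mul]
    by_cases hab : a = b
    · subst hab
      by_cases ha : a = 0
      · subst ha
        simp [hca, hcb]
        norm_num
      · have : ¬ ((a : ℤ) + a = 0) := by omega
        simp [hca, hcb, ha]
    · have h8 : ¬ ((a : ℤ) - b = 0) := by omega
      have h9 : ¬ ((a : ℤ) + b = 0) := by omega
      rw [if_neg h8, if_neg h9, if_neg hab]
      simp
  rw [h2]
  split_ifs <;> simp

open MeasureTheory in
theorem lintegral_fourierChar_le {d : ℕ} {a : (Fin d → ℤ) → ℂ} (ha : Summable fun k => ‖a k‖) :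
    ∫⁻ x in unitCube d, ‖∑' k, a k * fourierChar k x‖ₑ ^ 2 ≤ ∑' k, ‖a k‖ₑ ^ 2 := by
  refine lintegral_tsum_sq_le _ (K := 1) (fun k => ?_) (fun k x => (norm_fourierChar k x).le)
    (fun k l => ?_) ha
  · refine Continuous.aestronglyMeasurable ?_
    unfold fourierChar
    fun_prop
  · simp_rw [fourierChar_eq_prod]
    exact integral_unitCube_star_mul_prod expFun integral_expFun k l

open MeasureTheory in
theorem lintegral_cosineBasis_le {d : ℕ} {a : (Fin d → ℕ) → ℂ} (ha : Summable fun k => ‖a k‖) :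
    ∫⁻ x in unitCube d, ‖∑' k, a k * (cosineBasis k x : ℂ)‖ₑ ^ 2 ≤ ∑' k, ‖a k‖ₑ ^ 2 := by
  refine lintegral_tsum_sq_le _ (K := Real.sqrt 2 ^ d) (e := fun k x => (cosineBasis k x : ℂ))
    (fun k => ?_) (fun k x => ?_) (fun k l => ?_) ha
  · refine Continuous.aestronglyMeasurable ?_
    unfold cosineBasis
    fun_prop
  · rw [Complex.norm_real, Real.norm_eq_abs]
    refine (abs_cosineBasis_le k x).trans ?_
    refine pow_le_pow_right₀ (Real.one_le_sqrt.2 (by norm_num)) ?_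
    exact (Finset.card_filter_le _ _).trans (by simp)
  · simp_rw [cosineBasis_eq_prod]
    push_cast
    exact integral_unitCube_star_mul_prod (fun n x => ((cosFun n x : ℝ) : ℂ)) integral_cosFun k l

/-! ### Fourier coefficients of the periodized functions -/

/-- The componentwise absolute value. -/
def natAbsVec {d : ℕ} (h : Fin d → ℤ) : Fin d → ℕ := fun j => (h j).natAbs

/-- The vectors with given componentwise absolute values. -/
def signFiber {d : ℕ} (k : Fin d → ℕ) : Finset (Fin d → ℤ) :=
  Fintype.piFinset fun j => {(k j : ℤ), -(k j : ℤ)}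

theorem mem_signFiber {d : ℕ} {k : Fin d → ℕ} {h : Fin d → ℤ} :
    h ∈ signFiber k ↔ natAbsVec h = k := by
  rw [signFiber, Fintype.mem_piFinset, funext_iff]
  refine forall_congr' fun j => ?_
  rw [Finset.mem_insert, Finset.mem_singleton, natAbsVec]
  omega

theorem card_signFiber {d : ℕ} (k : Fin d → ℕ) : (signFiber k).card = 2 ^ numNonzero k := by
  rw [signFiber, Fintype.card_piFinset, numNonzero, ← Finset.prod_const, Finset.prod_filter]
  refine Finset.prod_congr rfl fun j _ => ?_
  split_ifs with h
  · rw [Finset.card_pair]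
    omega
  · have : k j = 0 := by omega
    simp [this]

theorem tsum_signFiber {d : ℕ} (F : (Fin d → ℤ) → ℝ≥0∞) :
    ∑' h, F h = ∑' k : Fin d → ℕ, ∑ h ∈ signFiber k, F h := by
  rw [← ENNReal.tsum_fiberwise F natAbsVec]
  refine tsum_congr fun k => ?_
  rw [← Finset.tsum_subtype]
  have : (natAbsVec ⁻¹' {k} : Set (Fin d → ℤ)) = ↑(signFiber k) := by
    ext h
    simp [mem_signFiber]
  rw [this]
  rfl

theorem hasSum_signFiber {d : ℕ} {F : (Fin d → ℤ) → ℂ} {a : ℂ} (hF : HasSum F a) :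
    HasSum (fun k : Fin d → ℕ => ∑ h ∈ signFiber k, F h) a := by
  refine (hF.tsum_fiberwise natAbsVec).congr_fun ?_
  intro k
  rw [← Finset.tsum_subtype]
  have : (natAbsVec ⁻¹' {k} : Set (Fin d → ℤ)) = ↑(signFiber k) := by
    ext h
    simp [mem_signFiber]
  rw [this]
  rfl

/-- The tent map doubles the frequency up to reflection: πn(1 - |2x-1|) is 2πnx or 2πn - 2πnx, and
the cosine does not distinguish them. -/
theorem sum_expFun_eq (n : ℕ) (x : ℝ) :
    ∑ m ∈ ({(n : ℤ), -(n : ℤ)} : Finset ℤ), expFun m x =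
      (((if n = 0 then 1 else 2) * Real.cos (Real.pi * n * (1 - |2 * x - 1|)) : ℝ) : ℂ) := by
  split_ifs with h
  · subst h
    simp [expFun]
  · have h1 : Real.cos (Real.pi * n * (1 - |2 * x - 1|)) = Real.cos (2 * Real.pi * n * x) := by
      rcases abs_choice (2 * x - 1) with h2 | h2
      · rw [h2, show Real.pi * n * (1 - (2 * x - 1)) = n * (2 * Real.pi) - 2 * Real.pi * n * x by
          ring, Real.cos_nat_mul_two_pi_sub]
      · rw [h2]
        congr 1
        ring
    rw [h1, Finset.sum_pair (by omega), expFun, expFun]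
    push_cast
    rw [Complex.two_cos]
    congr 2 <;> ring

theorem sum_fourierChar_signFiber {d : ℕ} (k : Fin d → ℕ) (z : Fin d → ℝ) :
    ∑ h ∈ signFiber k, fourierChar h z =
      ((Real.sqrt 2 ^ numNonzero k * cosineBasis k (tent z) : ℝ) : ℂ) := by
  simp_rw [fourierChar_eq_prod]
  rw [signFiber, ← Finset.prod_univ_sum (fun j => {(k j : ℤ), -(k j : ℤ)})
    fun j m => expFun m (z j)]
  simp_rw [sum_expFun_eq]
  rw [← Complex.ofReal_prod, cosineBasis, ← mul_assoc, ← mul_pow,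
    Real.mul_self_sqrt (by norm_num), Finset.prod_mul_distrib, numNonzero, ← Finset.prod_const,
    Finset.prod_filter]
  congr 2
  refine Finset.prod_congr rfl fun j _ => ?_
  split_ifs <;> simp_all

/-- The Fourier coefficients of `f ∘ ψ`. -/
def tentCoeff {d : ℕ} (f : (Fin d → ℝ) → ℝ) (h : Fin d → ℤ) : ℝ :=
  cosineCoeff f (natAbsVec h) / Real.sqrt 2 ^ numNonzero (natAbsVec h)

theorem weight_natAbsVec {d : ℕ} (α : ℝ) (γ : ℕ → ℝ) (h : Fin d → ℤ) :
    weight α γ (fun j => (natAbsVec h j : ℤ)) = weight α γ h := by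
  refine Finset.prod_congr rfl fun j _ => ?_
  simp only [natAbsVec, Nat.cast_natAbs, Int.cast_abs, Int.cast_id, abs_abs]

theorem tentCoeff_of_mem {d : ℕ} {f : (Fin d → ℝ) → ℝ} {k : Fin d → ℕ} {h : Fin d → ℤ}
    (hh : h ∈ signFiber k) : tentCoeff f h = cosineCoeff f k / Real.sqrt 2 ^ numNonzero k := by
  rw [tentCoeff, mem_signFiber.1 hh]

/-- `‖û(h)‖² r(h)²`. -/
def energyTerm {d : ℕ} (α : ℝ) (γ : ℕ → ℝ) (f : (Fin d → ℝ) → ℝ) (h : Fin d → ℤ) : ℝ≥0∞ :=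
  (‖tentCoeff f h‖ₑ * ENNReal.ofReal (weight α γ h)) ^ 2

theorem energyTerm_eq {d : ℕ} (α : ℝ) (γ : ℕ → ℝ) (f : (Fin d → ℝ) → ℝ) (h : Fin d → ℤ) :
    energyTerm α γ f h = ENNReal.ofReal (tentCoeff f h ^ 2 * weight α γ h ^ 2) := by
  have := (weight_pos α γ h).le
  rw [energyTerm, mul_pow, ENNReal.ofReal_mul (by positivity), ENNReal.ofReal_pow this,
    ← sq_abs, ENNReal.ofReal_pow (abs_nonneg _), Real.enorm_eq_ofReal_abs]

/-- Each cosine coefficient is divided by √2^|k|₀ and repeated 2^|k|₀ times with the same weight, so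
composition with the tent map is isometric. -/
theorem tsum_energyTerm_le {d : ℕ} {α : ℝ} {γ : ℕ → ℝ} {f : (Fin d → ℝ) → ℝ}
    (hf : f ∈ cosineBall d α γ) : ∑' h, energyTerm α γ f h ≤ 1 := by
  rw [tsum_signFiber]
  have h1 : ∀ k : Fin d → ℕ, ∑ h ∈ signFiber k, energyTerm α γ f h =
      ENNReal.ofReal (cosineCoeff f k ^ 2 * weight α γ (fun j => (k j : ℤ)) ^ 2) := by
    intro k
    have h2 : ∀ h ∈ signFiber k, energyTerm α γ f h = ENNReal.ofReal
        ((cosineCoeff f k / Real.sqrt 2 ^ numNonzero k) ^ 2 *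
          weight α γ (fun j => (k j : ℤ)) ^ 2) := by
      intro h hh
      rw [energyTerm_eq, tentCoeff_of_mem hh, ← weight_natAbsVec, mem_signFiber.1 hh]
    rw [Finset.sum_congr rfl h2, Finset.sum_const, card_signFiber, nsmul_eq_mul,
      ← ENNReal.ofReal_natCast, ← ENNReal.ofReal_mul (by positivity)]
    congr 1
    have h3 : (Real.sqrt 2 ^ numNonzero k) ^ 2 = 2 ^ numNonzero k := by
      rw [← pow_mul, mul_comm, pow_mul, Real.sq_sqrt (by norm_num)]
    rw [div_pow, h3]
    push_cast
    field_simp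
  simp_rw [h1]
  rw [← ENNReal.ofReal_tsum_of_nonneg (fun _ => by positivity) hf.1.summable]
  have h4 := hf.2
  rw [cosineNorm, Real.sqrt_le_one] at h4
  exact ENNReal.ofReal_le_one.2 h4

theorem ENNReal_tsum_mul_le {ι : Type*} (f g : ι → ℝ≥0∞) :
    ∑' i, f i * g i ≤ (∑' i, f i ^ 2) ^ (1 / 2 : ℝ) * (∑' i, g i ^ 2) ^ (1 / 2 : ℝ) := by
  refine ENNReal.summable.tsum_le_of_sum_le fun s => ?_
  have h := ENNReal.inner_le_Lp_mul_Lq s f g (p := 2) (q := 2) Real.HolderConjugate.two_two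
  refine h.trans (mul_le_mul' ?_ ?_)
  all_goals
    refine ENNReal.rpow_le_rpow ?_ (by norm_num)
    simp only [ENNReal.rpow_ofNat]
    exact ENNReal.sum_le_tsum s

theorem enorm_tentCoeff_eq {d : ℕ} (α : ℝ) (γ : ℕ → ℝ) (f : (Fin d → ℝ) → ℝ) (h : Fin d → ℤ) :
    ‖tentCoeff f h‖ₑ =
      (‖tentCoeff f h‖ₑ * ENNReal.ofReal (weight α γ h)) * weightPow α γ 1 h := by
  have := weight_pos α γ h
  rw [weightPow, mul_assoc, ← ENNReal.ofReal_mul this.le, Real.rpow_neg_one,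
    mul_inv_cancel₀ this.ne', ENNReal.ofReal_one, mul_one]

theorem weightPow_one_sq {d : ℕ} (α : ℝ) (γ : ℕ → ℝ) (h : Fin d → ℤ) :
    weightPow α γ 1 h ^ 2 = weightPow α γ 2 h := by
  have := weightPow_rpow α γ 1 2 zero_le_two h
  rwa [one_mul, ENNReal.rpow_ofNat] at this

/-- Cauchy–Schwarz against Σ r(h)⁻², which is finite since 2α > 1. -/
theorem summable_norm_tentCoeff {d : ℕ} {α : ℝ} {γ : ℕ → ℝ} (hα : 1 / 2 < α)
    (hγ : ∀ j, 0 < γ j) {f : (Fin d → ℝ) → ℝ} (hf : f ∈ cosineBall d α γ) :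
    Summable fun h : Fin d → ℤ => ‖(tentCoeff f h : ℂ)‖ := by
  have h1 : ∑' h : Fin d → ℤ, ‖tentCoeff f h‖ₑ ≠ ∞ := by
    rw [tsum_congr fun h => enorm_tentCoeff_eq α γ f h]
    refine ((ENNReal_tsum_mul_le _ _).trans_lt (ENNReal.mul_lt_top ?_ ?_)).ne
    · exact ENNReal.rpow_lt_top_of_nonneg (by norm_num)
        ((tsum_energyTerm_le hf).trans_lt ENNReal.one_lt_top).ne
    · refine ENNReal.rpow_lt_top_of_nonneg (by norm_num) ?_
      simp_rw [weightPow_one_sq]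
      exact ((tsum_weightPow_le (by linarith) hγ zero_le_two (by linarith) d).trans_lt
        ENNReal.ofReal_lt_top).ne
  refine (ENNReal.summable_toReal h1).congr fun h => ?_
  rw [toReal_enorm, Complex.norm_real]

theorem tail_sq_le {d : ℕ} {α : ℝ} {γ : ℕ → ℝ} {f : (Fin d → ℝ) → ℝ}
    (hf : f ∈ cosineBall d α γ) {A : Finset (Fin d → ℤ)} {M : ℝ} (hM : 0 < M)
    (hA : ∀ h, h ∉ A → M ≤ weight α γ h) :
    ∑' h, (if h ∈ A then 0 else ‖tentCoeff f h‖ₑ ^ 2) ≤ ENNReal.ofReal (M ^ (-2 : ℝ)) := by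
  calc ∑' h, (if h ∈ A then 0 else ‖tentCoeff f h‖ₑ ^ 2)
      ≤ ∑' h, ENNReal.ofReal (M ^ (-2 : ℝ)) * energyTerm α γ f h := by
        refine ENNReal.tsum_le_tsum fun h => ?_
        split_ifs with hh
        · exact zero_le
        · have h1 : (1 : ℝ≥0∞) ≤ ENNReal.ofReal (M ^ (-2 : ℝ)) *
              ENNReal.ofReal (weight α γ h) ^ 2 := by
            have hw := weight_pos α γ h
            rw [← ENNReal.ofReal_pow hw.le, ← ENNReal.ofReal_mul (by positivity),
              ENNReal.one_le_ofReal, Real.rpow_neg hM.le, Real.rpow_ofNat, inv_mul_eq_div,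
              one_le_div (by positivity)]
            exact pow_le_pow_left₀ hM.le (hA h hh) 2
          calc ‖tentCoeff f h‖ₑ ^ 2 = 1 * ‖tentCoeff f h‖ₑ ^ 2 := (one_mul _).symm
            _ ≤ _ := mul_le_mul' h1 le_rfl
            _ = _ := by rw [energyTerm]; ring
    _ ≤ ENNReal.ofReal (M ^ (-2 : ℝ)) * 1 := by
        rw [ENNReal.tsum_mul_left]
        exact mul_le_mul' le_rfl (tsum_energyTerm_le hf)
    _ = _ := mul_one _

/-- Cauchy–Schwarz, with Σ r⁻² outside A bounded by M^(p-2) Σ r^(-p). The free parameter p > 1/α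
trades the power of M against the zeta product. -/
theorem tail_le {d : ℕ} {α : ℝ} {γ : ℕ → ℝ} (hα : 1 / 2 < α) (hγ : ∀ j, 0 < γ j)
    {f : (Fin d → ℝ) → ℝ} (hf : f ∈ cosineBall d α γ) {A : Finset (Fin d → ℤ)} {M : ℝ}
    (hM : 0 < M) (hA : ∀ h, h ∉ A → M ≤ weight α γ h) {p : ℝ} (hp : 1 / α < p) (hp2 : p ≤ 2) :
    ∑' h, (if h ∈ A then 0 else ‖tentCoeff f h‖ₑ) ≤
      ENNReal.ofReal (zetaProd d α γ p ^ (1 / 2 : ℝ) * M ^ (-1 + p / 2)) := by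
  have hα0 : 0 < α := by linarith
  have hp0 : 0 < p := (by positivity : 0 < 1 / α).trans hp
  have hαp := one_lt_mul_of_one_div_lt hα0 hp
  have hz := one_le_zetaProd (s := d) hγ hαp
  have hz0 : 0 < zetaProd d α γ p := by linarith
  have h1 : ∑' h, (if h ∈ A then 0 else weightPow α γ 2 h) ≤
      ENNReal.ofReal (M ^ (p - 2)) * ENNReal.ofReal (zetaProd d α γ p) := by
    refine le_trans (ENNReal.tsum_le_tsum fun h => ?_)
      ((ENNReal.tsum_mul_left (a := ENNReal.ofReal (M ^ (p - 2)))
        (f := weightPow α γ p)).le.trans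
        (mul_le_mul' le_rfl (tsum_weightPow_le hα0 hγ hp0.le hαp d)))
    split_ifs with hh
    · exact zero_le
    · have hw := weight_pos α γ h
      rw [weightPow, weightPow, ← ENNReal.ofReal_mul (by positivity)]
      refine ENNReal.ofReal_le_ofReal ?_
      rw [show (-2 : ℝ) = (p - 2) + (-p) by ring, Real.rpow_add hw]
      refine mul_le_mul_of_nonneg_right ?_ (by positivity)
      exact Real.rpow_le_rpow_of_nonpos hM (hA h hh) (by linarith)
  calc ∑' h, (if h ∈ A then 0 else ‖tentCoeff f h‖ₑ)
      = ∑' h, (‖tentCoeff f h‖ₑ * ENNReal.ofReal (weight α γ h)) *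
          (if h ∈ A then 0 else weightPow α γ 1 h) := by
        refine tsum_congr fun h => ?_
        split_ifs
        · rw [mul_zero]
        · exact enorm_tentCoeff_eq α γ f h
    _ ≤ (∑' h, energyTerm α γ f h) ^ (1 / 2 : ℝ) *
          (∑' h, (if h ∈ A then 0 else weightPow α γ 1 h) ^ 2) ^ (1 / 2 : ℝ) :=
        ENNReal_tsum_mul_le _ _
    _ ≤ 1 * (ENNReal.ofReal (M ^ (p - 2)) * ENNReal.ofReal (zetaProd d α γ p)) ^ (1 / 2 : ℝ) := by
        refine mul_le_mul' ?_ (ENNReal.rpow_le_rpow ?_ (by norm_num))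
        · have := ENNReal.rpow_le_rpow (tsum_energyTerm_le hf) (by norm_num : (0 : ℝ) ≤ 1 / 2)
          rwa [ENNReal.one_rpow] at this
        · refine le_trans (le_of_eq (tsum_congr fun h => ?_)) h1
          split_ifs
          · simp
          · exact weightPow_one_sq α γ h
    _ = _ := by
        rw [one_mul, ← ENNReal.ofReal_mul (by positivity),
          ENNReal.ofReal_rpow_of_nonneg (by positivity) (by norm_num),
          Real.mul_rpow (by positivity) hz0.le, ← Real.rpow_mul hM.le, mul_comm]
        congr 3
        ring

/-! ### The periodized functions and their observations -/

theorem tent_mem_unitCube {d : ℕ} {z : Fin d → ℝ} (hz : z ∈ unitCube d) :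
    tent z ∈ unitCube d := by
  rw [unitCube, ← Set.pi_univ_Icc, Set.mem_univ_pi] at hz ⊢
  intro j
  obtain ⟨h1, h2⟩ := hz j
  simp only [Pi.zero_apply, Pi.one_apply] at h1 h2
  have h3 : |2 * z j - 1| ≤ 1 := abs_le.2 ⟨by linarith, by linarith⟩
  have h4 := abs_nonneg (2 * z j - 1)
  simp only [tent, Pi.zero_apply, Pi.one_apply]
  exact ⟨by linarith, by linarith⟩

theorem fract_mem_unitCube {d : ℕ} (z : Fin d → ℝ) :
    (fun j => Int.fract (z j)) ∈ unitCube d := by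
  rw [unitCube, ← Set.pi_univ_Icc, Set.mem_univ_pi]
  exact fun j => ⟨Int.fract_nonneg _, (Int.fract_lt_one _).le⟩

theorem summable_tentCoeff_mul {d : ℕ} {α : ℝ} {γ : ℕ → ℝ} (hα : 1 / 2 < α)
    (hγ : ∀ j, 0 < γ j) {f : (Fin d → ℝ) → ℝ} (hf : f ∈ cosineBall d α γ) (z : Fin d → ℝ) :
    Summable fun h : Fin d → ℤ => (tentCoeff f h : ℂ) * fourierChar h z := by
  refine Summable.of_norm ((summable_norm_tentCoeff hα hγ hf).congr fun h => ?_)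
  rw [norm_mul, norm_fourierChar, mul_one]

theorem sum_signFiber_tentCoeff {d : ℕ} (f : (Fin d → ℝ) → ℝ) (k : Fin d → ℕ) (z : Fin d → ℝ) :
    ∑ h ∈ signFiber k, (tentCoeff f h : ℂ) * fourierChar h z =
      ((cosineCoeff f k * cosineBasis k (tent z) : ℝ) : ℂ) := by
  have h1 : ∀ h ∈ signFiber k, (tentCoeff f h : ℂ) * fourierChar h z =
      ((cosineCoeff f k / Real.sqrt 2 ^ numNonzero k : ℝ) : ℂ) * fourierChar h z := by
    intro h hh
    rw [tentCoeff_of_mem hh]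
  rw [Finset.sum_congr rfl h1, ← Finset.mul_sum, sum_fourierChar_signFiber, ← Complex.ofReal_mul]
  congr 1
  field_simp

/-- The exponential series converges absolutely, so it may be grouped by sign patterns; the groups
are the terms of the cosine series of f, and limits are unique. -/
theorem hasSum_tentCoeff {d : ℕ} {α : ℝ} {γ : ℕ → ℝ} (hα : 1 / 2 < α)
    (hγ : ∀ j, 0 < γ j) {f : (Fin d → ℝ) → ℝ} (hf : f ∈ cosineBall d α γ) {z : Fin d → ℝ}
    (hz : z ∈ unitCube d) :
    HasSum (fun h : Fin d → ℤ => (tentCoeff f h : ℂ) * fourierChar h z) (f (tent z) : ℂ) := by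
  have h1 := (summable_tentCoeff_mul hα hγ hf z).hasSum
  have h2 := hasSum_signFiber h1
  simp_rw [sum_signFiber_tentCoeff] at h2
  have h3 := Complex.hasSum_ofReal.2 (hf.1.hasSum.hasSum (tent_mem_unitCube hz))
  rwa [h2.unique h3] at h1

/-- Summing the characters over the rank-one lattice retains exactly the frequencies congruent to l
with respect to g. Fractional parts keep the points in the cube and do not affect characters. -/
theorem hasSum_observation {d : ℕ} {α : ℝ} {γ : ℕ → ℝ} (hα : 1 / 2 < α)
    (hγ : ∀ j, 0 < γ j) {f : (Fin d → ℝ) → ℝ} (hf : f ∈ cosineBall d α γ) {N : ℕ} (hN : N ≠ 0)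
    (g : Fin d → ℕ) (l : Fin d → ℤ) (y : Fin d → ℝ) :
    HasSum (fun h : Fin d → ℤ => (if (N : ℤ) ∣ ∑ j, (h j - l j) * g j then
      (tentCoeff f h : ℂ) else 0) * fourierChar h y)
      (observation N g (fun z => f (tent z)) l y) := by
  have hNC : (N : ℂ) ≠ 0 := by exact_mod_cast hN
  have h1 : ∀ n ∈ Finset.range N, HasSum (fun h : Fin d → ℤ => (tentCoeff f h : ℂ) *
      fourierChar h y * fourierChar (h - l) (fun j => (n : ℝ) * (g j : ℤ) / N))
      ((f (tent fun j => Int.fract ((n : ℝ) * g j / N + y j)) : ℂ) *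
        fourierChar (-l) (fun j => (n : ℝ) * g j / N)) := by
    intro n _
    have h2 := (hasSum_tentCoeff hα hγ hf
      (fract_mem_unitCube fun j => (n : ℝ) * g j / N + y j)).mul_right
        (fourierChar (-l) (fun j => (n : ℝ) * g j / N))
    refine h2.congr_fun fun h => ?_
    have h3 : (fun j => (n : ℝ) * g j / N + y j) = (fun j => (n : ℝ) * g j / N) + y := rfl
    rw [fourierChar_fract, h3, fourierChar_add, sub_eq_add_neg, fourierChar_add_left]
    simp only [Int.cast_natCast]
    ring
  have h4 := (hasSum_sum h1).mul_left (1 / N : ℂ)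
  rw [observation]
  refine h4.congr_fun fun h => ?_
  rw [← Finset.mul_sum, sum_fourierChar_lattice (h - l) (fun j => (g j : ℤ)) hN]
  have h5 : dot (h - l) (fun j => (g j : ℤ)) = ∑ j, (h j - l j) * g j := rfl
  rw [h5]
  split_ifs
  · field_simp
  · simp

/-! ### Least squares -/

theorem star_dotProduct_self_eq {ι : Type*} [Fintype ι] (v : ι → ℂ) :
    star v ⬝ᵥ v = ((∑ i, ‖v i‖ ^ 2 : ℝ) : ℂ) := by
  rw [dotProduct, Complex.ofReal_sum]
  refine Finset.sum_congr rfl fun i _ => ?_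
  rw [Pi.star_apply, Complex.star_def, Complex.conj_mul', Complex.ofReal_pow]

theorem star_dotProduct_gram_eq {κ ι : Type*} [Fintype κ] [Fintype ι] (B : Matrix κ ι ℂ)
    (a : ι → ℂ) (w : κ → ℂ) : star a ⬝ᵥ (Bᴴ *ᵥ w) = star (B *ᵥ a) ⬝ᵥ w := by
  rw [Matrix.star_mulVec, Matrix.dotProduct_mulVec]

theorem re_star_dotProduct_le {κ : Type*} [Fintype κ] (v w : κ → ℂ) :
    (star v ⬝ᵥ w).re ≤ ((∑ i, ‖v i‖ ^ 2) + ∑ i, ‖w i‖ ^ 2) / 2 := by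
  rw [dotProduct, Complex.re_sum, ← Finset.sum_add_distrib, Finset.sum_div]
  refine Finset.sum_le_sum fun i _ => ?_
  have h1 := Complex.re_le_norm (star v i * w i)
  rw [norm_mul] at h1
  rw [show ‖star v i‖ = ‖v i‖ from norm_star (v i)] at h1
  nlinarith [sq_nonneg (‖v i‖ - ‖w i‖)]

/-- Stability of the least-squares solution of `B a = w`, and exactness for solvable systems. -/
theorem leastSquares_bound {κ ι : Type*} [Fintype κ] [Fintype ι] [DecidableEq ι]
    (B : Matrix κ ι ℂ) {c : ℝ} (hc : 0 < c)
    (hB : ∀ a : ι → ℂ, c * ∑ i, ‖a i‖ ^ 2 ≤ ∑ s, ‖(B *ᵥ a) s‖ ^ 2) :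
    (∀ x, ((Bᴴ * B)⁻¹ * Bᴴ) *ᵥ (B *ᵥ x) = x) ∧
      ∀ w : κ → ℂ, c * ∑ i, ‖(((Bᴴ * B)⁻¹ * Bᴴ) *ᵥ w) i‖ ^ 2 ≤ ∑ s, ‖w s‖ ^ 2 := by
  -- The lower bound makes the Gram matrix injective, so its inverse is genuine and not the default
  -- value.
  have hinj : Function.Injective (Bᴴ * B).mulVec := by
    intro a b hab
    have h1 : (Bᴴ * B) *ᵥ (a - b) = 0 := by
      rw [Matrix.mulVec_sub]
      exact sub_eq_zero.2 hab
    have h2 := star_dotProduct_gram_eq B (a - b) (B *ᵥ (a - b))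
    rw [Matrix.mulVec_mulVec, h1, dotProduct_zero, star_dotProduct_self_eq] at h2
    have h3 : ∑ s, ‖(B *ᵥ (a - b)) s‖ ^ 2 = 0 := by exact_mod_cast h2.symm
    have h4 := hB (a - b)
    rw [h3] at h4
    have h5 : ∑ i, ‖(a - b) i‖ ^ 2 = 0 :=
      le_antisymm (nonpos_of_mul_nonpos_right h4 hc) (Finset.sum_nonneg fun _ _ => by positivity)
    rw [Finset.sum_eq_zero_iff_of_nonneg fun _ _ => by positivity] at h5
    funext i
    have h6 := h5 i (Finset.mem_univ i)
    rw [sq_eq_zero_iff, norm_eq_zero] at h6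
    exact sub_eq_zero.1 h6
  have hunit : IsUnit (Bᴴ * B).det :=
    (Matrix.isUnit_iff_isUnit_det _).1 (Matrix.mulVec_injective_iff_isUnit.1 hinj)
  refine ⟨fun x => ?_, fun w => ?_⟩
  · rw [Matrix.mulVec_mulVec, Matrix.mul_assoc, Matrix.nonsing_inv_mul _ hunit,
      Matrix.one_mulVec]
  · set a := ((Bᴴ * B)⁻¹ * Bᴴ) *ᵥ w with ha
    have h1 : Bᴴ *ᵥ (B *ᵥ a) = Bᴴ *ᵥ w := by
      rw [ha, Matrix.mulVec_mulVec, Matrix.mulVec_mulVec, ← Matrix.mul_assoc,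
        Matrix.mul_nonsing_inv _ hunit, Matrix.one_mul]
    -- By the normal equations ‖Ba‖² = Re⟨Ba, w⟩ ≤ (‖Ba‖² + ‖w‖²)/2, hence ‖Ba‖² ≤ ‖w‖².
    have h2 := star_dotProduct_gram_eq B a (B *ᵥ a)
    rw [h1, star_dotProduct_gram_eq, star_dotProduct_self_eq] at h2
    have h3 := re_star_dotProduct_le (B *ᵥ a) w
    rw [h2, Complex.ofReal_re] at h3
    linarith [hB a]

/-- A Gershgorin type lower bound for a quadratic form with constant diagonal. -/
theorem gram_lower_bound {ι : Type*} [Fintype ι] [DecidableEq ι] (G : Matrix ι ι ℂ)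
    {s r t : ℝ} (hr : 0 ≤ r) (hdiag : ∀ i, G i i = (s : ℂ))
    (hoff : ∀ i j, i ≠ j → ‖G i j‖ ≤ r) (hcard : ((Fintype.card ι : ℝ) - 1) * r ≤ t * s)
    (a : ι → ℂ) : (1 - t) * s * ∑ i, ‖a i‖ ^ 2 ≤ (star a ⬝ᵥ (G *ᵥ a)).re := by
  -- Adding r to the diagonal completes the off-diagonal sum to r (Σ|a_i|)², to which Cauchy–Schwarz
  -- applies.
  have h1 : ∀ i j, (if i = j then (s + r) * ‖a i‖ ^ 2 else 0) - r * (‖a i‖ * ‖a j‖) ≤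
      (star a i * (G i j * a j)).re := by
    intro i j
    split_ifs with h
    · subst h
      have h2 : star a i * (G i i * a i) = ((s * ‖a i‖ ^ 2 : ℝ) : ℂ) := by
        rw [hdiag, mul_left_comm, Pi.star_apply, Complex.star_def, Complex.conj_mul',
          ← Complex.ofReal_pow, ← Complex.ofReal_mul]
      rw [h2, Complex.ofReal_re]
      nlinarith
    · have h2 := (abs_le.1 (Complex.abs_re_le_norm (star a i * (G i j * a j)))).1
      rw [norm_mul, norm_mul, show ‖star a i‖ = ‖a i‖ from norm_star (a i)] at h2
      have h3 := mul_le_mul_of_nonneg_right (hoff i j h)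
        (mul_nonneg (norm_nonneg (a i)) (norm_nonneg (a j)))
      nlinarith
  have h2 : (star a ⬝ᵥ (G *ᵥ a)).re = ∑ i, ∑ j, (star a i * (G i j * a j)).re := by
    simp only [dotProduct, Matrix.mulVec, Finset.mul_sum, Complex.re_sum]
  have h3 : ∑ i, ∑ j, ((if i = j then (s + r) * ‖a i‖ ^ 2 else 0) - r * (‖a i‖ * ‖a j‖)) =
      (s + r) * (∑ i, ‖a i‖ ^ 2) - r * (∑ i, ‖a i‖) ^ 2 := by
    simp only [Finset.sum_sub_distrib, Finset.sum_ite_eq, Finset.mem_univ, if_true,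
      ← Finset.mul_sum, ← Finset.sum_mul]
    ring
  have h4 : (∑ i, ‖a i‖) ^ 2 ≤ Fintype.card ι * ∑ i, ‖a i‖ ^ 2 := by
    have := sq_sum_le_card_mul_sum_sq (s := Finset.univ) (f := fun i => ‖a i‖)
    rwa [Finset.card_univ] at this
  have h5 : 0 ≤ ∑ i, ‖a i‖ ^ 2 := Finset.sum_nonneg fun _ _ => by positivity
  have h6 := Finset.sum_le_sum fun i (_ : i ∈ Finset.univ) =>
    Finset.sum_le_sum fun j (_ : j ∈ Finset.univ) => h1 i j
  rw [h2]
  rw [h3] at h6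
  have h7 := mul_le_mul_of_nonneg_left h4 hr
  have h8 := mul_le_mul_of_nonneg_right hcard h5
  nlinarith

/-! ### The error of the estimated coefficients -/

theorem gram_systemMatrix {d : ℕ} (A : Finset (Fin d → ℤ)) (N : ℕ) (g : Fin d → ℕ)
    (Y : List (Fin d → ℝ)) (k : Fin d → ℤ) (m n : fiber A N g k) :
    ((systemMatrix A N g Y k)ᴴ * systemMatrix A N g Y k) m n = expSum Y (n.1 - m.1) := by
  rw [Matrix.mul_apply, expSum, ← Fin.sum_univ_fun_getElem]
  refine Finset.sum_congr rfl fun s _ => ?_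
  rw [Matrix.conjTranspose_apply, systemMatrix, Matrix.of_apply, Matrix.of_apply,
    star_fourierChar, ← fourierChar_add_left, neg_add_eq_sub]
  rfl

/-- Shifts for which the least-squares problems of all fibers are well conditioned. -/
def StableShifts {d : ℕ} (A : Finset (Fin d → ℤ)) (N : ℕ) (g : Fin d → ℕ) (t : ℝ)
    (Y : List (Fin d → ℝ)) : Prop :=
  1 ≤ Y.length ∧ (2 ≤ maxFiber A N g → ∀ h ∈ fiberDiffs A N g,
    ‖expSum Y h‖ * ((maxFiber A N g : ℝ) - 1) ≤ t * Y.length)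

theorem card_fiber_le {d : ℕ} {A : Finset (Fin d → ℤ)} {N : ℕ} {g : Fin d → ℕ} {k : Fin d → ℤ}
    (hk : k ∈ A) : (fiber A N g k).card ≤ maxFiber A N g :=
  Finset.le_sup (f := fun l => (fiber A N g l).card) hk

theorem sub_mem_fiberDiffs {d : ℕ} {A : Finset (Fin d → ℤ)} {N : ℕ} {g : Fin d → ℕ}
    {k m n : Fin d → ℤ} (hm : m ∈ fiber A N g k) (hn : n ∈ fiber A N g k) (hmn : n ≠ m) :
    n - m ∈ fiberDiffs A N g := by
  refine Finset.mem_erase.2 ⟨sub_ne_zero.2 hmn, Finset.mem_biUnion.2 ⟨m, (mem_fiber.1 hm).1,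
    Finset.mem_image.2 ⟨n, mem_fiber.2 ⟨(mem_fiber.1 hn).1, ?_⟩, rfl⟩⟩⟩
  exact dvd_of_mem_fiber hn hm

/-- Entries of the Gram matrix are exponential sums at fiber differences. The number of columns is
at most R, which is the R in the stability condition. -/
theorem systemMatrix_lower_bound {d : ℕ} {A : Finset (Fin d → ℤ)} {N : ℕ} {g : Fin d → ℕ}
    {t : ℝ} (ht : 0 < t) {Y : List (Fin d → ℝ)} (hY : StableShifts A N g t Y) {k : Fin d → ℤ}
    (hk : k ∈ A) (a : fiber A N g k → ℂ) :
    (1 - t) * Y.length * ∑ m, ‖a m‖ ^ 2 ≤ ∑ s, ‖(systemMatrix A N g Y k *ᵥ a) s‖ ^ 2 := by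
  have h1 := star_dotProduct_gram_eq (systemMatrix A N g Y k) a (systemMatrix A N g Y k *ᵥ a)
  rw [star_dotProduct_self_eq, Matrix.mulVec_mulVec] at h1
  have h2 : ∑ s, ‖(systemMatrix A N g Y k *ᵥ a) s‖ ^ 2 =
      (star a ⬝ᵥ (((systemMatrix A N g Y k)ᴴ * systemMatrix A N g Y k) *ᵥ a)).re := by
    rw [h1, Complex.ofReal_re]
  rw [h2]
  have hdiag : ∀ m, ((systemMatrix A N g Y k)ᴴ * systemMatrix A N g Y k) m m =
      ((Y.length : ℝ) : ℂ) := by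
    intro m
    rw [gram_systemMatrix, sub_self, expSum]
    simp
  have hcard : (Fintype.card (fiber A N g k) : ℝ) ≤ maxFiber A N g := by
    rw [Fintype.card_coe]
    exact_mod_cast card_fiber_le hk
  -- For R < 2 the quotient by R - 1 is meaningless, but then the matrix has no off-diagonal
  -- entries.
  rcases Nat.lt_or_ge (maxFiber A N g) 2 with hR | hR
  · have hR1 : Fintype.card (fiber A N g k) ≤ 1 := by
      have : Fintype.card (fiber A N g k) ≤ maxFiber A N g := by exact_mod_cast hcard
      omega
    refine gram_lower_bound _ le_rfl hdiag (fun m n hmn => ?_) ?_ a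
    · exact absurd (Fintype.card_le_one_iff.1 hR1 m n) hmn
    · rw [mul_zero]
      positivity
  · have hR1 : (0 : ℝ) < (maxFiber A N g : ℝ) - 1 := by
      have : (2 : ℝ) ≤ maxFiber A N g := by exact_mod_cast hR
      linarith
    refine gram_lower_bound _ (r := t * Y.length / ((maxFiber A N g : ℝ) - 1)) (by positivity)
      hdiag (fun m n hmn => ?_) ?_ a
    · rw [gram_systemMatrix, le_div_iff₀ hR1]
      exact hY.2 hR _ (sub_mem_fiberDiffs m.2 n.2 fun h => hmn (Subtype.ext h.symm))
    · rw [mul_div_assoc', div_le_iff₀ hR1, mul_comm]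
      exact mul_le_mul_of_nonneg_left (by linarith) (by positivity)

/-- The part of an observation for the fiber of `k` which is due to frequencies outside of `A`. -/
def aliasing {d : ℕ} (A : Finset (Fin d → ℤ)) (N : ℕ) (g : Fin d → ℕ) (f : (Fin d → ℝ) → ℝ)
    (k : Fin d → ℤ) (y : Fin d → ℝ) : ℂ :=
  ∑' h : Fin d → ℤ, (if h ∉ A ∧ (N : ℤ) ∣ ∑ j, (h j - k j) * g j then (tentCoeff f h : ℂ) else 0) *
    fourierChar h y

theorem observation_eq_add_aliasing {d : ℕ} {α : ℝ} {γ : ℕ → ℝ} (hα : 1 / 2 < α)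
    (hγ : ∀ j, 0 < γ j) {f : (Fin d → ℝ) → ℝ} (hf : f ∈ cosineBall d α γ) {N : ℕ} (hN : N ≠ 0)
    (A : Finset (Fin d → ℤ)) (g : Fin d → ℕ) (k : Fin d → ℤ) (y : Fin d → ℝ) :
    observation N g (fun z => f (tent z)) k y =
      (∑ m : fiber A N g k, fourierChar m.1 y * (tentCoeff f m.1 : ℂ)) + aliasing A N g f k y := by
  have h1 := hasSum_observation hα hγ hf hN g k y
  have h2 : HasSum (fun h => if h ∈ fiber A N g k then (tentCoeff f h : ℂ) * fourierChar h y else 0)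
      (∑ h ∈ fiber A N g k, (tentCoeff f h : ℂ) * fourierChar h y) := by
    rw [← Finset.sum_congr rfl fun h (hh : h ∈ fiber A N g k) =>
      if_pos (t := (tentCoeff f h : ℂ) * fourierChar h y) (e := 0) hh]
    exact hasSum_sum_of_ne_finset_zero fun h hh => if_neg hh
  have h3 : aliasing A N g f k y = _ := (HasSum.congr_fun (h1.sub h2) fun h => by
    simp only [mem_fiber]
    by_cases h4 : h ∈ A <;> by_cases h5 : (N : ℤ) ∣ ∑ j, (h j - k j) * g j <;>
      simp [h4, h5]).tsum_eq
  rw [h3, ← Finset.sum_coe_sort (fiber A N g k)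
    (fun h => (tentCoeff f h : ℂ) * fourierChar h y)]
  simp_rw [mul_comm (fourierChar _ y)]
  ring

/-- The fiber part of the observation is reproduced exactly, so the error is one entry of the
least-squares solution for the aliasing data. The unimodular matrix D(-Δ) undoes the phase of the
global shift. -/
theorem coeffEstimate_sub_sq_le {d : ℕ} {α : ℝ} {γ : ℕ → ℝ} (hα : 1 / 2 < α)
    (hγ : ∀ j, 0 < γ j) {f : (Fin d → ℝ) → ℝ} (hf : f ∈ cosineBall d α γ) {N : ℕ} (hN : N ≠ 0)
    {A : Finset (Fin d → ℤ)} {g : Fin d → ℕ} {t : ℝ} (ht0 : 0 < t) (ht1 : t < 1)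
    {Y : List (Fin d → ℝ)} (hY : StableShifts A N g t Y) {k : Fin d → ℤ} (hk : k ∈ A)
    (Δ : Fin d → ℝ) :
    (1 - t) * Y.length * ‖(tentCoeff f k : ℂ) -
      coeffEstimate A N g Y Δ (fun z => f (tent z)) k‖ ^ 2 ≤
      ∑ s : Fin Y.length, ‖aliasing A N g f k (Y.get s + Δ)‖ ^ 2 := by
  have hS : (0 : ℝ) < Y.length := by exact_mod_cast hY.1
  have hkf : k ∈ fiber A N g k := mem_fiber.2 ⟨hk, by simp⟩
  set B := systemMatrix A N g Y k with hB
  obtain ⟨h1, h2⟩ := leastSquares_bound B (c := (1 - t) * Y.length)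
    (mul_pos (by linarith) hS) (systemMatrix_lower_bound ht0 hY hk)
  set w : Fin Y.length → ℂ := fun s => aliasing A N g f k (Y.get s + Δ) with hw
  have h3 : (fun s => observation N g (fun z => f (tent z)) k (Y.get s + Δ)) =
      B *ᵥ (fun m => fourierChar m.1 Δ * (tentCoeff f m.1 : ℂ)) + w := by
    funext s
    rw [observation_eq_add_aliasing hα hγ hf hN A, Pi.add_apply, Matrix.mulVec, dotProduct]
    congr 1
    refine Finset.sum_congr rfl fun m _ => ?_
    rw [hB, systemMatrix, Matrix.of_apply, fourierChar_add, mul_assoc]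
  have h4 : coeffEstimate A N g Y Δ (fun z => f (tent z)) k = (tentCoeff f k : ℂ) +
      fourierChar k (-Δ) * (((Bᴴ * B)⁻¹ * Bᴴ) *ᵥ w) ⟨k, hkf⟩ := by
    rw [coeffEstimate, dif_pos hkf]
    have h6 : fiberEstimate A N g Y Δ (fun z => f (tent z)) k =
        Matrix.diagonal (fun m : fiber A N g k => fourierChar m.1 (-Δ)) *ᵥ
          (((Bᴴ * B)⁻¹ * Bᴴ) *ᵥ
            fun s => observation N g (fun z => f (tent z)) k (Y.get s + Δ)) := by
      rw [Matrix.mulVec_mulVec, ← Matrix.mul_assoc]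
      rfl
    rw [h6, h3, Matrix.mulVec_add, h1]
    refine (Matrix.mulVec_diagonal _ _ _).trans ?_
    refine (mul_add _ _ _).trans ?_
    rw [← mul_assoc, ← fourierChar_add, neg_add_cancel, fourierChar_zero, one_mul]
  have h5 : ‖(tentCoeff f k : ℂ) - coeffEstimate A N g Y Δ (fun z => f (tent z)) k‖ =
      ‖(((Bᴴ * B)⁻¹ * Bᴴ) *ᵥ w) ⟨k, hkf⟩‖ := by
    rw [h4, sub_add_cancel_left, norm_neg, norm_mul, norm_fourierChar, one_mul]
  rw [h5]
  refine le_trans (mul_le_mul_of_nonneg_left ?_ (mul_pos (by linarith) hS).le) (h2 w)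
  generalize ((Bᴴ * B)⁻¹ * Bᴴ) *ᵥ w = v
  exact Finset.single_le_sum (f := fun m => ‖v m‖ ^ 2)
    (fun _ _ => by positivity) (Finset.mem_univ (⟨k, hkf⟩ : fiber A N g k))

/-! ### Reduction of the errors to the coefficients -/

/-- The errors of the approximated Fourier coefficients of `f ∘ ψ`. -/
def coeffError {d : ℕ} (A : Finset (Fin d → ℤ)) (N : ℕ) (g : Fin d → ℕ) (Y : List (Fin d → ℝ))
    (Δ : Fin d → ℝ) (f : (Fin d → ℝ) → ℝ) (h : Fin d → ℤ) : ℂ :=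
  (tentCoeff f h : ℂ) - if h ∈ A then coeffEstimate A N g Y Δ (fun z => f (tent z)) h else 0

/-- The errors of the approximated cosine coefficients of `f`. -/
def cosineError {d : ℕ} (A : Finset (Fin d → ℤ)) (N : ℕ) (g : Fin d → ℕ) (Y : List (Fin d → ℝ))
    (Δ : Fin d → ℝ) (f : (Fin d → ℝ) → ℝ) (k : Fin d → ℕ) : ℂ :=
  1 / (Real.sqrt 2 : ℂ) ^ numNonzero k * ∑ h ∈ signFiber k, coeffError A N g Y Δ f h

/-- Averaging the coefficients û(h) over the signs of k and rescaling recovers the cosine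
coefficient, so the approximation error is itself a cosine series, with the averaged coefficient
errors. -/
theorem hasSum_cosineError {d : ℕ} {α : ℝ} {γ : ℕ → ℝ} (hα : 0 < α)
    (hγ : ∀ j, 0 < γ j) {f : (Fin d → ℝ) → ℝ} (hf : f ∈ cosineBall d α γ) (N : ℕ)
    (g : Fin d → ℕ) (Y : List (Fin d → ℝ)) (Δ : Fin d → ℝ) {x : Fin d → ℝ}
    (hx : x ∈ unitCube d) :
    HasSum (fun k => cosineError (hyperbolicCross d α γ (truncation d α γ N)) N g Y Δ f k *
      (cosineBasis k x : ℂ)) ((f x : ℂ) - cosineApprox α γ N g Y Δ f x) := by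
  set M := truncation d α γ N with hM
  set A := hyperbolicCross d α γ M with hA
  have h1 := Complex.hasSum_ofReal.2 (hf.1.hasSum.hasSum hx)
  have h2 : HasSum (fun k => if k ∈ positiveCross d α γ M then
      (1 / (Real.sqrt 2 : ℂ) ^ numNonzero k *
        ∑ h ∈ A.filter (fun h => ∀ j, (h j).natAbs = k j),
          coeffEstimate A N g Y Δ (fun z => f (tent z)) h) * (cosineBasis k x : ℂ) else 0)
      (cosineApprox α γ N g Y Δ f x) := by
    rw [cosineApprox]
    simp only [← hM, ← hA]
    rw [← Finset.sum_congr rfl fun k (hk : k ∈ positiveCross d α γ M) => if_pos hk]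
    exact hasSum_sum_of_ne_finset_zero fun k hk => if_neg hk
  refine HasSum.congr_fun (h1.sub h2) fun k => ?_
  -- The weight ignores signs: either all sign variants of k belong to A or none does.
  have hmem : ∀ h ∈ signFiber k, (h ∈ A ↔ k ∈ positiveCross d α γ M) := by
    intro h hh
    rw [hA, mem_hyperbolicCross hα hγ, mem_positiveCross hα hγ, ← weight_natAbsVec,
      mem_signFiber.1 hh]
  have hs2 : (Real.sqrt 2 : ℂ) ^ numNonzero k ≠ 0 := by
    refine pow_ne_zero _ ?_
    rw [Complex.ofReal_ne_zero]
    positivity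
  have h3 : 1 / (Real.sqrt 2 : ℂ) ^ numNonzero k * ∑ h ∈ signFiber k, (tentCoeff f h : ℂ) =
      (cosineCoeff f k : ℂ) := by
    rw [Finset.sum_congr rfl fun h hh => by rw [tentCoeff_of_mem hh], Finset.sum_const,
      card_signFiber, nsmul_eq_mul]
    have h4 : ((2 ^ numNonzero k : ℕ) : ℂ) =
        (Real.sqrt 2 : ℂ) ^ numNonzero k * (Real.sqrt 2 : ℂ) ^ numNonzero k := by
      rw [← mul_pow, ← Complex.ofReal_mul, Real.mul_self_sqrt zero_le_two]
      push_cast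
      rfl
    rw [h4]
    push_cast
    field_simp
  have h5 : cosineError A N g Y Δ f k = (cosineCoeff f k : ℂ) -
      1 / (Real.sqrt 2 : ℂ) ^ numNonzero k * ∑ h ∈ signFiber k,
        if h ∈ A then coeffEstimate A N g Y Δ (fun z => f (tent z)) h else 0 := by
    rw [cosineError, ← h3, ← mul_sub, ← Finset.sum_sub_distrib]
    rfl
  rw [h5]
  split_ifs with hk
  · have h6 : A.filter (fun h => ∀ j, (h j).natAbs = k j) = signFiber k := by
      ext h
      rw [Finset.mem_filter]
      constructor
      · exact fun hh => mem_signFiber.2 (funext hh.2)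
      · exact fun hh => ⟨(hmem h hh).2 hk, congrFun (mem_signFiber.1 hh)⟩
    rw [h6, Finset.sum_congr rfl fun h hh => if_pos ((hmem h hh).2 hk)]
    push_cast
    ring
  · rw [Finset.sum_congr rfl fun h hh => if_neg (mt (hmem h hh).1 hk)]
    push_cast
    simp

theorem norm_cosineError_mul_le {d : ℕ} (A : Finset (Fin d → ℤ)) (N : ℕ) (g : Fin d → ℕ)
    (Y : List (Fin d → ℝ)) (Δ : Fin d → ℝ) (f : (Fin d → ℝ) → ℝ) (k : Fin d → ℕ) :
    ‖cosineError A N g Y Δ f k‖ * Real.sqrt 2 ^ numNonzero k ≤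
      ∑ h ∈ signFiber k, ‖coeffError A N g Y Δ f h‖ := by
  have hs2 : 0 < Real.sqrt 2 ^ numNonzero k := by positivity
  have h1 : ‖1 / (Real.sqrt 2 : ℂ) ^ numNonzero k‖ = 1 / Real.sqrt 2 ^ numNonzero k := by
    rw [norm_div, norm_one, norm_pow, Complex.norm_real, Real.norm_of_nonneg (Real.sqrt_nonneg 2)]
  rw [cosineError, norm_mul, h1, mul_right_comm, one_div_mul_cancel hs2.ne', one_mul]
  exact norm_sum_le _ _

/-- Cauchy–Schwarz over the 2^|k|₀ sign patterns, which the squared normalization cancels exactly.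
-/
theorem norm_cosineError_sq_le {d : ℕ} (A : Finset (Fin d → ℤ)) (N : ℕ) (g : Fin d → ℕ)
    (Y : List (Fin d → ℝ)) (Δ : Fin d → ℝ) (f : (Fin d → ℝ) → ℝ) (k : Fin d → ℕ) :
    ‖cosineError A N g Y Δ f k‖ ^ 2 ≤ ∑ h ∈ signFiber k, ‖coeffError A N g Y Δ f h‖ ^ 2 := by
  have hs2 : 0 < Real.sqrt 2 ^ numNonzero k := by positivity
  have h1 := norm_cosineError_mul_le A N g Y Δ f k
  have h2 := sq_sum_le_card_mul_sum_sq (s := signFiber k) (f := fun h => ‖coeffError A N g Y Δ f h‖)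
  have h3 := pow_le_pow_left₀ (by positivity) h1 2
  rw [card_signFiber] at h2
  have h4 : (Real.sqrt 2 ^ numNonzero k) ^ 2 = ((2 ^ numNonzero k : ℕ) : ℝ) := by
    rw [← pow_mul, mul_comm, pow_mul, Real.sq_sqrt (by norm_num)]
    push_cast
    rfl
  have h5 : (0 : ℝ) < ((2 ^ numNonzero k : ℕ) : ℝ) := by positivity
  rw [mul_pow, h4] at h3
  have h6 := h3.trans h2
  rw [mul_comm] at h6
  exact le_of_mul_le_mul_left h6 h5

theorem enorm_sq_eq_ofReal {E : Type*} [SeminormedAddCommGroup E] (a : E) :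
    ‖a‖ₑ ^ 2 = ENNReal.ofReal (‖a‖ ^ 2) := by
  rw [← ofReal_norm, ENNReal.ofReal_pow (norm_nonneg a)]

theorem enorm_sub_cosineApprox_le {d : ℕ} {α : ℝ} {γ : ℕ → ℝ} (hα : 0 < α)
    (hγ : ∀ j, 0 < γ j) {f : (Fin d → ℝ) → ℝ} (hf : f ∈ cosineBall d α γ) (N : ℕ)
    (g : Fin d → ℕ) (Y : List (Fin d → ℝ)) (Δ : Fin d → ℝ) {x : Fin d → ℝ}
    (hx : x ∈ unitCube d) :
    ‖(f x : ℂ) - cosineApprox α γ N g Y Δ f x‖ₑ ≤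
      ∑' h, ‖coeffError (hyperbolicCross d α γ (truncation d α γ N)) N g Y Δ f h‖ₑ := by
  rw [← (hasSum_cosineError hα hγ hf N g Y Δ hx).tsum_eq, tsum_signFiber]
  refine (enorm_tsum_le_tsum_enorm).trans (ENNReal.tsum_le_tsum fun k => ?_)
  rw [← ofReal_norm, norm_mul, Complex.norm_real, Real.norm_eq_abs]
  have h1 := (mul_le_mul_of_nonneg_left (abs_cosineBasis_le k x) (norm_nonneg _)).trans
    (norm_cosineError_mul_le (hyperbolicCross d α γ (truncation d α γ N)) N g Y Δ f k)
  refine (ENNReal.ofReal_le_ofReal h1).trans (le_of_eq ?_)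
  rw [ENNReal.ofReal_sum_of_nonneg fun _ _ => norm_nonneg _]
  exact Finset.sum_congr rfl fun h _ => ofReal_norm _

theorem summable_norm_coeffError {d : ℕ} {α : ℝ} {γ : ℕ → ℝ} (hα : 1 / 2 < α)
    (hγ : ∀ j, 0 < γ j) {f : (Fin d → ℝ) → ℝ} (hf : f ∈ cosineBall d α γ)
    (A : Finset (Fin d → ℤ)) (N : ℕ) (g : Fin d → ℕ) (Y : List (Fin d → ℝ)) (Δ : Fin d → ℝ) :
    Summable fun h => ‖coeffError A N g Y Δ f h‖ := by
  refine Summable.of_nonneg_of_le (fun _ => norm_nonneg _) (fun h => norm_sub_le _ _)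
    ((summable_norm_tentCoeff hα hγ hf).add ?_)
  refine summable_of_ne_finset_zero (s := A) fun h hh => ?_
  rw [if_neg hh, norm_zero]

theorem lintegral_sub_cosineApprox_le {d : ℕ} {α : ℝ} {γ : ℕ → ℝ} (hα : 1 / 2 < α)
    (hγ : ∀ j, 0 < γ j) {f : (Fin d → ℝ) → ℝ} (hf : f ∈ cosineBall d α γ) (N : ℕ)
    (g : Fin d → ℕ) (Y : List (Fin d → ℝ)) (Δ : Fin d → ℝ) :
    ∫⁻ x in unitCube d, ‖(f x : ℂ) - cosineApprox α γ N g Y Δ f x‖ₑ ^ 2 ≤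
      ∑' h, ‖coeffError (hyperbolicCross d α γ (truncation d α γ N)) N g Y Δ f h‖ₑ ^ 2 := by
  set A := hyperbolicCross d α γ (truncation d α γ N) with hA
  have hsum : Summable fun k => ‖cosineError A N g Y Δ f k‖ := by
    have h1 : ∑' h, ‖coeffError A N g Y Δ f h‖ₑ ≠ ∞ :=
      tsum_enorm_ne_top_iff_summable_norm.2 (summable_norm_coeffError hα hγ hf A N g Y Δ)
    rw [tsum_signFiber] at h1
    refine Summable.of_nonneg_of_le (fun _ => norm_nonneg _) (fun k => ?_)
      (ENNReal.summable_toReal h1)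
    rw [ENNReal.toReal_sum fun _ _ => enorm_ne_top]
    simp only [toReal_enorm]
    refine le_trans ?_ (norm_cosineError_mul_le A N g Y Δ f k)
    exact le_mul_of_one_le_right (norm_nonneg _)
      (one_le_pow₀ (Real.one_le_sqrt.2 one_le_two))
  have hcube : MeasurableSet (unitCube d) := measurableSet_Icc
  rw [MeasureTheory.setLIntegral_congr_fun hcube fun x hx => by
    rw [← (hasSum_cosineError (by linarith) hγ hf N g Y Δ hx).tsum_eq]]
  refine (lintegral_cosineBasis_le hsum).trans ?_
  rw [tsum_signFiber]
  refine ENNReal.tsum_le_tsum fun k => ?_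
  rw [enorm_sq_eq_ofReal]
  refine (ENNReal.ofReal_le_ofReal (norm_cosineError_sq_le A N g Y Δ f k)).trans (le_of_eq ?_)
  rw [ENNReal.ofReal_sum_of_nonneg fun _ _ => by positivity]
  exact Finset.sum_congr rfl fun h _ => (enorm_sq_eq_ofReal _).symm

/-! ### Error bounds in terms of the truncation parameter -/

/-- h need not lie in A, so the set is empty or it is the fiber of any of its members. -/
theorem card_filter_congruent_le {d : ℕ} (A : Finset (Fin d → ℤ)) (N : ℕ) (g : Fin d → ℕ)
    (h : Fin d → ℤ) :
    (A.filter fun k => (N : ℤ) ∣ ∑ j, (h j - k j) * g j).card ≤ maxFiber A N g := by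
  rcases (A.filter fun k => (N : ℤ) ∣ ∑ j, (h j - k j) * g j).eq_empty_or_nonempty with h1 | h1
  · rw [h1]
    exact Nat.zero_le _
  · obtain ⟨k₀, hk₀⟩ := h1
    rw [Finset.mem_filter] at hk₀
    refine (Finset.card_le_card fun k hk => ?_).trans (card_fiber_le hk₀.1)
    rw [Finset.mem_filter] at hk
    refine mem_fiber.2 ⟨hk.1, ?_⟩
    have h2 := dvd_sub hk₀.2 hk.2
    rw [← Finset.sum_sub_distrib] at h2
    refine (congrArg _ (Finset.sum_congr rfl fun j _ => ?_)).mpr h2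
    ring

/-- Exchanging the sums, each outside frequency is counted once for every element of A to which it
aliases. -/
theorem sum_congruent_le {d : ℕ} (A : Finset (Fin d → ℤ)) (N : ℕ) (g : Fin d → ℕ)
    (F : (Fin d → ℤ) → ℝ≥0∞) :
    ∑ k ∈ A, ∑' h, (if h ∉ A ∧ (N : ℤ) ∣ ∑ j, (h j - k j) * g j then F h else 0) ≤
      maxFiber A N g * ∑' h, if h ∈ A then 0 else F h := by
  rw [← Summable.tsum_finsetSum fun _ _ => ENNReal.summable, ← ENNReal.tsum_mul_left]
  refine ENNReal.tsum_le_tsum fun h => ?_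
  by_cases hh : h ∈ A
  · simp [hh]
  · simp only [hh, not_false_eq_true, true_and, if_false]
    rw [← Finset.sum_filter, Finset.sum_const, nsmul_eq_mul]
    exact mul_le_mul' (by exact_mod_cast card_filter_congruent_le A N g h) le_rfl

theorem summable_aliasing {d : ℕ} {α : ℝ} {γ : ℕ → ℝ} (hα : 1 / 2 < α)
    (hγ : ∀ j, 0 < γ j) {f : (Fin d → ℝ) → ℝ} (hf : f ∈ cosineBall d α γ)
    (P : (Fin d → ℤ) → Prop) [DecidablePred P] :
    Summable fun h => ‖if P h then (tentCoeff f h : ℂ) else 0‖ := by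
  refine Summable.of_nonneg_of_le (fun _ => norm_nonneg _) (fun h => ?_)
    (summable_norm_tentCoeff hα hγ hf)
  split_ifs
  · exact le_rfl
  · rw [norm_zero]
    exact norm_nonneg _

theorem enorm_ite_tentCoeff {d : ℕ} (f : (Fin d → ℝ) → ℝ) (p : Prop) [Decidable p]
    (h : Fin d → ℤ) :
    ‖if p then (tentCoeff f h : ℂ) else 0‖ₑ = if p then ‖tentCoeff f h‖ₑ else 0 := by
  split_ifs
  · rw [← ofReal_norm, Complex.norm_real, ofReal_norm]
  · exact enorm_zero

theorem enorm_aliasing_le {d : ℕ} (A : Finset (Fin d → ℤ)) (N : ℕ) (g : Fin d → ℕ)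
    (f : (Fin d → ℝ) → ℝ) (k : Fin d → ℤ) (y : Fin d → ℝ) :
    ‖aliasing A N g f k y‖ₑ ≤ ∑' h : Fin d → ℤ,
      (if h ∉ A ∧ (N : ℤ) ∣ ∑ j, (h j - k j) * g j then ‖tentCoeff f h‖ₑ else 0) := by
  refine enorm_tsum_le_tsum_enorm.trans (ENNReal.tsum_le_tsum fun h => le_of_eq ?_)
  rw [enorm_mul, enorm_ite_tentCoeff, ← ofReal_norm (fourierChar h y), norm_fourierChar,
    ENNReal.ofReal_one, mul_one]

theorem enorm_sub_coeffEstimate_sq_le {d : ℕ} {α : ℝ} {γ : ℕ → ℝ} (hα : 1 / 2 < α)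
    (hγ : ∀ j, 0 < γ j) {f : (Fin d → ℝ) → ℝ} (hf : f ∈ cosineBall d α γ) {N : ℕ} (hN : N ≠ 0)
    {A : Finset (Fin d → ℤ)} {g : Fin d → ℕ} {t : ℝ} (ht0 : 0 < t) (ht1 : t < 1)
    {Y : List (Fin d → ℝ)} (hY : StableShifts A N g t Y) {k : Fin d → ℤ} (hk : k ∈ A)
    (Δ : Fin d → ℝ) :
    ‖(tentCoeff f k : ℂ) - coeffEstimate A N g Y Δ (fun z => f (tent z)) k‖ₑ ^ 2 ≤
      ENNReal.ofReal (1 / (1 - t)) * ((Y.length : ℝ≥0∞)⁻¹ *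
        ∑ s : Fin Y.length, ‖aliasing A N g f k (Y.get s + Δ)‖ₑ ^ 2) := by
  have hS : (0 : ℝ) < Y.length := by exact_mod_cast hY.1
  have h1 := coeffEstimate_sub_sq_le hα hγ hf hN ht0 ht1 hY hk Δ
  have ht : 0 < 1 - t := by linarith
  have h2 : ‖(tentCoeff f k : ℂ) - coeffEstimate A N g Y Δ (fun z => f (tent z)) k‖ ^ 2 ≤
      1 / (1 - t) * ((Y.length : ℝ)⁻¹ *
        ∑ s : Fin Y.length, ‖aliasing A N g f k (Y.get s + Δ)‖ ^ 2) := by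
    rw [one_div_mul_eq_div, le_div_iff₀ ht, inv_mul_eq_div, le_div_iff₀ hS]
    linarith
  rw [enorm_sq_eq_ofReal]
  refine (ENNReal.ofReal_le_ofReal h2).trans (le_of_eq ?_)
  rw [ENNReal.ofReal_mul (by positivity), ENNReal.ofReal_mul (by positivity),
    ENNReal.ofReal_inv_of_pos hS, ENNReal.ofReal_natCast,
    ENNReal.ofReal_sum_of_nonneg fun _ _ => by positivity]
  simp_rw [enorm_sq_eq_ofReal]

theorem tsum_coeffError_eq {d : ℕ} (A : Finset (Fin d → ℤ)) (N : ℕ) (g : Fin d → ℕ)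
    (Y : List (Fin d → ℝ)) (Δ : Fin d → ℝ) (f : (Fin d → ℝ) → ℝ) (p : ℕ) :
    ∑' h, ‖coeffError A N g Y Δ f h‖ₑ ^ p =
      (∑ h ∈ A, ‖(tentCoeff f h : ℂ) - coeffEstimate A N g Y Δ (fun z => f (tent z)) h‖ₑ ^ p) +
        ∑' h, if h ∈ A then 0 else ‖tentCoeff f h‖ₑ ^ p := by
  have h1 : ∑ h ∈ A, ‖(tentCoeff f h : ℂ) -
      coeffEstimate A N g Y Δ (fun z => f (tent z)) h‖ₑ ^ p = ∑' h, if h ∈ A then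
        ‖(tentCoeff f h : ℂ) - coeffEstimate A N g Y Δ (fun z => f (tent z)) h‖ₑ ^ p else 0 := by
    rw [tsum_eq_sum (s := A) fun h hh => if_neg hh]
    exact Finset.sum_congr rfl fun h hh => (if_pos hh).symm
  rw [h1, ← ENNReal.tsum_add]
  refine tsum_congr fun h => ?_
  rw [coeffError]
  split_ifs
  · rw [add_zero]
  · rw [sub_zero, zero_add, ← ofReal_norm, Complex.norm_real, ofReal_norm]

theorem sum_inv_length_mul_le (n : ℕ) (F : Fin n → ℝ≥0∞) {c : ℝ≥0∞} (hF : ∀ s, F s ≤ c) :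
    (n : ℝ≥0∞)⁻¹ * ∑ s, F s ≤ c := by
  rcases Nat.eq_zero_or_pos n with h | h
  · subst h
    simp
  · have h1 : ∑ s, F s ≤ n * c := by
      refine (Finset.sum_le_sum fun s _ => hF s).trans (le_of_eq ?_)
      rw [Finset.sum_const, Finset.card_univ, Fintype.card_fin, nsmul_eq_mul]
    refine (mul_le_mul' le_rfl h1).trans (le_of_eq ?_)
    rw [← mul_assoc, ENNReal.inv_mul_cancel (by exact_mod_cast h.ne') (ENNReal.natCast_ne_top n),
      one_mul]

/-- Deterministic bound: aliasing is at most the ℓ¹ mass of the congruent outside frequencies,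
whatever the shift. Summation over A costs R; the final 1 is the truncation error. -/
theorem tsum_coeffError_le {d : ℕ} {α : ℝ} {γ : ℕ → ℝ} (hα : 1 / 2 < α)
    (hγ : ∀ j, 0 < γ j) {f : (Fin d → ℝ) → ℝ} (hf : f ∈ cosineBall d α γ) {N : ℕ} (hN : N ≠ 0)
    {A : Finset (Fin d → ℤ)} {g : Fin d → ℕ} {t : ℝ} (ht0 : 0 < t) (ht1 : t < 1)
    {Y : List (Fin d → ℝ)} (hY : StableShifts A N g t Y) (Δ : Fin d → ℝ) :
    ∑' h, ‖coeffError A N g Y Δ f h‖ₑ ≤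
      (ENNReal.ofReal (1 / (1 - t)) * maxFiber A N g + 1) *
        ∑' h, if h ∈ A then 0 else ‖tentCoeff f h‖ₑ := by
  have h1 := tsum_coeffError_eq A N g Y Δ f 1
  simp only [pow_one] at h1
  rw [h1, add_mul, one_mul]
  refine add_le_add ?_ le_rfl
  have hc : 1 ≤ ENNReal.ofReal (1 / (1 - t)) :=
    ENNReal.one_le_ofReal.2 ((one_le_div (by linarith)).2 (by linarith))
  have h2 : ∀ k ∈ A, ‖(tentCoeff f k : ℂ) - coeffEstimate A N g Y Δ (fun z => f (tent z)) k‖ₑ ≤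
      ENNReal.ofReal (1 / (1 - t)) * ∑' h : Fin d → ℤ,
        (if h ∉ A ∧ (N : ℤ) ∣ ∑ j, (h j - k j) * g j then ‖tentCoeff f h‖ₑ else 0) := by
    intro k hk
    -- The squares are compared; c ≤ c² for c = 1/(1-t) ≥ 1 avoids a square root.
    rw [← ENNReal.pow_le_pow_left_iff two_ne_zero]
    refine (enorm_sub_coeffEstimate_sq_le hα hγ hf hN ht0 ht1 hY hk Δ).trans ?_
    rw [mul_pow]
    refine mul_le_mul' (le_self_pow₀ hc two_ne_zero) ?_
    exact sum_inv_length_mul_le _ _ fun s => pow_le_pow_left₀ zero_le (enorm_aliasing_le ..) 2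
  refine (Finset.sum_le_sum h2).trans ?_
  rw [← Finset.mul_sum, mul_assoc]
  exact mul_le_mul' le_rfl (sum_congruent_le A N g _)

theorem continuous_aliasing {d : ℕ} {α : ℝ} {γ : ℕ → ℝ} (hα : 1 / 2 < α)
    (hγ : ∀ j, 0 < γ j) {f : (Fin d → ℝ) → ℝ} (hf : f ∈ cosineBall d α γ) (N : ℕ)
    (A : Finset (Fin d → ℤ)) (g : Fin d → ℕ) (k : Fin d → ℤ) :
    Continuous (aliasing A N g f k) := by
  refine continuous_tsum (fun h => ?_) (summable_aliasing hα hγ hf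
    fun h => h ∉ A ∧ (N : ℤ) ∣ ∑ j, (h j - k j) * g j) fun h y => ?_
  · unfold fourierChar
    fun_prop
  · rw [norm_mul, norm_fourierChar, mul_one]

/-- For uniform Δ the characters are orthonormal, so the mean square of the aliasing is an ℓ² sum.
This saves N^(1/2) over the worst case. -/
theorem lintegral_aliasing_le {d : ℕ} {α : ℝ} {γ : ℕ → ℝ} (hα : 1 / 2 < α)
    (hγ : ∀ j, 0 < γ j) {f : (Fin d → ℝ) → ℝ} (hf : f ∈ cosineBall d α γ) (N : ℕ)
    (A : Finset (Fin d → ℤ)) (g : Fin d → ℕ) (k : Fin d → ℤ) (y : Fin d → ℝ) :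
    ∫⁻ Δ in unitCube d, ‖aliasing A N g f k (y + Δ)‖ₑ ^ 2 ≤ ∑' h : Fin d → ℤ,
      (if h ∉ A ∧ (N : ℤ) ∣ ∑ j, (h j - k j) * g j then ‖tentCoeff f h‖ₑ ^ 2 else 0) := by
  have h1 : ∀ h : Fin d → ℤ, ‖(if h ∉ A ∧ (N : ℤ) ∣ ∑ j, (h j - k j) * g j then
      (tentCoeff f h : ℂ) else 0) * fourierChar h y‖ = ‖(if h ∉ A ∧
        (N : ℤ) ∣ ∑ j, (h j - k j) * g j then (tentCoeff f h : ℂ) else 0)‖ := by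
    intro h
    rw [norm_mul, norm_fourierChar, mul_one]
  have h2 := lintegral_fourierChar_le ((summable_aliasing hα hγ hf
    fun h => h ∉ A ∧ (N : ℤ) ∣ ∑ j, (h j - k j) * g j).congr fun h => (h1 h).symm)
  simp only [mul_assoc, ← fourierChar_add] at h2
  refine h2.trans (ENNReal.tsum_le_tsum fun h => le_of_eq ?_)
  rw [← ofReal_norm, h1, ofReal_norm, enorm_ite_tentCoeff]
  split_ifs <;> simp

open MeasureTheory in
theorem lintegral_tsum_coeffError_le {d : ℕ} {α : ℝ} {γ : ℕ → ℝ} (hα : 1 / 2 < α)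
    (hγ : ∀ j, 0 < γ j) {f : (Fin d → ℝ) → ℝ} (hf : f ∈ cosineBall d α γ) {N : ℕ} (hN : N ≠ 0)
    {A : Finset (Fin d → ℤ)} {g : Fin d → ℕ} {t : ℝ} (ht0 : 0 < t) (ht1 : t < 1)
    {Y : List (Fin d → ℝ)} (hY : StableShifts A N g t Y) :
    ∫⁻ Δ in unitCube d, ∑' h, ‖coeffError A N g Y Δ f h‖ₑ ^ 2 ≤
      (ENNReal.ofReal (1 / (1 - t)) * maxFiber A N g + 1) *
        ∑' h, if h ∈ A then 0 else ‖tentCoeff f h‖ₑ ^ 2 := by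
  have hmeas : ∀ (k : Fin d → ℤ) (y : Fin d → ℝ),
      Measurable fun Δ => ‖aliasing A N g f k (y + Δ)‖ₑ ^ 2 := by
    intro k y
    have := (continuous_aliasing hα hγ hf N A g k).measurable
    fun_prop
  calc ∫⁻ Δ in unitCube d, ∑' h, ‖coeffError A N g Y Δ f h‖ₑ ^ 2
      ≤ ∫⁻ Δ in unitCube d, ((∑ k ∈ A, ENNReal.ofReal (1 / (1 - t)) *
          ((Y.length : ℝ≥0∞)⁻¹ * ∑ s : Fin Y.length, ‖aliasing A N g f k (Y.get s + Δ)‖ₑ ^ 2)) +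
            ∑' h, if h ∈ A then 0 else ‖tentCoeff f h‖ₑ ^ 2) := by
        refine lintegral_mono fun Δ => ?_
        rw [tsum_coeffError_eq A N g Y Δ f 2]
        exact add_le_add (Finset.sum_le_sum fun k hk =>
          enorm_sub_coeffEstimate_sq_le hα hγ hf hN ht0 ht1 hY hk Δ) le_rfl
    _ = (∑ k ∈ A, ENNReal.ofReal (1 / (1 - t)) * ((Y.length : ℝ≥0∞)⁻¹ *
          ∑ s : Fin Y.length, ∫⁻ Δ in unitCube d, ‖aliasing A N g f k (Y.get s + Δ)‖ₑ ^ 2)) +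
            ∑' h, if h ∈ A then 0 else ‖tentCoeff f h‖ₑ ^ 2 := by
        rw [lintegral_add_right _ measurable_const, lintegral_const, measure_univ, mul_one,
          lintegral_finsetSum]
        · congr 1
          refine Finset.sum_congr rfl fun k _ => ?_
          rw [lintegral_const_mul, lintegral_const_mul, lintegral_finsetSum]
          · exact fun s _ => hmeas k _
          · exact Finset.measurable_sum _ fun s _ => hmeas k _
          · exact (Finset.measurable_sum _ fun s _ => hmeas k _).const_mul _
        · intro k _
          exact ((Finset.measurable_sum _ fun s _ => hmeas k _).const_mul _).const_mul _
    _ ≤ _ := by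
        rw [add_mul, one_mul]
        refine add_le_add ?_ le_rfl
        rw [mul_assoc]
        refine le_trans ?_ (mul_le_mul' le_rfl (sum_congruent_le A N g _))
        rw [← Finset.mul_sum]
        refine mul_le_mul' le_rfl (Finset.sum_le_sum fun k _ => ?_)
        exact sum_inv_length_mul_le _ _ fun s => lintegral_aliasing_le hα hγ hf N A g k _

theorem le_weight_of_notMem {d : ℕ} {α : ℝ} {γ : ℕ → ℝ} {M : ℝ} (hα : 0 < α)
    (hγ : ∀ j, 0 < γ j) (h : Fin d → ℤ) (hh : h ∉ hyperbolicCross d α γ M) :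
    M ≤ weight α γ h := by
  rw [mem_hyperbolicCross hα hγ] at hh
  exact not_lt.1 hh

theorem worstCaseError_le {d : ℕ} {α : ℝ} {γ : ℕ → ℝ} (hα : 1 / 2 < α)
    (hγ : ∀ j, 0 < γ j) {N : ℕ} (hN : 2 ≤ N) {g : Fin d → ℕ} {t : ℝ} (ht0 : 0 < t) (ht1 : t < 1)
    {Y : List (Fin d → ℝ)}
    (hY : StableShifts (hyperbolicCross d α γ (truncation d α γ N)) N g t Y)
    {p : ℝ} (hp : 1 / α < p) (hp2 : p ≤ 2) :
    worstCaseError d α γ (cosineApprox α γ N g Y 0) ≤ ENNReal.ofReal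
      ((1 / (1 - t) * maxFiber (hyperbolicCross d α γ (truncation d α γ N)) N g + 1) *
        (zetaProd d α γ p ^ (1 / 2 : ℝ) * truncation d α γ N ^ (-1 + p / 2))) := by
  have hα0 : 0 < α := by linarith
  have ht : 0 < 1 - t := by linarith
  refine iSup₂_le fun f hf => iSup₂_le fun x hx => ?_
  refine (enorm_sub_cosineApprox_le hα0 hγ hf N g Y 0 hx).trans ?_
  refine (tsum_coeffError_le hα hγ hf (by omega) ht0 ht1 hY 0).trans ?_
  rw [ENNReal.ofReal_mul (by positivity), ENNReal.ofReal_add (by positivity) zero_le_one,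
    ENNReal.ofReal_mul (by positivity), ENNReal.ofReal_natCast, ENNReal.ofReal_one]
  exact mul_le_mul' le_rfl (tail_le hα hγ hf (truncation_pos hα hγ hN)
    (le_weight_of_notMem hα0 hγ) hp hp2)

theorem randomizedError_le {d : ℕ} {α : ℝ} {γ : ℕ → ℝ} (hα : 1 / 2 < α)
    (hγ : ∀ j, 0 < γ j) {N : ℕ} (hN : 2 ≤ N) {g : Fin d → ℕ} {t : ℝ} (ht0 : 0 < t) (ht1 : t < 1)
    {Y : List (Fin d → ℝ)}
    (hY : StableShifts (hyperbolicCross d α γ (truncation d α γ N)) N g t Y) :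
    randomizedError d α γ (cosineApprox α γ N g Y) ≤ ENNReal.ofReal
      ((1 / (1 - t) * maxFiber (hyperbolicCross d α γ (truncation d α γ N)) N g + 1) *
        truncation d α γ N ^ (-1 : ℝ)) := by
  have hα0 : 0 < α := by linarith
  have ht : 0 < 1 - t := by linarith
  have hM := truncation_pos hα hγ hN (d := d)
  set F : ℝ := 1 / (1 - t) * maxFiber (hyperbolicCross d α γ (truncation d α γ N)) N g + 1 with hF
  have hF1 : 1 ≤ F := by
    have : 0 ≤ 1 / (1 - t) * maxFiber (hyperbolicCross d α γ (truncation d α γ N)) N g := by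
      positivity
    linarith
  refine iSup₂_le fun f hf => ?_
  have h1 : ∫⁻ Δ in unitCube d, ∫⁻ x in unitCube d,
      ‖(f x : ℂ) - cosineApprox α γ N g Y Δ f x‖ₑ ^ 2 ≤
        ENNReal.ofReal (F * truncation d α γ N ^ (-2 : ℝ)) := by
    refine (MeasureTheory.lintegral_mono fun Δ =>
      lintegral_sub_cosineApprox_le hα hγ hf N g Y Δ).trans ?_
    refine (lintegral_tsum_coeffError_le hα hγ hf (by omega) ht0 ht1 hY).trans ?_
    rw [ENNReal.ofReal_mul (by positivity), hF, ENNReal.ofReal_add (by positivity) zero_le_one,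
      ENNReal.ofReal_mul (by positivity), ENNReal.ofReal_natCast, ENNReal.ofReal_one]
    exact mul_le_mul' le_rfl (tail_sq_le hf hM (le_weight_of_notMem hα0 hγ))
  refine (ENNReal.rpow_le_rpow h1 (by norm_num)).trans ?_
  rw [ENNReal.ofReal_rpow_of_nonneg (by positivity) (by norm_num)]
  refine ENNReal.ofReal_le_ofReal ?_
  rw [Real.mul_rpow (by positivity) (by positivity), ← Real.rpow_mul hM.le]
  norm_num only
  refine mul_le_mul_of_nonneg_right ?_ (by positivity)
  -- √F ≤ F suffices: F is of logarithmic size and is later absorbed into N^ε.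
  exact (Real.rpow_le_rpow_of_exponent_le hF1 (by norm_num)).trans_eq (Real.rpow_one F)

/-! ### Rates up to an arbitrarily small power of N -/

theorem exists_log_rpow_le (r : ℝ) {δ : ℝ} (hδ : 0 < δ) :
    ∃ K : ℝ, 0 < K ∧ ∀ x : ℝ, 2 ≤ x → Real.log x ^ r ≤ K * x ^ δ := by
  have hlog2 : 0 < Real.log 2 := Real.log_pos one_lt_two
  rcases le_or_gt r 0 with hr | hr
  · refine ⟨Real.log 2 ^ r, by positivity, fun x hx => ?_⟩
    have h1 : Real.log x ^ r ≤ Real.log 2 ^ r :=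
      Real.rpow_le_rpow_of_nonpos hlog2 (Real.log_le_log two_pos hx) hr
    exact h1.trans (le_mul_of_one_le_right (by positivity)
      (Real.one_le_rpow (by linarith) hδ.le))
  · refine ⟨(1 / (δ / r)) ^ r, by positivity, fun x hx => ?_⟩
    have h1 := Real.log_le_rpow_div (by linarith : 0 ≤ x) (div_pos hδ hr)
    have h2 := Real.rpow_le_rpow (Real.log_nonneg (by linarith)) h1 hr.le
    rw [div_eq_mul_one_div, Real.mul_rpow (by positivity) (by positivity),
      ← Real.rpow_mul (by linarith), div_mul_cancel₀ _ hr.ne', mul_comm] at h2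
    exact h2

theorem stableShifts_adaptiveShifts {d : ℕ} (α : ℝ) (γ : ℕ → ℝ) (N : ℕ) (g : Fin d → ℕ) {t : ℝ}
    (ht0 : 0 < t) (ht1 : t < 1) :
    StableShifts (hyperbolicCross d α γ (truncation d α γ N)) N g t
      (adaptiveShifts α γ N g t) :=
  have h := adaptiveShifts_spec α γ N g ht0 ht1 rfl rfl rfl rfl
  ⟨h.1, h.2.1⟩

theorem exists_maxFiber_le_rpow {d : ℕ} (hd : 1 ≤ d) {α : ℝ} (hα : 1 / 2 < α) {γ : ℕ → ℝ}
    (hγ : ∀ j, 0 < γ j) {t : ℝ} (ht1 : t < 1) {δ : ℝ} (hδ : 0 < δ) :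
    ∃ K : ℝ, 0 < K ∧ ∀ (N : ℕ) (g : Fin d → ℕ), N.Prime → IsGeneratingVector α γ N g →
      1 / (1 - t) * maxFiber (hyperbolicCross d α γ (truncation d α γ N)) N g + 1 ≤
        K * (N : ℝ) ^ δ := by
  obtain ⟨K₁, hK₁, h1⟩ := exists_maxFiber_le hd hα hγ
  obtain ⟨K₂, hK₂, h2⟩ := exists_log_rpow_le ((d - 1 : ℕ) : ℝ) hδ
  have ht : 0 < 1 - t := by linarith
  refine ⟨1 / (1 - t) * (K₁ * K₂) + 1, by positivity, fun N g hN hg => ?_⟩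
  have hN2 : (2 : ℝ) ≤ N := by exact_mod_cast hN.two_le
  have h3 := h2 N hN2
  rw [Real.rpow_natCast] at h3
  have h4 := (h1 N g hN hg).trans (mul_le_mul_of_nonneg_left h3 hK₁.le)
  have h5 : 1 ≤ (N : ℝ) ^ δ := Real.one_le_rpow (by linarith) hδ.le
  have h6 := mul_le_mul_of_nonneg_left h4 (by positivity : 0 ≤ 1 / (1 - t))
  linarith

theorem exists_worstCaseError_le {d : ℕ} (hd : 1 ≤ d) {α : ℝ} (hα : 1 / 2 < α) {γ : ℕ → ℝ}
    (hγ : ∀ j, 0 < γ j) {t : ℝ} (ht0 : 0 < t) (ht1 : t < 1) {ε : ℝ} (hε : 0 < ε) :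
    ∃ K : ℝ, 0 < K ∧ ∀ (N : ℕ) (g : Fin d → ℕ), N.Prime → IsGeneratingVector α γ N g →
      worstCaseError d α γ (cosineApprox α γ N g (adaptiveShifts α γ N g t) 0) ≤
        ENNReal.ofReal (K * (N : ℝ) ^ (-α + 1 / 2 + ε)) := by
  have hα0 : 0 < α := by linarith
  obtain ⟨K, hK, hR⟩ := exists_maxFiber_le_rpow hd hα hγ ht1 (by positivity : 0 < ε / 3)
  obtain ⟨c, hc, hM⟩ := exists_le_truncation d hα hγ (by positivity : 0 < ε / 3)
  have hα2 : 0 < 2 - 1 / α := by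
    rw [sub_pos, div_lt_iff₀ hα0]
    linarith
  -- One third of ε is spent on the fiber length, one on the gap between M and N^α, one on the
  -- excess of p over 1/α. The second bound keeps p < 2.
  set η := min (ε / (3 * α)) ((2 - 1 / α) / 4) with hη
  have hη0 : 0 < η := lt_min (by positivity) (by positivity)
  have hη1 : η ≤ ε / (3 * α) := min_le_left _ _
  have hη2 : η ≤ (2 - 1 / α) / 4 := min_le_right _ _
  set p := 1 / α + 2 * η with hp
  have hp1 : 1 / α < p := by linarith
  have hp2 : p < 2 := by linarith
  have hp0 : 0 < p := (by positivity : 0 < 1 / α).trans hp1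
  have hz : 0 < zetaProd d α γ p := lt_of_lt_of_le one_pos
    (one_le_zetaProd hγ (one_lt_mul_of_one_div_lt hα0 hp1))
  refine ⟨K * (zetaProd d α γ p ^ (1 / 2 : ℝ) * c ^ (-1 + p / 2)), by positivity,
    fun N g hN hg => ?_⟩
  have hN1 : (1 : ℝ) ≤ N := by exact_mod_cast hN.one_lt.le
  have hN0 : (0 : ℝ) < N := by linarith
  refine (worstCaseError_le hα hγ hN.two_le ht0 ht1
    (stableShifts_adaptiveShifts α γ N g ht0 ht1) hp1 hp2.le).trans (ENNReal.ofReal_le_ofReal ?_)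
  have h1 : truncation d α γ N ^ (-1 + p / 2) ≤
      c ^ (-1 + p / 2) * (N : ℝ) ^ ((α - ε / 3) * (-1 + p / 2)) := by
    rw [Real.rpow_mul hN0.le, ← Real.mul_rpow hc.le (by positivity)]
    exact Real.rpow_le_rpow_of_nonpos (by positivity) (hM N hN.two_le) (by linarith)
  have h2 : (N : ℝ) ^ (ε / 3) * (N : ℝ) ^ ((α - ε / 3) * (-1 + p / 2)) ≤
      (N : ℝ) ^ (-α + 1 / 2 + ε) := by
    rw [← Real.rpow_add hN0]
    refine Real.rpow_le_rpow_of_exponent_le hN1 ?_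
    have h3 : α * p = 1 + 2 * (α * η) := by
      rw [hp]
      field_simp
    have h4 : α * η ≤ ε / 3 := by
      calc α * η ≤ α * (ε / (3 * α)) := mul_le_mul_of_nonneg_left hη1 hα0.le
        _ = ε / 3 := by field_simp
    nlinarith [mul_pos hε hp0]
  calc _ ≤ K * (N : ℝ) ^ (ε / 3) * (zetaProd d α γ p ^ (1 / 2 : ℝ) *
        (c ^ (-1 + p / 2) * (N : ℝ) ^ ((α - ε / 3) * (-1 + p / 2)))) := by
        refine mul_le_mul (hR N g hN hg) (mul_le_mul_of_nonneg_left h1 (by positivity)) ?_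
          (by positivity)
        have := (truncation_pos hα hγ hN.two_le (d := d)).le
        positivity
    _ = K * (zetaProd d α γ p ^ (1 / 2 : ℝ) * c ^ (-1 + p / 2)) *
        ((N : ℝ) ^ (ε / 3) * (N : ℝ) ^ ((α - ε / 3) * (-1 + p / 2))) := by ring
    _ ≤ _ := mul_le_mul_of_nonneg_left h2 (by positivity)

theorem exists_randomizedError_le {d : ℕ} (hd : 1 ≤ d) {α : ℝ} (hα : 1 / 2 < α) {γ : ℕ → ℝ}
    (hγ : ∀ j, 0 < γ j) {t : ℝ} (ht0 : 0 < t) (ht1 : t < 1) {ε : ℝ} (hε : 0 < ε) :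
    ∃ K : ℝ, 0 < K ∧ ∀ (N : ℕ) (g : Fin d → ℕ), N.Prime → IsGeneratingVector α γ N g →
      randomizedError d α γ (cosineApprox α γ N g (adaptiveShifts α γ N g t)) ≤
        ENNReal.ofReal (K * (N : ℝ) ^ (-α + ε)) := by
  obtain ⟨K, hK, hR⟩ := exists_maxFiber_le_rpow hd hα hγ ht1 (by positivity : 0 < ε / 2)
  obtain ⟨c, hc, hM⟩ := exists_le_truncation d hα hγ (by positivity : 0 < ε / 2)
  refine ⟨K * c ^ (-1 : ℝ), by positivity, fun N g hN hg => ?_⟩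
  have hN0 : (0 : ℝ) < N := by exact_mod_cast hN.pos
  refine (randomizedError_le hα hγ hN.two_le ht0 ht1
    (stableShifts_adaptiveShifts α γ N g ht0 ht1)).trans (ENNReal.ofReal_le_ofReal ?_)
  have h1 : truncation d α γ N ^ (-1 : ℝ) ≤ c ^ (-1 : ℝ) * (N : ℝ) ^ ((α - ε / 2) * (-1)) := by
    rw [Real.rpow_mul hN0.le, ← Real.mul_rpow hc.le (by positivity)]
    exact Real.rpow_le_rpow_of_nonpos (by positivity) (hM N hN.two_le) (by norm_num)
  calc _ ≤ K * (N : ℝ) ^ (ε / 2) * (c ^ (-1 : ℝ) * (N : ℝ) ^ ((α - ε / 2) * (-1))) := by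
        refine mul_le_mul (hR N g hN hg) h1 ?_ (by positivity)
        have := (truncation_pos hα hγ hN.two_le (d := d)).le
        positivity
    _ = K * c ^ (-1 : ℝ) * ((N : ℝ) ^ (ε / 2) * (N : ℝ) ^ ((α - ε / 2) * (-1))) := by ring
    _ = _ := by
        rw [← Real.rpow_add hN0]
        congr 2
        ring

/-! ### Bounds with logarithmic factors -/

/-- If `E = O(N ^ (a + ε))` for all positive `ε`, and `S = O((log N) ^ (2 d))`, then `E` has the
bounds of the theorem, in terms of `N` and in terms of `N S`, with all large enough constants. -/
theorem exists_log_bounds {ι : Type*} (N S : ι → ℕ) (E : ι → ℝ≥0∞) (hN : ∀ i, 2 ≤ N i)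
    (hS : ∀ i, 1 ≤ S i) {d : ℕ} (hd : 1 ≤ d) {K : ℝ} (hK : 0 < K)
    (hSN : ∀ i, (S i : ℝ) ≤ K * Real.log (N i) ^ (2 * d)) (a : ℝ)
    (hE : ∀ ε : ℝ, 0 < ε → ∃ K : ℝ, 0 < K ∧ ∀ i, E i ≤ ENNReal.ofReal (K * (N i : ℝ) ^ (a + ε)))
    {τ : ℝ} (hτ : 0 < τ) {b : ℝ} (hb : b = ((d : ℝ) - 1) / 2 - 2 * (a + τ) * d) :
    ∃ C₀ : ℝ, 0 < C₀ ∧ ∀ C, C₀ ≤ C → ∃ C₁ : ℝ, 0 < C₁ ∧ ∀ C', C₁ ≤ C' → ∀ i,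
      E i ≤ ENNReal.ofReal (C * (Real.log (N i) ^ (((d : ℝ) - 1) / 2) * (N i : ℝ) ^ (a + τ))) ∧
      E i ≤ ENNReal.ofReal (C' * (Real.log ((N i * S i : ℕ) : ℝ) ^ b *
        ((N i * S i : ℕ) : ℝ) ^ (a + τ))) ∧
      (a + τ ≤ 0 → C * (Real.log (N i) ^ (((d : ℝ) - 1) / 2) * (N i : ℝ) ^ (a + τ)) ≤
        C' * (Real.log ((N i * S i : ℕ) : ℝ) ^ b * ((N i * S i : ℕ) : ℝ) ^ (a + τ))) := by
  have hlog2 : 0 < Real.log 2 := Real.log_pos one_lt_two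
  have hd1 : 0 ≤ ((d : ℝ) - 1) / 2 := by
    have : (1 : ℝ) ≤ d := by exact_mod_cast hd
    linarith
  have hN2 : ∀ i, (2 : ℝ) ≤ N i := fun i => by exact_mod_cast hN i
  have hNT : ∀ i, (N i : ℝ) ≤ ((N i * S i : ℕ) : ℝ) := fun i => by
    exact_mod_cast Nat.le_mul_of_pos_right _ (hS i)
  have hL : ∀ i, Real.log 2 ≤ Real.log (N i) := fun i => Real.log_le_log two_pos (hN2 i)
  obtain ⟨K₀, hK₀, hE₀⟩ := hE τ hτ
  refine ⟨K₀ * Real.log 2 ^ (-(((d : ℝ) - 1) / 2)), by positivity, fun C hC => ?_⟩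
  have hC0 : 0 < C := lt_of_lt_of_le (by positivity) hC
  have hfirst : ∀ i, E i ≤ ENNReal.ofReal
      (C * (Real.log (N i) ^ (((d : ℝ) - 1) / 2) * (N i : ℝ) ^ (a + τ))) := by
    intro i
    refine (hE₀ i).trans (ENNReal.ofReal_le_ofReal ?_)
    rw [← mul_assoc]
    refine mul_le_mul_of_nonneg_right ?_ (by positivity)
    -- log N ≥ log 2, so the logarithmic factor only costs a constant.
    calc K₀ = K₀ * Real.log 2 ^ (-(((d : ℝ) - 1) / 2)) * Real.log 2 ^ (((d : ℝ) - 1) / 2) := by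
          rw [mul_assoc, ← Real.rpow_add hlog2, neg_add_cancel, Real.rpow_zero, mul_one]
      _ ≤ _ := mul_le_mul hC (Real.rpow_le_rpow hlog2.le (hL i) hd1) (by positivity) hC0.le
  rcases le_or_gt (a + τ) 0 with ha | ha
  · refine ⟨C * K ^ (-(a + τ)), by positivity, fun C' hC' i => ?_⟩
    have hNi := hN2 i
    have hN0 : (0 : ℝ) < N i := by linarith
    have hLi : 0 < Real.log (N i) := hlog2.trans_le (hL i)
    have hS0 : (0 : ℝ) < S i := by exact_mod_cast hS i
    have hb0 : 0 ≤ b := by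
      rw [hb]
      nlinarith [mul_nonneg (neg_nonneg.2 ha) (Nat.cast_nonneg d : (0 : ℝ) ≤ d)]
    have hthird : C * (Real.log (N i) ^ (((d : ℝ) - 1) / 2) * (N i : ℝ) ^ (a + τ)) ≤
        C' * (Real.log ((N i * S i : ℕ) : ℝ) ^ b * ((N i * S i : ℕ) : ℝ) ^ (a + τ)) := by
      have h1 : Real.log (N i) ^ b ≤ Real.log ((N i * S i : ℕ) : ℝ) ^ b :=
        Real.rpow_le_rpow hLi.le (Real.log_le_log hN0 (hNT i)) hb0
      -- A non-positive exponent reverses S ≤ K (log N)^(2d): S^(a+τ) is at least a constant times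
      -- (log N)^(2d(a+τ)). The number b compensates precisely for this loss, and b ≥ 0 lets log N
      -- grow to log (NS).
      have h2 : (N i : ℝ) ^ (a + τ) * (K ^ (a + τ) * Real.log (N i) ^ (2 * (a + τ) * d)) ≤
          ((N i * S i : ℕ) : ℝ) ^ (a + τ) := by
        rw [Nat.cast_mul, Real.mul_rpow hN0.le hS0.le]
        refine mul_le_mul_of_nonneg_left ?_ (by positivity)
        have h3 := Real.rpow_le_rpow_of_nonpos hS0 (hSN i) ha
        rw [Real.mul_rpow hK.le (by positivity), ← Real.rpow_natCast_mul hLi.le] at h3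
        refine le_of_eq_of_le ?_ h3
        congr 2
        push_cast
        ring
      calc C * (Real.log (N i) ^ (((d : ℝ) - 1) / 2) * (N i : ℝ) ^ (a + τ))
          = C * K ^ (-(a + τ)) * (Real.log (N i) ^ b * ((N i : ℝ) ^ (a + τ) *
              (K ^ (a + τ) * Real.log (N i) ^ (2 * (a + τ) * d)))) := by
            have h4 : Real.log (N i) ^ (((d : ℝ) - 1) / 2) =
                Real.log (N i) ^ b * Real.log (N i) ^ (2 * (a + τ) * d) := by
              rw [← Real.rpow_add hLi, hb]
              congr 1
              ring
            have h5 : K ^ (-(a + τ)) * K ^ (a + τ) = 1 := by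
              rw [← Real.rpow_add hK, neg_add_cancel, Real.rpow_zero]
            rw [h4]
            linear_combination (-C * Real.log (N i) ^ b * (N i : ℝ) ^ (a + τ) *
              Real.log (N i) ^ (2 * (a + τ) * d)) * h5
        _ ≤ _ := by
            refine mul_le_mul hC' (mul_le_mul h1 h2 (by positivity) (by positivity))
              (by positivity) (le_trans (by positivity) hC')
    exact ⟨hfirst i, (hfirst i).trans (ENNReal.ofReal_le_ofReal hthird), fun _ => hthird⟩
  -- Now b may be negative. An exponent a' strictly between max(a, 0) and a + τ is used instead:
  -- positivity gives N^(a') ≤ (NS)^(a'), and the slack a + τ - a' absorbs the logarithm.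
  · have hlt : max (a + τ / 2) ((a + τ) / 2) < a + τ := max_lt (by linarith) (by linarith)
    have hle1 : a + τ / 2 ≤ max (a + τ / 2) ((a + τ) / 2) := le_max_left _ _
    have hle2 : (a + τ) / 2 ≤ max (a + τ / 2) ((a + τ) / 2) := le_max_right _ _
    generalize max (a + τ / 2) ((a + τ) / 2) = a' at hlt hle1 hle2
    obtain ⟨K₁, hK₁, hE₁⟩ := hE (a' - a) (by linarith)
    obtain ⟨K₂, hK₂, hlog⟩ := exists_log_rpow_le (-b) (by linarith : 0 < a + τ - a')
    refine ⟨K₁ * K₂, by positivity, fun C' hC' i => ⟨hfirst i, ?_, fun h => absurd h ha.not_ge⟩⟩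
    refine (hE₁ i).trans (ENNReal.ofReal_le_ofReal ?_)
    rw [add_sub_cancel]
    have hT2 := (hN2 i).trans (hNT i)
    have h1 := hlog _ hT2
    have h2 : (N i : ℝ) ^ a' ≤ ((N i * S i : ℕ) : ℝ) ^ a' :=
      Real.rpow_le_rpow (Nat.cast_nonneg _) (hNT i) (by linarith)
    generalize ((N i * S i : ℕ) : ℝ) = T at hT2 h1 h2 ⊢
    have hT0 : 0 < T := by linarith
    have hLT : 0 < Real.log T := Real.log_pos (by linarith)
    calc K₁ * (N i : ℝ) ^ a' ≤ K₁ * T ^ a' := mul_le_mul_of_nonneg_left h2 hK₁.le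
      _ = K₁ * (Real.log T ^ (-b) * (Real.log T ^ b * T ^ a')) := by
          rw [← mul_assoc (Real.log T ^ (-b)), ← Real.rpow_add hLT, neg_add_cancel,
            Real.rpow_zero, one_mul]
      _ ≤ K₁ * (K₂ * T ^ (a + τ - a') * (Real.log T ^ b * T ^ a')) := by
          refine mul_le_mul_of_nonneg_left ?_ hK₁.le
          exact mul_le_mul_of_nonneg_right h1 (by positivity)
      _ = K₁ * K₂ * (Real.log T ^ b * T ^ (a + τ)) := by
          have : T ^ (a + τ) = T ^ (a + τ - a') * T ^ a' := by
            rw [← Real.rpow_add hT0, sub_add_cancel]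
          rw [this]
          ring
      _ ≤ _ := mul_le_mul_of_nonneg_right hC' (by positivity)

end

end MultiShift

/-! ### The main theorem -/

theorem theorem7p2 (d : ℕ) (hd : 1 ≤ d) (α : ℝ) (hα : 1 / 2 < α)
    (γ : ℕ → ℝ) (hγ : ∀ j, 0 < γ j) (t : ℝ) (ht0 : 0 < t) (ht1 : t < 1)
    (τ : ℝ) (hτ0 : 0 < τ) (hτ1 : τ ≤ 1) :
    ∃ C C' : ℝ, 0 < C ∧ 0 < C' ∧
      ∀ (N : ℕ) (g : Fin d → ℕ), N.Prime → MultiShift.IsGeneratingVector α γ N g →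
        ∀ (Y : List (Fin d → ℝ)), Y = MultiShift.adaptiveShifts α γ N g t →
        ∀ Ntot : ℕ, Ntot = N * Y.length →
          -- worst-case error in the supremum norm, with the unshifted algorithm
          (MultiShift.worstCaseError d α γ (MultiShift.cosineApprox α γ N g Y 0) ≤
              ENNReal.ofReal (C * (Real.log N ^ (((d : ℝ) - 1) / 2) *
                (N : ℝ) ^ (-α + 1 / 2 + τ))) ∧
            MultiShift.worstCaseError d α γ (MultiShift.cosineApprox α γ N g Y 0) ≤
              ENNReal.ofReal (C' * (Real.log Ntot ^ ((2 * α - 2 * τ - 1 / 2) * (d : ℝ) - 1 / 2) *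
                (Ntot : ℝ) ^ (-α + 1 / 2 + τ))) ∧
            (-α + 1 / 2 + τ ≤ 0 →
              C * (Real.log N ^ (((d : ℝ) - 1) / 2) * (N : ℝ) ^ (-α + 1 / 2 + τ)) ≤
                C' * (Real.log Ntot ^ ((2 * α - 2 * τ - 1 / 2) * (d : ℝ) - 1 / 2) *
                  (Ntot : ℝ) ^ (-α + 1 / 2 + τ)))) ∧
          -- randomized root-mean-square error, with a uniformly distributed global shift
          (MultiShift.randomizedError d α γ (MultiShift.cosineApprox α γ N g Y) ≤
              ENNReal.ofReal (C * (Real.log N ^ (((d : ℝ) - 1) / 2) * (N : ℝ) ^ (-α + τ))) ∧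
            MultiShift.randomizedError d α γ (MultiShift.cosineApprox α γ N g Y) ≤
              ENNReal.ofReal (C' * (Real.log Ntot ^ ((2 * α - 2 * τ + 1 / 2) * (d : ℝ) - 1 / 2) *
                (Ntot : ℝ) ^ (-α + τ))) ∧
            (-α + τ ≤ 0 →
              C * (Real.log N ^ (((d : ℝ) - 1) / 2) * (N : ℝ) ^ (-α + τ)) ≤
                C' * (Real.log Ntot ^ ((2 * α - 2 * τ + 1 / 2) * (d : ℝ) - 1 / 2) *
                  (Ntot : ℝ) ^ (-α + τ)))) := by
  -- Indexing by all admissible pairs (N, g) makes the constants uniform.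
  set I := {q : ℕ × (Fin d → ℕ) // q.1.Prime ∧ MultiShift.IsGeneratingVector α γ q.1 q.2} with hI
  obtain ⟨K, hK, hlen⟩ := MultiShift.exists_length_adaptiveShifts_le hd hα hγ ht0 ht1
  have hS : ∀ q : I, 1 ≤ (MultiShift.adaptiveShifts α γ q.1.1 q.1.2 t).length := fun q =>
    (MultiShift.stableShifts_adaptiveShifts α γ q.1.1 q.1.2 ht0 ht1).1
  obtain ⟨C₁, hC₁, h1⟩ := MultiShift.exists_log_bounds (fun q : I => q.1.1)
    (fun q : I => (MultiShift.adaptiveShifts α γ q.1.1 q.1.2 t).length)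
    (fun q : I => MultiShift.worstCaseError d α γ (MultiShift.cosineApprox α γ q.1.1 q.1.2
      (MultiShift.adaptiveShifts α γ q.1.1 q.1.2 t) 0)) (fun q => q.2.1.two_le) hS hd hK
    (fun q => hlen q.1.1 q.1.2 q.2.1 q.2.2) (-α + 1 / 2) (fun ε hε => by
      obtain ⟨K, hK, h⟩ := MultiShift.exists_worstCaseError_le hd hα hγ ht0 ht1 hε
      exact ⟨K, hK, fun q => h q.1.1 q.1.2 q.2.1 q.2.2⟩) hτ0
    (b := (2 * α - 2 * τ - 1 / 2) * (d : ℝ) - 1 / 2) (by ring)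
  obtain ⟨C₂, hC₂, h2⟩ := MultiShift.exists_log_bounds (fun q : I => q.1.1)
    (fun q : I => (MultiShift.adaptiveShifts α γ q.1.1 q.1.2 t).length)
    (fun q : I => MultiShift.randomizedError d α γ (MultiShift.cosineApprox α γ q.1.1 q.1.2
      (MultiShift.adaptiveShifts α γ q.1.1 q.1.2 t))) (fun q => q.2.1.two_le) hS hd hK
    (fun q => hlen q.1.1 q.1.2 q.2.1 q.2.2) (-α) (fun ε hε => by
      obtain ⟨K, hK, h⟩ := MultiShift.exists_randomizedError_le hd hα hγ ht0 ht1 hε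
      exact ⟨K, hK, fun q => h q.1.1 q.1.2 q.2.1 q.2.2⟩) hτ0
    (b := (2 * α - 2 * τ + 1 / 2) * (d : ℝ) - 1 / 2) (by ring)
  -- Both lines share C and C'. Since the final comparisons need C' large relative to C, the common
  -- C is fixed first.
  obtain ⟨C₁', hC₁', h3⟩ := h1 (max C₁ C₂) (le_max_left _ _)
  obtain ⟨C₂', hC₂', h4⟩ := h2 (max C₁ C₂) (le_max_right _ _)
  refine ⟨max C₁ C₂, max C₁' C₂', lt_max_of_lt_left hC₁, lt_max_of_lt_left hC₁', ?_⟩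
  rintro N g hN hg Y rfl Ntot rfl
  exact ⟨h3 _ (le_max_left _ _) ⟨(N, g), hN, hg⟩, h4 _ (le_max_right _ _) ⟨(N, g), hN, hg⟩⟩
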